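/- Let $X$ be a compact complex manifold of complex dimension $n\ge 3$ with a nowhere vanishing holomorphic $(n,0)$-form $\Omega$. For a Hermitian metric with Kähler form $\omega=i\sum g_{\bar kj}\,dz^j\wedge d\bar z^k$, let $\|\Omega\|_\omega>0$ be defined by $\|\Omega\|_\omega^2\,\omega^n=i^{n^2}\,n!\,\Omega\wedge\bar\Omega$. Let $\omega(t)$, $t\in[0,T)$, be a smooth family of Hermitian metrics on $X$ solving the Anomaly flow $$\partial_t\big(\|\Omega\|_{\omega}\,\omega^{n-1}\big)=i\partial\bar\partial\,\omega^{n-2},$$ with conformally balanced initial metric, i.e. $d\big(\|\Omega\|_{\omega(0)}\,\omega(0)^{n-1}\big)=0$. If, for some $t_0\in[0,T)$, the metric $\omega(t_0)$ is a stationary point of the flow (that is, the family that is constantly equal to $\omega(t_0)$ solves the flow equation), then $\omega(t_0)$ is a Ricci-flat Kähler metric: $d\omega(t_0)=0$, and the Ricci curvature $R_{\bar kj}=\sum_p R_{\bar kj}{}^p{}_p$ of its Chern connection, where $R_{\bar kj}{}^p{}_q=-\partial_{\bar k}\big(\sum_l g^{p\bar l}\partial_jg_{\bar lq}\big)$, vanishes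 identically. In particular, every conformally balanced Hermitian metric on $X$ that is a stationary point of the flow is Kähler and Ricci-flat. -/

import Mathlib

open scoped Manifold ContDiff

noncomputable section

namespace AnomalyFlow

/-! ### Wedge products of complex valued real-multilinear alternating forms -/

section LinearAlgebra

variable {V : Type*} [AddCommGroup V] [Module ℝ V] [TopologicalSpace V]

/-- The (not yet alternating) product `v ↦ α (v₀, …, v_{k-1}) * β (v_k, …, v_{k+l-1})`. -/
def mulMultilinear {k l : ℕ} (α : V [⋀^Fin k]→L[ℝ] ℂ) (β : V [⋀^Fin l]→L[ℝ] ℂ) :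
    ContinuousMultilinearMap ℝ (fun _ : Fin (k + l) => V) ℂ where
  toFun v := α (fun i => v (Fin.castAdd l i)) * β (fun i => v (Fin.natAdd k i))
  map_update_add' := by
    intro _ v i x y
    refine Fin.addCases (fun a => ?_) (fun b => ?_) i
    · have h1 (z : V) : (fun j => Function.update v (Fin.castAdd l a) z (Fin.castAdd l j)) =
          Function.update (fun j => v (Fin.castAdd l j)) a z :=
        Function.update_comp_eq_of_injective v (Fin.castAdd_injective k l) a z
      have h2 (z : V) : (fun j => Function.update v (Fin.castAdd l a) z (Fin.natAdd k j)) =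
          fun j => v (Fin.natAdd k j) := by
        funext j
        refine Function.update_of_ne ?_ z v
        simp only [ne_eq, Fin.ext_iff, Fin.val_natAdd, Fin.val_castAdd]
        omega
      simp only [h1, h2, α.map_update_add, add_mul]
    · have h1 (z : V) : (fun j => Function.update v (Fin.natAdd k b) z (Fin.natAdd k j)) =
          Function.update (fun j => v (Fin.natAdd k j)) b z :=
        Function.update_comp_eq_of_injective v (Fin.natAdd_injective l k) b z
      have h2 (z : V) : (fun j => Function.update v (Fin.natAdd k b) z (Fin.castAdd l j)) =
          fun j => v (Fin.castAdd l j) := by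
        funext j
        refine Function.update_of_ne ?_ z v
        simp only [ne_eq, Fin.ext_iff, Fin.val_natAdd, Fin.val_castAdd]
        omega
      simp only [h1, h2, β.map_update_add, mul_add]
  map_update_smul' := by
    intro _ v i c x
    refine Fin.addCases (fun a => ?_) (fun b => ?_) i
    · have h1 (z : V) : (fun j => Function.update v (Fin.castAdd l a) z (Fin.castAdd l j)) =
          Function.update (fun j => v (Fin.castAdd l j)) a z :=
        Function.update_comp_eq_of_injective v (Fin.castAdd_injective k l) a z
      have h2 (z : V) : (fun j => Function.update v (Fin.castAdd l a) z (Fin.natAdd k j)) =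
          fun j => v (Fin.natAdd k j) := by
        funext j
        refine Function.update_of_ne ?_ z v
        simp only [ne_eq, Fin.ext_iff, Fin.val_natAdd, Fin.val_castAdd]
        omega
      simp only [h1, h2, α.map_update_smul, smul_mul_assoc]
    · have h1 (z : V) : (fun j => Function.update v (Fin.natAdd k b) z (Fin.natAdd k j)) =
          Function.update (fun j => v (Fin.natAdd k j)) b z :=
        Function.update_comp_eq_of_injective v (Fin.natAdd_injective l k) b z
      have h2 (z : V) : (fun j => Function.update v (Fin.natAdd k b) z (Fin.castAdd l j)) =
          fun j => v (Fin.castAdd l j) := by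
        funext j
        refine Function.update_of_ne ?_ z v
        simp only [ne_eq, Fin.ext_iff, Fin.val_natAdd, Fin.val_castAdd]
        omega
      simp only [h1, h2, β.map_update_smul, mul_smul_comm]
  cont := by
    refine (α.cont.comp ?_).mul (β.cont.comp ?_) <;> fun_prop

/-- The wedge product, normalised so that
`(α ∧ β)(v₁, …, v_{k+l}) = (k! l!)⁻¹ ∑_σ sign σ α(v_{σ 1}, …, v_{σ k}) β(v_{σ (k+1)}, …)`. -/
def wedge {k l : ℕ} (α : V [⋀^Fin k]→L[ℝ] ℂ) (β : V [⋀^Fin l]→L[ℝ] ℂ) :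
    V [⋀^Fin (k + l)]→L[ℝ] ℂ :=
  ((k.factorial * l.factorial : ℝ)⁻¹) •
    ContinuousMultilinearMap.alternatization (mulMultilinear α β)

/-- The wedge powers `α ^ p` of a 2-form. -/
def wedgePow (α : V [⋀^Fin 2]→L[ℝ] ℂ) : (p : ℕ) → V [⋀^Fin (2 * p)]→L[ℝ] ℂ
  | 0 => ContinuousAlternatingMap.constOfIsEmpty ℝ V (Fin 0) 1
  | p + 1 => wedge (wedgePow α p) α

/-- Transport of a form along an equality of degrees. -/
def castForm {k l : ℕ} (h : k = l) (α : V [⋀^Fin k]→L[ℝ] ℂ) : V [⋀^Fin l]→L[ℝ] ℂ := h ▸ α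

/-- Complex conjugate of a form. -/
def conjForm {k : ℕ} (α : V [⋀^Fin k]→L[ℝ] ℂ) : V [⋀^Fin k]→L[ℝ] ℂ :=
  (Complex.conjCLE : ℂ →L[ℝ] ℂ).compContinuousAlternatingMap α

/-- The quotient `α / β` of two forms of top degree: the number `c` with `α = c β`
(meaningful if `β ≠ 0`). -/
def topQuotient {k : ℕ} (α β : V [⋀^Fin k]→L[ℝ] ℂ) : ℂ :=
  Classical.epsilon fun c : ℂ => α = c • β

end LinearAlgebra

section Calculus

variable {E : Type*} [NormedAddCommGroup E] [NormedSpace ℂ E]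
  {W : Type*} [NormedAddCommGroup W] [NormedSpace ℂ W]

/-- Multiplication by `i` on a complex vector space, as a real-linear map. -/
def mulI (E : Type*) [NormedAddCommGroup E] [NormedSpace ℂ E] : E →L[ℝ] E :=
  (Complex.I • ContinuousLinearMap.id ℂ E).restrictScalars ℝ

/-- The complex-linear part of a real-linear map. -/
def linearPart (L : E →L[ℝ] W) : E →L[ℝ] W :=
  (1 / 2 : ℂ) • (L - Complex.I • L.comp (mulI E))

/-- The complex-antilinear part of a real-linear map. -/
def antilinearPart (L : E →L[ℝ] W) : E →L[ℝ] W :=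
  (1 / 2 : ℂ) • (L + Complex.I • L.comp (mulI E))

/-- `∂` of a differential form on a complex vector space: `∂α = ∑ⱼ dzⱼ ∧ ∂α/∂zⱼ`. -/
def del {k : ℕ} (α : E → E [⋀^Fin k]→L[ℝ] ℂ) (z : E) : E [⋀^Fin (k + 1)]→L[ℝ] ℂ :=
  ContinuousAlternatingMap.alternatizeUncurryFin (linearPart (fderiv ℝ α z))

/-- `∂̄` of a differential form on a complex vector space: `∂̄α = ∑ⱼ dz̄ⱼ ∧ ∂α/∂z̄ⱼ`. -/
def delBar {k : ℕ} (α : E → E [⋀^Fin k]→L[ℝ] ℂ) (z : E) : E [⋀^Fin (k + 1)]→L[ℝ] ℂ :=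
  ContinuousAlternatingMap.alternatizeUncurryFin (antilinearPart (fderiv ℝ α z))

/-- The derivative `∂f/∂zⱼ`, in the coordinate direction `v = ∂/∂zⱼ`. -/
def wirtinger (f : E → ℂ) (v z : E) : ℂ := linearPart (fderiv ℝ f z) v

/-- The derivative `∂f/∂z̄ₖ`, in the coordinate direction `v = ∂/∂zₖ`. -/
def wirtingerBar (f : E → ℂ) (v z : E) : ℂ := antilinearPart (fderiv ℝ f z) v

end Calculus

/-! ### Differential forms on a complex manifold -/

section Manifold

/-- Complex valued differential `k`-forms (not necessarily continuous) on a complex manifold `X`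
modelled on `E`. -/
abbrev DForm (E : Type*) [NormedAddCommGroup E] [NormedSpace ℂ E] (X : Type*) [TopologicalSpace X]
    [ChartedSpace E X] (k : ℕ) : Type _ :=
  (x : X) → TangentSpace 𝓘(ℂ, E) x [⋀^Fin k]→L[ℝ] ℂ

variable {E : Type*} [NormedAddCommGroup E] [NormedSpace ℂ E]
  {X : Type*} [TopologicalSpace X] [ChartedSpace E X]

/-- The differential at `z` of the inverse of the chart around `x₀`; its values on a basis of `E`
are the holomorphic coordinate vector fields `∂/∂zⱼ`. -/
def chartInvDeriv (x₀ : X) (z : E) :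
    E →L[ℂ] TangentSpace 𝓘(ℂ, E) ((chartAt E x₀).symm z) :=
  mfderiv 𝓘(ℂ, E) 𝓘(ℂ, E) (chartAt E x₀).symm z

/-- The differential at `x` of the chart around `x`. -/
def chartDeriv (x : X) : TangentSpace 𝓘(ℂ, E) x →L[ℂ] E :=
  mfderiv 𝓘(ℂ, E) 𝓘(ℂ, E) (chartAt E x) x

/-- The expression of a form in the chart around `x₀`. -/
def DForm.inChart {k : ℕ} (α : DForm E X k) (x₀ : X) (z : E) : E [⋀^Fin k]→L[ℝ] ℂ :=
  (α ((chartAt E x₀).symm z)).compContinuousLinearMap ((chartInvDeriv x₀ z).restrictScalars ℝ)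

/-- The exterior derivative `d`. -/
def DForm.d {k : ℕ} (α : DForm E X k) : DForm E X (k + 1) := fun x =>
  (extDeriv (α.inChart x) (chartAt E x x)).compContinuousLinearMap
    ((chartDeriv x).restrictScalars ℝ)

/-- The operator `∂` (in holomorphic coordinates). -/
def DForm.del {k : ℕ} (α : DForm E X k) : DForm E X (k + 1) := fun x =>
  (AnomalyFlow.del (α.inChart x) (chartAt E x x)).compContinuousLinearMap
    ((chartDeriv x).restrictScalars ℝ)

/-- The operator `∂̄` (in holomorphic coordinates). -/
def DForm.delBar {k : ℕ} (α : DForm E X k) : DForm E X (k + 1) := fun x =>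
  (AnomalyFlow.delBar (α.inChart x) (chartAt E x x)).compContinuousLinearMap
    ((chartDeriv x).restrictScalars ℝ)

/-- The form `i ∂∂̄ α`. -/
def DForm.iDelDelBar {k : ℕ} (α : DForm E X k) : DForm E X (k + 2) := fun x =>
  Complex.I • (α.delBar.del x)

/-! ### Holomorphic `(n,0)`-forms and Hermitian metrics -/

variable (E X) in
/-- A nowhere vanishing holomorphic `(n,0)`-form. -/
structure HolomorphicVolumeForm (n : ℕ) where
  /-- the form: complex multilinear, i.e. of type `(n,0)` -/
  form : (x : X) → TangentSpace 𝓘(ℂ, E) x [⋀^Fin n]→L[ℂ] ℂ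
  holomorphic : ∀ (x₀ : X) (v : Fin n → E), DifferentiableOn ℂ
    (fun z => form ((chartAt E x₀).symm z) (fun i => chartInvDeriv x₀ z (v i)))
    (chartAt E x₀).target
  ne_zero : ∀ x, form x ≠ 0

/-- A holomorphic `(n,0)`-form as a complex valued real differential form. -/
def HolomorphicVolumeForm.toDForm {n : ℕ} (Ω : HolomorphicVolumeForm E X n) : DForm E X n :=
  fun x => (Ω.form x).restrictScalars ℝ

variable (E X) in
/-- A smooth Hermitian metric on the holomorphic tangent bundle; `inner x v w` is complex linear
in `v` and conjugate linear in `w`. -/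
structure HermitianMetric where
  /-- the Hermitian inner product on each tangent space -/
  inner : (x : X) → TangentSpace 𝓘(ℂ, E) x →ₗ[ℂ] TangentSpace 𝓘(ℂ, E) x →ₗ⋆[ℂ] ℂ
  conj_symm : ∀ x v w, star (inner x w v) = inner x v w
  pos : ∀ x v, v ≠ 0 → 0 < (inner x v v).re
  /-- automatic, since the tangent spaces are finite dimensional -/
  continuous : ∀ x, Continuous fun p : TangentSpace 𝓘(ℂ, E) x × TangentSpace 𝓘(ℂ, E) x =>
    inner x p.1 p.2
  smooth : ∀ (x₀ : X) (v w : E), ContDiffOn ℝ ∞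
    (fun z => inner ((chartAt E x₀).symm z) (chartInvDeriv x₀ z v) (chartInvDeriv x₀ z w))
    (chartAt E x₀).target

namespace HermitianMetric

/-- The Hermitian inner product as a real bilinear map. -/
def bilin (g : HermitianMetric E X) (x : X) :
    ContinuousMultilinearMap ℝ (fun _ : Fin 2 => TangentSpace 𝓘(ℂ, E) x) ℂ where
  toFun v := g.inner x (v 0) (v 1)
  map_update_add' := by
    intro _ v i a b
    fin_cases i <;> simp
  map_update_smul' := by
    intro _ v i c a
    have h1 (u : TangentSpace 𝓘(ℂ, E) x) : c • u = (c : ℂ) • u := rfl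
    have h2 (u : ℂ) : c • u = (c : ℂ) • u := rfl
    have h3 (u w : TangentSpace 𝓘(ℂ, E) x) : g.inner x u (c • w) = (c : ℂ) * g.inner x u w := by
      rw [h1, map_smulₛₗ, Complex.conj_ofReal, smul_eq_mul]
    rw [h2]
    fin_cases i
    · simp [h1 a, -Complex.coe_smul]
    · simp [h3]
  cont := by
    have h : Continuous fun v : Fin 2 → TangentSpace 𝓘(ℂ, E) x => (v 0, v 1) :=
      (continuous_apply 0).prodMk (continuous_apply 1)
    exact (g.continuous x).comp h

/-- The Kähler form `ω = i ∑ g_{k̄j} dzʲ ∧ dz̄ᵏ`, i.e. `ω(v,w) = i (g(v,w) - g(w,v))`. -/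
def kahlerForm (g : HermitianMetric E X) : DForm E X 2 := fun x =>
  Complex.I • ContinuousMultilinearMap.alternatization (g.bilin x)

/-- The form `ω ^ p`. -/
def kahlerPow (g : HermitianMetric E X) (p : ℕ) : DForm E X (2 * p) := fun x =>
  wedgePow (g.kahlerForm x) p

/-- The metric is Kähler: `dω = 0`. -/
def IsKahler (g : HermitianMetric E X) : Prop := ∀ x, g.kahlerForm.d x = 0

/-- The matrix `(k, j) ↦ g_{k̄j} = g(∂/∂zⱼ, ∂/∂zₖ)` at `z`, in the holomorphic coordinates given by
the chart around `x₀` and the basis `b` of the model space. -/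
def coeff {n : ℕ} (g : HermitianMetric E X) (x₀ : X) (b : Module.Basis (Fin n) ℂ E) (z : E) :
    Matrix (Fin n) (Fin n) ℂ := Matrix.of fun k j =>
  g.inner ((chartAt E x₀).symm z) (chartInvDeriv x₀ z (b j)) (chartInvDeriv x₀ z (b k))

/-- The component `R_{k̄j}{}^p{}_q = -∂_{k̄} (∑_l g^{p l̄} ∂_j g_{l̄ q})` of the curvature of the Chern
connection. -/
def chernCurvature {n : ℕ} (g : HermitianMetric E X) (x₀ : X) (b : Module.Basis (Fin n) ℂ E)
    (k j p q : Fin n) (z : E) : ℂ :=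
  -wirtingerBar (fun w => ∑ l, (g.coeff x₀ b w)⁻¹ p l *
    wirtinger (fun u => g.coeff x₀ b u l q) (b j) w) (b k) z

/-- The component `R_{k̄j} = R_{k̄j}{}^p{}_p` of the Ricci curvature. -/
def ricci {n : ℕ} (g : HermitianMetric E X) (x₀ : X) (b : Module.Basis (Fin n) ℂ E)
    (k j : Fin n) (z : E) : ℂ :=
  ∑ p, g.chernCurvature x₀ b k j p p z

/-- The metric is Ricci-flat: its Ricci curvature vanishes, in all the coordinates of an atlas. -/
def IsRicciFlat (n : ℕ) (g : HermitianMetric E X) : Prop :=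
  ∀ (x₀ : X) (b : Module.Basis (Fin n) ℂ E), ∀ z ∈ (chartAt E x₀).target, ∀ k j,
    g.ricci x₀ b k j z = 0

/-- The norm `‖Ω‖_ω`, defined by `‖Ω‖_ω² = i^{n²} n! (Ω ∧ Ω̄) / ωⁿ`. -/
def normOf {n : ℕ} (g : HermitianMetric E X) (Ω : HolomorphicVolumeForm E X n) (x : X) : ℝ :=
  Real.sqrt (topQuotient
    ((Complex.I ^ (n ^ 2) * (n.factorial : ℂ)) •
      castForm (two_mul n).symm (wedge (Ω.toDForm x) (conjForm (Ω.toDForm x))))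
    (g.kahlerPow n x)).re

/-- The form `‖Ω‖_ω ω ^ (n - 1)`. -/
def normMulPow {n : ℕ} (g : HermitianMetric E X) (Ω : HolomorphicVolumeForm E X n) :
    DForm E X (2 * (n - 1)) := fun x => (g.normOf Ω x) • (g.kahlerPow (n - 1) x)

/-- The metric is conformally balanced: `d(‖Ω‖_ω ω ^ (n - 1)) = 0`. -/
def IsConformallyBalanced {n : ℕ} (g : HermitianMetric E X) (Ω : HolomorphicVolumeForm E X n) :
    Prop := ∀ x, (g.normMulPow Ω).d x = 0

end HermitianMetric

/-! ### The Anomaly flow -/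

/-- The family of Hermitian metrics `g t`, `t ∈ S`, is a smooth solution of the Anomaly flow
`∂ₜ(‖Ω‖_ω ω ^ (n - 1)) = i ∂∂̄ (ω ^ (n - 2))` on the time interval `S`. -/
structure IsAnomalyFlow {n : ℕ} (hn : 3 ≤ n) (Ω : HolomorphicVolumeForm E X n)
    (g : ℝ → HermitianMetric E X) (S : Set ℝ) : Prop where
  smooth : ∀ (x₀ : X) (v w : E), ContDiffOn ℝ ∞
    (fun p : ℝ × E => (g p.1).inner ((chartAt E x₀).symm p.2)
      (chartInvDeriv x₀ p.2 v) (chartInvDeriv x₀ p.2 w))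
    (S ×ˢ (chartAt E x₀).target)
  evolution : ∀ t ∈ S, ∀ (x : X) (v : Fin (2 * (n - 1)) → TangentSpace 𝓘(ℂ, E) x),
    HasDerivWithinAt (fun s => (g s).normMulPow Ω x v)
      (castForm (show 2 * (n - 2) + 2 = 2 * (n - 1) by omega)
        (((g t).kahlerPow (n - 2)).iDelDelBar x) v) S t

/-- A stationary point of the Anomaly flow: a metric which, kept constant in time, is a solution. -/
def IsStationaryPoint {n : ℕ} (hn : 3 ≤ n) (Ω : HolomorphicVolumeForm E X n)
    (g : HermitianMetric E X) : Prop :=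
  IsAnomalyFlow hn Ω (fun _ => g) (Set.Ici 0)

end Manifold

end AnomalyFlow

end

noncomputable section

namespace AnomalyFlow

/-! ### Alternating sums of arbitrary functions -/

section AltSum

variable {V : Type*}

/-! Write ν = ‖Ω‖_ω. The right-hand side of the flow is closed, because ∂̄² = 0 gives ∂∂̄ω^(n-2) =
d∂̄ω^(n-2). Hence d(ν ω^(n-1)) does not depend on time, and every ω(t) is conformally balanced
(`IsAnomalyFlow.extDeriv_eq_zero`). A stationary point satisfies in addition ∂∂̄ω^(n-2) = 0
(`IsStationaryPoint.del_delBar_eq_zero`). After that, time plays no role.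

The two equations combine into a pointwise identity, `sum_wirtinger_wirtingerBar_eq_torsion`. Let T
be the torsion, i.e. the array of differences ∂ⱼg(∂ₖ,∂ₗ) - ∂ₖg(∂ⱼ,∂ₗ), and let τ be its trace. Then
(n-2) Δν = ν ((2n-5)|τ|² + ½|T|²), where Δ is the trace of ∂∂̄ with respect to ω. To see this,
choose a basis in which the Gram matrix G is the identity at the given point. The balanced condition
says that V = ν det(G) G⁻¹ is divergence free, for ∂ in one index and for ∂̄ in the other. So the
double divergence of det(G) G⁻¹ = ν⁻¹V is ν Δ(ν⁻¹). Expanded, it is C + Q, with C linear in the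
second derivatives of G and Q = |τ|² - ½|T|². The second equation, wedged with the constant form
that agrees with ω at the point, reads (n-2) C + (n-3) Q = 0. Eliminating C and using ∂ₖν = -ν τₖ
gives the identity.

Since n ≥ 3, the coefficients n-2 and 2n-5 are positive, so Δν ≥ 0 for an elliptic operator without
lower order terms. The strong maximum principle (`eq_of_isMaxOn_ball`) and compactness make ν
locally constant (`HermitianMetric.eventually_normOf_eq`). The identity then forces T = 0, which is
dω = 0 (`extDeriv_eq_zero_of_torsion`). Finally ν² det G = |f|² with f the holomorphic coefficient
of Ω, so for constant ν the form ∂ log det G = ∂f / f is holomorphic and its ∂̄, which is the Ricci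
curvature up to sign, vanishes (`HermitianMetric.isRicciFlat_of_normOf`).

Two devices support the computation. Forms are treated as alternating sums of unsymmetrised
products; wedging with constant covectors and evaluating on a real frame turns them into
determinants. The operators d, ∂, ∂̄ on X use the preferred chart of each point, so they are shown
to commute with holomorphic pullback before one works in a fixed chart. -/

/-- The alternating sum of a function of `k` vectors. -/
def altSum {k : ℕ} (m : (Fin k → V) → ℂ) (v : Fin k → V) : ℂ :=
  ∑ σ : Equiv.Perm (Fin k), ((Equiv.Perm.sign σ : ℤ) : ℂ) * m (fun i => v (σ i))

theorem altSum_comp_perm {k : ℕ} (m : (Fin k → V) → ℂ) (τ : Equiv.Perm (Fin k))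
    (v : Fin k → V) :
    altSum (fun u => m (fun i => u (τ i))) v = ((Equiv.Perm.sign τ : ℤ) : ℂ) * altSum m v := by
  unfold altSum
  rw [Finset.mul_sum]
  refine Fintype.sum_equiv (Equiv.mulRight τ) _ _ fun σ => ?_
  simp only [Equiv.coe_mulRight, Equiv.Perm.sign_mul, Equiv.Perm.coe_mul, Function.comp_apply,
    Units.val_mul, Int.cast_mul]
  have h : ((Equiv.Perm.sign τ : ℤ) : ℂ) * ((Equiv.Perm.sign τ : ℤ) : ℂ) = 1 := by
    rcases Int.units_eq_one_or (Equiv.Perm.sign τ) with h | h <;> simp [h]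
  linear_combination (-((Equiv.Perm.sign σ : ℤ) : ℂ) * m (fun i => v (σ (τ i)))) * h

theorem altSum_sum {k : ℕ} {ι : Type*} (s : Finset ι) (c : ι → ℂ) (m : ι → (Fin k → V) → ℂ)
    (v : Fin k → V) :
    altSum (fun u => ∑ i ∈ s, c i * m i u) v = ∑ i ∈ s, c i * altSum (m i) v := by
  simp only [altSum, Finset.mul_sum]
  rw [Finset.sum_comm]
  refine Finset.sum_congr rfl fun i _ => Finset.sum_congr rfl fun σ _ => ?_
  ring

theorem altSum_const_mul {k : ℕ} (c : ℂ) (m : (Fin k → V) → ℂ) (v : Fin k → V) :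
    altSum (fun u => c * m u) v = c * altSum m v := by
  simp only [altSum, Finset.mul_sum]
  refine Finset.sum_congr rfl fun σ _ => ?_
  ring

theorem altSum_zero {k : ℕ} (v : Fin k → V) : altSum (fun _ => 0) v = 0 := by
  simp [altSum]

theorem altSum_add {k : ℕ} (m m' : (Fin k → V) → ℂ) (v : Fin k → V) :
    altSum (fun u => m u + m' u) v = altSum m v + altSum m' v := by
  simp only [altSum, mul_add, Finset.sum_add_distrib]

/-- A permutation inside one of the two blocks is absorbed by the outer alternating sum, at the cost
of a sign that cancels the one already present. So the k! l! inner terms all contribute the same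
amount. -/
theorem altSum_mul_altSum {k l : ℕ} (m : (Fin k → V) → ℂ) (m' : (Fin l → V) → ℂ)
    (v : Fin (k + l) → V) :
    altSum (fun u => altSum m (fun i => u (Fin.castAdd l i)) *
      altSum m' (fun i => u (Fin.natAdd k i))) v =
    (k.factorial * l.factorial : ℂ) *
      altSum (fun u => m (fun i => u (Fin.castAdd l i)) * m' (fun i => u (Fin.natAdd k i))) v := by
  have h (u : Fin (k + l) → V) : altSum m (fun i => u (Fin.castAdd l i)) *
      altSum m' (fun i => u (Fin.natAdd k i)) =
      ∑ p : Equiv.Perm (Fin k) × Equiv.Perm (Fin l),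
        (((Equiv.Perm.sign p.1 : ℤ) : ℂ) * ((Equiv.Perm.sign p.2 : ℤ) : ℂ)) *
          (fun u : Fin (k + l) → V => m (fun i => u (Fin.castAdd l (p.1 i))) *
            m' (fun i => u (Fin.natAdd k (p.2 i)))) u := by
    rw [altSum, altSum, Finset.sum_mul_sum, Fintype.sum_prod_type]
    refine Finset.sum_congr rfl fun σ _ => Finset.sum_congr rfl fun σ' _ => ?_
    ring
  simp only [h]
  rw [altSum_sum]
  have h2 (p : Equiv.Perm (Fin k) × Equiv.Perm (Fin l)) :
      altSum (fun u : Fin (k + l) → V => m (fun i => u (Fin.castAdd l (p.1 i))) *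
            m' (fun i => u (Fin.natAdd k (p.2 i)))) v =
      (((Equiv.Perm.sign p.1 : ℤ) : ℂ) * ((Equiv.Perm.sign p.2 : ℤ) : ℂ)) *
      altSum (fun u => m (fun i => u (Fin.castAdd l i)) * m' (fun i => u (Fin.natAdd k i))) v := by
    have := altSum_comp_perm
      (fun u : Fin (k + l) → V => m (fun i => u (Fin.castAdd l i)) *
        m' (fun i => u (Fin.natAdd k i)))
      (finSumFinEquiv.permCongr (Equiv.Perm.sumCongr p.1 p.2)) v
    simpa [Equiv.Perm.sign_permCongr, Equiv.Perm.sign_sumCongr, Equiv.permCongr_apply] using this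
  simp only [h2, ← mul_assoc]
  rw [← Finset.sum_mul]
  congr 1
  have h3 (p : Equiv.Perm (Fin k) × Equiv.Perm (Fin l)) :
      ((Equiv.Perm.sign p.1 : ℤ) : ℂ) * ((Equiv.Perm.sign p.2 : ℤ) : ℂ) *
        ((Equiv.Perm.sign p.1 : ℤ) : ℂ) * ((Equiv.Perm.sign p.2 : ℤ) : ℂ) = 1 := by
    rcases Int.units_eq_one_or (Equiv.Perm.sign p.1) with h | h <;>
    rcases Int.units_eq_one_or (Equiv.Perm.sign p.2) with h' | h' <;> simp [h, h']
  simp only [h3]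
  simp [Fintype.card_perm]

/-- A permutation of k + 1 letters is determined by the image i of 0 and a permutation of the
remaining letters. This folds the signed sum over i in the definition of d, ∂ and ∂̄ into a single
alternating sum. -/
theorem altSum_cons {k : ℕ} (m : V → (Fin k → V) → ℂ) (v : Fin (k + 1) → V) :
    ∑ i : Fin (k + 1), (-1 : ℂ) ^ (i : ℕ) * altSum (m (v i)) (i.removeNth v) =
      altSum (fun u => m (u 0) (Fin.tail u)) v := by
  -- The inverse of `cycleRange` sends 0 to i and keeps the order of the other letters; its sign is
  -- (-1)^i.
  let Φ : Fin (k + 1) × Equiv.Perm (Fin k) → Equiv.Perm (Fin (k + 1)) := fun p =>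
    (p.1.cycleRange)⁻¹ * Equiv.Perm.decomposeFin.symm (0, p.2)
  have h0 (p) : Φ p 0 = p.1 := by
    simp [Φ, Equiv.Perm.mul_apply, Equiv.Perm.inv_def, Fin.cycleRange_symm_zero]
  have hs (p) (j : Fin k) : Φ p j.succ = p.1.succAbove (p.2 j) := by
    simp [Φ, Equiv.Perm.mul_apply, Equiv.Perm.inv_def, Fin.cycleRange_symm_succ]
  have hsign (p) : ((Equiv.Perm.sign (Φ p) : ℤ) : ℂ) =
      (-1) ^ (p.1 : ℕ) * ((Equiv.Perm.sign p.2 : ℤ) : ℂ) := by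
    simp [Φ, Fin.sign_cycleRange]
  have hbij : Function.Bijective Φ := by
    rw [Fintype.bijective_iff_injective_and_card]
    constructor
    · intro p q h
      have h1 : p.1 = q.1 := by rw [← h0 p, ← h0 q, h]
      have h2 : p.2 = q.2 := by
        ext j
        have := hs p j
        rw [h, hs q j, ← h1] at this
        exact (congrArg Fin.val (Fin.succAbove_right_injective this)).symm
      exact Prod.ext h1 h2
    · simp [Fintype.card_perm, Nat.factorial_succ]
  simp only [altSum, Finset.mul_sum]
  rw [← hbij.sum_comp, Fintype.sum_prod_type]
  refine Finset.sum_congr rfl fun i _ => Finset.sum_congr rfl fun σ _ => ?_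
  rw [hsign, h0]
  simp only [Fin.removeNth, mul_assoc]
  congr 4
  funext j
  simp [Fin.tail, hs]

theorem altSum_altSum_tail {k : ℕ} (m : V → (Fin k → V) → ℂ) (v : Fin (k + 1) → V) :
    altSum (fun u => altSum (m (u 0)) (Fin.tail u)) v =
      (k.factorial : ℂ) * altSum (fun u => m (u 0) (Fin.tail u)) v := by
  have h (u : Fin (k + 1) → V) : altSum (m (u 0)) (Fin.tail u) =
      ∑ σ : Equiv.Perm (Fin k), ((Equiv.Perm.sign σ : ℤ) : ℂ) *
        (fun u : Fin (k + 1) → V => m (u 0) (fun i => Fin.tail u (σ i))) u := rfl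
  simp only [h]
  rw [altSum_sum]
  have h2 (σ : Equiv.Perm (Fin k)) :
      altSum (fun u : Fin (k + 1) → V => m (u 0) (fun i => Fin.tail u (σ i))) v =
        ((Equiv.Perm.sign σ : ℤ) : ℂ) * altSum (fun u => m (u 0) (Fin.tail u)) v := by
    have := altSum_comp_perm (fun u : Fin (k + 1) → V => m (u 0) (Fin.tail u))
      (Equiv.Perm.decomposeFin.symm (0, σ)) v
    simpa [Fin.tail_def] using this
  have h3 (σ : Equiv.Perm (Fin k)) :
      ((Equiv.Perm.sign σ : ℤ) : ℂ) * ((Equiv.Perm.sign σ : ℤ) : ℂ) = 1 := by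
    rcases Int.units_eq_one_or (Equiv.Perm.sign σ) with h | h <;> simp [h]
  simp only [h2, ← mul_assoc, h3, one_mul]
  simp [Fintype.card_perm]

end AltSum

/-! ### Wedge products as alternating sums -/

section Forms

variable {V : Type*} [AddCommGroup V] [Module ℝ V] [TopologicalSpace V]

theorem castForm_apply {k l : ℕ} (h : k = l) (α : V [⋀^Fin k]→L[ℝ] ℂ) (v : Fin l → V) :
    castForm h α v = α (fun i => v (Fin.cast h i)) := by
  subst h
  rfl

theorem conjForm_apply {k : ℕ} (α : V [⋀^Fin k]→L[ℝ] ℂ) (v : Fin k → V) :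
    conjForm α v = star (α v) := rfl

theorem wedge_apply {k l : ℕ} (α : V [⋀^Fin k]→L[ℝ] ℂ) (β : V [⋀^Fin l]→L[ℝ] ℂ)
    (v : Fin (k + l) → V) :
    wedge α β v = (k.factorial * l.factorial : ℂ)⁻¹ *
      altSum (fun u => α (fun i => u (Fin.castAdd l i)) * β (fun i => u (Fin.natAdd k i))) v := by
  simp only [wedge, altSum, ContinuousAlternatingMap.smul_apply,
    ContinuousMultilinearMap.alternatization_apply_apply, mulMultilinear]
  rw [Complex.real_smul]
  congr 1
  · push_cast; rfl
  · refine Finset.sum_congr rfl fun σ _ => ?_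
    rw [Units.smul_def, zsmul_eq_mul]
    rfl

/-- The factor (k! l!)⁻¹ in the wedge product cancels the k! l! of `altSum_mul_altSum`, so no
factorials accumulate when products are iterated. -/
theorem wedge_apply_of_altSum {k l : ℕ} {α : V [⋀^Fin k]→L[ℝ] ℂ} {β : V [⋀^Fin l]→L[ℝ] ℂ}
    {a : ℂ} {b : ℂ} {m : (Fin k → V) → ℂ} {m' : (Fin l → V) → ℂ}
    (hα : ∀ v, α v = a * altSum m v) (hβ : ∀ v, β v = b * altSum m' v) (v : Fin (k + l) → V) :
    wedge α β v = a * b * altSum (fun u => m (fun i => u (Fin.castAdd l i)) *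
      m' (fun i => u (Fin.natAdd k i))) v := by
  rw [wedge_apply]
  have h (u : Fin (k + l) → V) :
      α (fun i => u (Fin.castAdd l i)) * β (fun i => u (Fin.natAdd k i)) =
      (a * b) * (altSum m (fun i => u (Fin.castAdd l i)) *
        altSum m' (fun i => u (Fin.natAdd k i))) := by
    rw [hα, hβ]; ring
  simp only [h]
  rw [altSum_const_mul, altSum_mul_altSum]
  have h1 : (k.factorial : ℂ) ≠ 0 := by exact_mod_cast k.factorial_ne_zero
  have h2 : (l.factorial : ℂ) ≠ 0 := by exact_mod_cast l.factorial_ne_zero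
  field_simp

end Forms

/-- The index `2 i`. -/
def evenIdx {p : ℕ} (i : Fin p) : Fin (2 * p) := ⟨2 * i, by omega⟩

/-- The index `2 i + 1`. -/
def oddIdx {p : ℕ} (i : Fin p) : Fin (2 * p) := ⟨2 * i + 1, by omega⟩

/-- The product of bilinear expressions in consecutive pairs of vectors. -/
def pairProd {V : Type*} {p : ℕ} (B : Fin p → V → V → ℂ) (v : Fin (2 * p) → V) : ℂ :=
  ∏ i, B i (v (evenIdx i)) (v (oddIdx i))

theorem pairProd_succ {V : Type*} {p : ℕ} (B : Fin (p + 1) → V → V → ℂ)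
    (v : Fin (2 * p + 1 + 1) → V) :
    pairProd B v = B 0 (v 0) (v 1) * pairProd (Fin.tail B) (Fin.tail (Fin.tail v)) := by
  rw [pairProd, Fin.prod_univ_succ]
  rfl

theorem wedgePow_apply {V : Type*} [AddCommGroup V] [Module ℝ V] [TopologicalSpace V]
    {α : V [⋀^Fin 2]→L[ℝ] ℂ} {c : ℂ} {B : V → V → ℂ}
    (hα : ∀ v, α v = c * altSum (fun u => B (u 0) (u 1)) v) :
    ∀ (p : ℕ) (v : Fin (2 * p) → V),
      wedgePow α p v = c ^ p * altSum (pairProd fun _ : Fin p => B) v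
  | 0, v => by
    change (1 : ℂ) = _
    simp only [pow_zero, one_mul, altSum, pairProd, Finset.univ_eq_empty, Finset.prod_empty,
      mul_one]
    have : (Finset.univ : Finset (Equiv.Perm (Fin (2 * 0)))) = {1} := by decide
    rw [this]
    simp
  | p + 1, v => by
    change wedge (wedgePow α p) α v = _
    rw [wedge_apply_of_altSum (wedgePow_apply hα p) hα, pow_succ]
    congr 2
    funext u
    rw [pairProd, pairProd, Fin.prod_univ_castSucc]
    rfl

/-! ### Evaluation of top degree forms -/

/-- The interleaving of two copies of `Fin p`. -/
def interleave (p : ℕ) : Fin p ⊕ Fin p ≃ Fin (2 * p) :=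
  Equiv.ofBijective (Sum.elim evenIdx oddIdx) (by
    rw [Fintype.bijective_iff_injective_and_card]
    constructor
    · rintro (i | i) (j | j) h <;>
      simp only [Sum.elim_inl, Sum.elim_inr, evenIdx, oddIdx, Fin.mk.injEq] at h
      · exact congrArg _ (Fin.ext (by omega))
      · omega
      · omega
      · exact congrArg _ (Fin.ext (by omega))
    · simp [two_mul])

@[simp] theorem interleave_inl {p : ℕ} (i : Fin p) : interleave p (Sum.inl i) = evenIdx i := rfl

@[simp] theorem interleave_inr {p : ℕ} (i : Fin p) : interleave p (Sum.inr i) = oddIdx i := rfl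

section Pairs

variable {V : Type*}

/-- Two-forms commute: permuting pairs applies the same permutation to the even and to the odd
positions, so the total sign is a square. -/
theorem altSum_pairProd_perm {p : ℕ} (B : Fin p → V → V → ℂ) (τ : Equiv.Perm (Fin p))
    (v : Fin (2 * p) → V) :
    altSum (pairProd fun i => B (τ i)) v = altSum (pairProd B) v := by
  have := altSum_comp_perm (pairProd B)
    ((interleave p).permCongr (Equiv.Perm.sumCongr τ⁻¹ τ⁻¹)) v
  rw [Equiv.Perm.sign_permCongr, Equiv.Perm.sign_sumCongr] at this
  have h : Equiv.Perm.sign τ⁻¹ * Equiv.Perm.sign τ⁻¹ = 1 := Int.units_mul_self _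
  rw [h] at this
  simp only [Units.val_one, Int.cast_one, one_mul] at this
  rw [← this]
  congr 1
  funext u
  simp only [pairProd]
  refine Fintype.prod_equiv τ _ _ fun i => ?_
  have h1 : evenIdx (τ i) = interleave p (Sum.inl (τ i)) := rfl
  have h2 : oddIdx (τ i) = interleave p (Sum.inr (τ i)) := rfl
  rw [h1, h2]
  simp [Equiv.permCongr_apply, -interleave_inl, -interleave_inr]
  simp

theorem pairProd_sum {p n : ℕ} (η ζ : Fin p → Fin n → V → ℂ) (v : Fin (2 * p) → V) :
    pairProd (fun i x y => ∑ k, η i k x * ζ i k y) v =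
      ∑ κ : Fin p → Fin n, pairProd (fun i x y => η i (κ i) x * ζ i (κ i) y) v := by
  simp only [pairProd]
  rw [Finset.prod_univ_sum, Fintype.piFinset_univ]

theorem altSum_prod_eq_det {k : ℕ} (η : Fin k → V → ℂ) (v : Fin k → V) :
    altSum (fun u => ∏ i, η i (u i)) v = (Matrix.of fun i j => η i (v j)).det := by
  rw [← Matrix.det_transpose, Matrix.det_apply']
  rfl

/-- Indexing rows and columns by `Fin p ⊕ Fin p` makes the determinant a block matrix, with the η in
the upper and the ζ in the lower rows. The same interleaving is used on both sides, so no sign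
appears. -/
theorem altSum_pairProd_mul {p : ℕ} (η ζ : Fin p → V → ℂ) (v : Fin (2 * p) → V) :
    altSum (pairProd fun i x y => η i x * ζ i y) v =
      (Matrix.of fun i j : Fin p ⊕ Fin p => Sum.elim η ζ i (v (interleave p j))).det := by
  have h (u : Fin (2 * p) → V) : pairProd (fun i x y => η i x * ζ i y) u =
      ∏ r, (Sum.elim η ζ ((interleave p).symm r)) (u r) := by
    rw [← (interleave p).prod_comp, Fintype.prod_sum_type]
    simp only [Equiv.symm_apply_apply, Sum.elim_inl, Sum.elim_inr]
    simp only [pairProd, interleave_inl, interleave_inr, Finset.prod_mul_distrib]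
  have h' : (pairProd fun i x y => η i x * ζ i y) =
      fun u : Fin (2 * p) → V => ∏ r, (Sum.elim η ζ ((interleave p).symm r)) (u r) := funext h
  rw [h', altSum_prod_eq_det, ← Matrix.det_submatrix_equiv_self (interleave p)]
  congr 1
  ext i j
  simp

end Pairs

variable {E : Type*} [NormedAddCommGroup E] [NormedSpace ℂ E] {n : ℕ}

/-- The sesquilinear form with a given matrix. -/
def sesq (b : Module.Basis (Fin n) ℂ E) (M : Matrix (Fin n) (Fin n) ℂ) (v w : E) : ℂ :=
  ∑ k, (∑ j, M j k * b.repr v j) * star (b.repr w k)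

/-- The real basis `b₀, i b₀, b₁, i b₁, …`. -/
def realFrame (b : Module.Basis (Fin n) ℂ E) (r : Fin (2 * n)) : E :=
  Sum.elim (fun i => b i) (fun i => Complex.I • b i) ((interleave n).symm r)

@[simp] theorem realFrame_evenIdx (b : Module.Basis (Fin n) ℂ E) (i : Fin n) :
    realFrame b (evenIdx i) = b i := by
  rw [← interleave_inl, realFrame, Equiv.symm_apply_apply, Sum.elim_inl]

@[simp] theorem realFrame_oddIdx (b : Module.Basis (Fin n) ℂ E) (i : Fin n) :
    realFrame b (oddIdx i) = Complex.I • b i := by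
  rw [← interleave_inr, realFrame, Equiv.symm_apply_apply, Sum.elim_inr]

theorem sesq_add (b : Module.Basis (Fin n) ℂ E) (M N : Matrix (Fin n) (Fin n) ℂ) (v w : E) :
    sesq b (M + N) v w = sesq b M v w + sesq b N v w := by
  simp only [sesq, Matrix.add_apply, add_mul, Finset.sum_add_distrib]

theorem sesq_smul (b : Module.Basis (Fin n) ℂ E) (c : ℂ) (M : Matrix (Fin n) (Fin n) ℂ) (v w : E) :
    sesq b (c • M) v w = c * sesq b M v w := by
  simp only [sesq, Matrix.smul_apply, Finset.mul_sum, Finset.sum_mul, smul_eq_mul, mul_assoc]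

/-- On the vectors bⱼ and i bⱼ the covectors dz and dz̄ give the blocks 1, i and 1, -i, and the
Schur complement is -2i times the identity. -/
theorem det_frame (b : Module.Basis (Fin n) ℂ E) :
    (Matrix.of fun i j : Fin n ⊕ Fin n => Sum.elim (fun i v => b.repr v i)
      (fun i v => star (b.repr v i)) i (realFrame b (interleave n j))).det =
      (-2 * Complex.I) ^ n := by
  have : (Matrix.of fun i j : Fin n ⊕ Fin n => Sum.elim (fun i v => b.repr v i)
      (fun i v => star (b.repr v i)) i (realFrame b (interleave n j))) =
      Matrix.fromBlocks 1 (Complex.I • (1 : Matrix (Fin n) (Fin n) ℂ)) 1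
        (-Complex.I • (1 : Matrix (Fin n) (Fin n) ℂ)) := by
    ext (i | i) (j | j) <;>
    · simp [Matrix.one_apply, Finsupp.single_apply, eq_comm]
      try split_ifs <;> simp
  rw [this, Matrix.det_fromBlocks_one₁₁, Matrix.one_mul, ← sub_smul, Matrix.det_smul,
    Matrix.det_one, mul_one, Fintype.card_fin]
  ring

/-- Write the form as ∑ₖ ηₖ ∧ dz̄ₖ with ηₖ = ∑ⱼ Mⱼₖ dzⱼ and expand the n-th power. A term survives
only if its indices form a permutation, and by commutativity of two-forms the n! surviving terms are
equal. -/
theorem altSum_pairProd_sesq (b : Module.Basis (Fin n) ℂ E) (M : Matrix (Fin n) (Fin n) ℂ) :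
    altSum (pairProd fun _ : Fin n => sesq b M) (realFrame b) =
      n.factorial * (-2 * Complex.I) ^ n * M.det := by
  set η : Fin n → E → ℂ := fun k v => ∑ j, M j k * b.repr v j with hη
  set ζ : Fin n → E → ℂ := fun k v => star (b.repr v k) with hζ
  have h1 : (pairProd fun _ : Fin n => sesq b M) = fun v => ∑ κ ∈ (Finset.univ : Finset (Fin n → Fin n)),
      (1 : ℂ) * pairProd (fun i x y => η (κ i) x * ζ (κ i) y) v := by
    funext v
    simp only [one_mul]
    exact pairProd_sum (fun _ => η) (fun _ => ζ) v
  rw [h1, altSum_sum]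
  simp only [one_mul]
  -- A repeated index repeats a row dz̄ₖ of the determinant.
  have h2 (κ : Fin n → Fin n) (hκ : ¬ Function.Bijective κ) :
      altSum (pairProd fun i x y => η (κ i) x * ζ (κ i) y) (realFrame b) = 0 := by
    have : ¬ Function.Injective κ := fun h => hκ (Finite.injective_iff_bijective.mp h)
    simp only [Function.Injective, not_forall] at this
    obtain ⟨i, j, hij, hne⟩ := this
    rw [altSum_pairProd_mul (fun i => η (κ i)) (fun i => ζ (κ i))]
    refine Matrix.det_zero_of_row_eq (i := Sum.inr i) (j := Sum.inr j) (by simpa using hne) ?_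
    funext c
    simp [hij]
  have h3 (κ : Equiv.Perm (Fin n)) :
      altSum (pairProd fun i x y => η (κ i) x * ζ (κ i) y) (realFrame b) =
        (-2 * Complex.I) ^ n * M.det := by
    rw [altSum_pairProd_perm (fun i x y => η i x * ζ i y) κ, altSum_pairProd_mul]
    have : (Matrix.of fun i j : Fin n ⊕ Fin n =>
        Sum.elim η ζ i (realFrame b (interleave n j))) =
      Matrix.fromBlocks M.transpose 0 0 1 *
      (Matrix.of fun i j : Fin n ⊕ Fin n => Sum.elim (fun i v => b.repr v i)
      (fun i v => star (b.repr v i)) i (realFrame b (interleave n j))) := by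
      ext (i | i) j <;> simp [Matrix.mul_apply, hη, hζ, Matrix.one_apply]
    rw [this, Matrix.det_mul, det_frame, Matrix.det_fromBlocks_zero₂₁]
    simp
    ring
  have h4 : ∑ κ : Fin n → Fin n,
      altSum (pairProd fun i x y => η (κ i) x * ζ (κ i) y) (realFrame b) =
      ∑ κ : Equiv.Perm (Fin n),
        altSum (pairProd fun i x y => η (κ i) x * ζ (κ i) y) (realFrame b) := by
    symm
    refine Finset.sum_of_injOn (fun κ : Equiv.Perm (Fin n) => (κ : Fin n → Fin n))
      (fun _ _ _ _ h => DFunLike.coe_injective h) (by simp) ?_ (by simp)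
    intro κ _ hκ
    refine h2 κ fun hb => hκ ?_
    exact ⟨Equiv.ofBijective κ hb, by simp, rfl⟩
  rw [h4, Finset.sum_congr rfl fun κ _ => h3 κ]
  simp [Fintype.card_perm, mul_assoc]

/-- Vanishing by type: the product contains p + 2 covectors of type (0,1) on a space of complex
dimension p + 1. It is used to discard the ∂̄ part of d(ν ω^(n-1)) after wedging with dz̄ₖ. -/
theorem altSum_pairProd_conj_conj {p : ℕ} (b : Module.Basis (Fin (p + 1)) ℂ E)
    (M : Matrix (Fin (p + 1)) (Fin (p + 1)) ℂ) (k j : Fin (p + 1)) :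
    altSum (pairProd (Fin.cons (fun x y => star (b.repr x k) * star (b.repr y j))
      fun _ : Fin p => sesq b M)) (realFrame b) = 0 := by
  set ζ : Fin (p + 1) → E → ℂ := fun k v => star (b.repr v k) with hζ
  -- The first factor dz̄ₖ ⊗ dz̄ⱼ is written as a sum over l with the single nonzero term l = j, so
  -- that it has the same shape as the other factors.
  set η : Fin (p + 1) → Fin (p + 1) → E → ℂ :=
    Fin.cons (fun l v => if l = j then ζ k v else 0)
      (fun _ l v => ∑ i, M i l * b.repr v i) with hη
  have h0 : (Fin.cons (fun x y => star (b.repr x k) * star (b.repr y j))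
      (fun _ : Fin p => sesq b M) : Fin (p + 1) → E → E → ℂ) =
      fun i x y => ∑ l, η i l x * ζ l y := by
    funext i x y
    refine Fin.cases ?_ (fun i => ?_) i
    · simp [hη, hζ, ite_mul]
    · simp [hη, hζ, sesq]
  have h1 : (pairProd (Fin.cons (fun x y => star (b.repr x k) * star (b.repr y j))
      fun _ : Fin p => sesq b M)) = fun v => ∑ κ ∈ (Finset.univ : Finset (Fin (p + 1) → Fin (p + 1))),
      (1 : ℂ) * pairProd (fun i x y => η i (κ i) x * ζ (κ i) y) v := by
    funext v
    rw [h0]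
    simp only [one_mul]
    exact pairProd_sum η (fun _ => ζ) v
  rw [h1, altSum_sum]
  refine Finset.sum_eq_zero fun κ _ => ?_
  rw [one_mul, altSum_pairProd_mul (fun i => η i (κ i)) (fun i => ζ (κ i))]
  by_cases hj : κ 0 = j
  · obtain ⟨x, y, hxy, hc⟩ := Fintype.exists_ne_map_eq_of_card_lt
      (Fin.cons k κ : Fin (p + 2) → Fin (p + 1)) (by simp)
    -- The p + 2 rows carrying some dz̄; by the pigeonhole principle two of them coincide.
    let r : Fin (p + 2) → Fin (p + 1) ⊕ Fin (p + 1) := Fin.cons (Sum.inl 0) Sum.inr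
    have hr : Function.Injective r := by
      refine Fin.cons_injective_iff.mpr ⟨by simp, Sum.inr_injective⟩
    have hrow (x : Fin (p + 2)) : Sum.elim (fun i => η i (κ i)) (fun i => ζ (κ i)) (r x) =
        ζ ((Fin.cons k κ : Fin (p + 2) → Fin (p + 1)) x) := by
      refine Fin.cases ?_ (fun i => ?_) x
      · simp [r, hη, hj]
      · simp [r]
    refine Matrix.det_zero_of_row_eq (i := r x) (j := r y) (fun h => hxy (hr h)) ?_
    funext c
    simp only [Matrix.of_apply, hrow, hc]
  · refine Matrix.det_eq_zero_of_row_eq_zero (Sum.inl 0) fun c => ?_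
    simp [hη, hj]

/-- Polarisation by differentiation: mixed products are obtained as derivatives at 0 of products
whose value is already known, which avoids expanding them by hand. -/
theorem hasDerivAt_altSum_pairProd {p : ℕ} (b : Module.Basis (Fin n) ℂ E)
    (B C : Fin p → Matrix (Fin n) (Fin n) ℂ) (v : Fin (2 * p) → E) :
    HasDerivAt (fun t : ℂ => altSum (pairProd fun i => sesq b (B i + t • C i)) v)
      (∑ i, altSum (pairProd fun l => sesq b (Function.update B i (C i) l)) v) 0 := by
  have key (u : Fin (2 * p) → E) :
      HasDerivAt (fun t : ℂ => pairProd (fun i => sesq b (B i + t • C i)) u)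
        (∑ i, pairProd (fun l => sesq b (Function.update B i (C i) l)) u) 0 := by
    simp only [pairProd, sesq_add, sesq_smul]
    have h (i : Fin p) : HasDerivAt (fun t : ℂ => sesq b (B i) (u (evenIdx i)) (u (oddIdx i)) +
        t * sesq b (C i) (u (evenIdx i)) (u (oddIdx i)))
        (sesq b (C i) (u (evenIdx i)) (u (oddIdx i))) 0 := by
      simpa using ((hasDerivAt_id (0 : ℂ)).mul_const
        (sesq b (C i) (u (evenIdx i)) (u (oddIdx i)))).const_add
        (sesq b (B i) (u (evenIdx i)) (u (oddIdx i)))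
    convert! HasDerivAt.fun_finsetProd (u := (Finset.univ : Finset (Fin p)))
      (fun i _ => h i) using 1
    apply Finset.sum_congr rfl
    intro i _
    rw [← Finset.mul_prod_erase Finset.univ _ (Finset.mem_univ i), Function.update_self, smul_eq_mul,
      mul_comm]
    congr 1
    refine Finset.prod_congr rfl fun l hl => ?_
    rw [Function.update_of_ne (Finset.ne_of_mem_erase hl)]
    simp
  unfold altSum
  rw [Finset.sum_comm]
  refine HasDerivAt.fun_sum fun σ _ => ?_
  rw [← Finset.mul_sum]
  exact (key _).const_mul _

theorem hasDerivAt_det_add_smul (G X : Matrix (Fin n) (Fin n) ℂ) (hG : IsUnit G.det) :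
    HasDerivAt (fun t : ℂ => (G + t • X).det) (G.det * (G⁻¹ * X).trace) 0 := by
  have h (t : ℂ) : (G + t • X).det = G.det * (1 + (G⁻¹ * X).trace * t +
      (Matrix.det (1 + (Polynomial.X : Polynomial ℂ) • (G⁻¹ * X).map Polynomial.C)).divX.divX.eval t
        * t ^ 2) := by
    rw [← Matrix.det_one_add_smul, ← Matrix.det_mul]
    congr 1
    rw [mul_add, Matrix.mul_one, Matrix.mul_smul, ← Matrix.mul_assoc, Matrix.mul_nonsing_inv _ hG,
      Matrix.one_mul]
  simp only [h]
  refine HasDerivAt.const_mul _ ?_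
  set P := (Matrix.det (1 + (Polynomial.X : Polynomial ℂ) • (G⁻¹ * X).map Polynomial.C)).divX.divX
  have h1 := (((hasDerivAt_id (0 : ℂ)).const_mul (G⁻¹ * X).trace).const_add 1).add
    ((P.hasDerivAt 0).mul ((hasDerivAt_id (0 : ℂ)).pow 2))
  convert! h1 using 1
  simp

/-- The mixed expression `X ∧ G ∧ ⋯ ∧ G` in top degree. -/
theorem altSum_pairProd_cons {p : ℕ} (b : Module.Basis (Fin (p + 1)) ℂ E)
    (G X : Matrix (Fin (p + 1)) (Fin (p + 1)) ℂ) (hG : IsUnit G.det) :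
    altSum (pairProd (Fin.cons (sesq b X) fun _ : Fin p => sesq b G)) (realFrame b) =
      p.factorial * (-2 * Complex.I) ^ (p + 1) * (G.det * (G⁻¹ * X).trace) := by
  have h1 := hasDerivAt_altSum_pairProd b (fun _ => G) (fun _ => X) (realFrame b)
  simp only [altSum_pairProd_sesq] at h1
  have h2 := (hasDerivAt_det_add_smul G X hG).const_mul
    (((p + 1).factorial : ℂ) * (-2 * Complex.I) ^ (p + 1))
  have h3 := h1.unique h2
  -- All p + 1 terms of the derivative agree, since a transposition moves the factor X to the front.
  have h4 (i : Fin (p + 1)) : altSum (pairProd fun l => sesq b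
      (Function.update (fun _ => G) i X l)) (realFrame b) =
      altSum (pairProd (Fin.cons (sesq b X) fun _ : Fin p => sesq b G)) (realFrame b) := by
    rw [← altSum_pairProd_perm (Fin.cons (sesq b X) fun _ : Fin p => sesq b G) (Equiv.swap 0 i)]
    congr 2
    funext l
    by_cases hl : l = i
    · subst hl; simp
    · rw [Function.update_of_ne hl]
      by_cases h0 : l = 0
      · subst h0
        rw [Equiv.swap_apply_left]
        obtain ⟨i', rfl⟩ := Fin.exists_succ_eq_of_ne_zero (Ne.symm hl)
        simp
      · rw [Equiv.swap_apply_of_ne_of_ne h0 hl]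
        obtain ⟨l', rfl⟩ := Fin.exists_succ_eq_of_ne_zero h0
        simp
  simp only [h4] at h3
  have h5 : ((p : ℂ) + 1) ≠ 0 := by exact_mod_cast p.succ_ne_zero
  rw [Finset.sum_const, Finset.card_univ, Fintype.card_fin, nsmul_eq_mul, Nat.factorial_succ] at h3
  push_cast at h3
  refine mul_left_cancel₀ h5 ?_
  rw [h3]
  ring

section

attribute [local instance] Matrix.linftyOpNormedRing Matrix.linftyOpNormedAlgebra

theorem hasDerivAt_inv_add_smul (G Y : Matrix (Fin n) (Fin n) ℂ) (hG : IsUnit G.det) :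
    HasDerivAt (fun t : ℂ => (G + t • Y)⁻¹) (-(G⁻¹ * Y * G⁻¹)) 0 := by
  obtain ⟨u, hu⟩ := (Matrix.isUnit_iff_isUnit_det G).mpr hG
  have h1 : HasFDerivAt Ring.inverse
      (-ContinuousLinearMap.mulLeftRight ℂ (Matrix (Fin n) (Fin n) ℂ) ↑u⁻¹ ↑u⁻¹)
      (G + (0 : ℂ) • Y) := by
    rw [zero_smul, add_zero, ← hu]
    exact hasFDerivAt_ringInverse u
  have h2 : HasDerivAt (fun t : ℂ => G + t • Y) Y 0 := by
    have := ((hasDerivAt_id (0 : ℂ)).smul_const Y).const_add G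
    rw [one_smul] at this
    exact this
  have h3 := h1.comp_hasDerivAt (0 : ℂ) h2
  have h4 : (Ring.inverse ∘ fun t : ℂ => G + t • Y) = fun t : ℂ => (G + t • Y)⁻¹ := by
    funext t
    simp [Matrix.nonsing_inv_eq_ringInverse]
  rw [h4] at h3
  convert! h3 using 1
  have h5 : ((u⁻¹ : (Matrix (Fin n) (Fin n) ℂ)ˣ) : Matrix (Fin n) (Fin n) ℂ) = G⁻¹ := by
    rw [← hu, Matrix.coe_units_inv]
  simp [h5]

theorem hasDerivAt_trace_inv_mul (G X Y : Matrix (Fin n) (Fin n) ℂ) (hG : IsUnit G.det) :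
    HasDerivAt (fun t : ℂ => ((G + t • Y)⁻¹ * X).trace) (-(G⁻¹ * Y * G⁻¹ * X).trace) 0 := by
  have h := (hasDerivAt_inv_add_smul G Y hG).mul_const X
  have h2 := ((Matrix.traceLinearMap (Fin n) ℂ ℂ).toContinuousLinearMap.hasFDerivAt
    (x := (G + (0 : ℂ) • Y)⁻¹ * X)).comp_hasDerivAt (0 : ℂ) h
  convert! h2 using 1
  rw [Matrix.neg_mul]
  exact (Matrix.trace_neg _).symm

end

/-- The mixed expression `Y ∧ X ∧ G ∧ ⋯ ∧ G` in top degree. -/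
theorem altSum_pairProd_cons_cons {p : ℕ} (b : Module.Basis (Fin (p + 2)) ℂ E)
    (G X Y : Matrix (Fin (p + 2)) (Fin (p + 2)) ℂ) (hG : IsUnit G.det) :
    altSum (pairProd (Fin.cons (sesq b X) (Fin.cons (sesq b Y) fun _ : Fin p => sesq b G)))
      (realFrame b) =
      p.factorial * (-2 * Complex.I) ^ (p + 2) * (G.det * ((G⁻¹ * Y).trace * (G⁻¹ * X).trace -
        (G⁻¹ * Y * G⁻¹ * X).trace)) := by
  -- The first factor stays fixed at X (velocity 0) while the others move along G + tY. The
  -- derivative then consists of one zero term and p + 1 equal ones, to be compared with the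
  -- derivative of `altSum_pairProd_cons`.
  have h1 := hasDerivAt_altSum_pairProd b (Fin.cons X fun _ : Fin (p + 1) => G)
    (Fin.cons 0 fun _ : Fin (p + 1) => Y) (realFrame b)
  -- The formula to be differentiated in t requires an invertible matrix, so it is available only
  -- for small t.
  have hdet : ∀ᶠ t in nhds (0 : ℂ), IsUnit (G + t • Y).det := by
    have hc : ContinuousAt (fun t : ℂ => (G + t • Y).det) 0 :=
      (hasDerivAt_det_add_smul G Y hG).continuousAt
    have : ∀ᶠ t in nhds (0 : ℂ), (G + t • Y).det ≠ 0 := by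
      refine hc.eventually_ne ?_
      simpa using hG
    exact this.mono fun t ht => ht.isUnit
  have h2 := ((hasDerivAt_det_add_smul G Y hG).mul (hasDerivAt_trace_inv_mul G X Y hG)).const_mul
    (((p + 1).factorial : ℂ) * (-2 * Complex.I) ^ (p + 2))
  have h6 : (fun t : ℂ => altSum (pairProd fun i => sesq b
      ((Fin.cons X (fun _ : Fin (p + 1) => G) : Fin (p + 2) → Matrix (Fin (p + 2)) (Fin (p + 2)) ℂ) i +
        t • (Fin.cons 0 (fun _ : Fin (p + 1) => Y) : Fin (p + 2) → Matrix (Fin (p + 2)) (Fin (p + 2)) ℂ) i))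
        (realFrame b)) =ᶠ[nhds 0]
      fun t => ((p + 1).factorial : ℂ) * (-2 * Complex.I) ^ (p + 2) *
        ((fun t : ℂ => (G + t • Y).det) * fun t : ℂ => ((G + t • Y)⁻¹ * X).trace) t := by
    filter_upwards [hdet] with t ht
    rw [Pi.mul_apply, ← altSum_pairProd_cons b (G + t • Y) X ht]
    congr 2
    funext i
    refine Fin.cases ?_ (fun i => ?_) i <;> simp
  have h3 := h1.unique (h2.congr_of_eventuallyEq h6)
  rw [Fin.sum_univ_succ] at h3
  have h7 : altSum (pairProd fun l => sesq b (Function.update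
      (Fin.cons X (fun _ : Fin (p + 1) => G) : Fin (p + 2) → Matrix (Fin (p + 2)) (Fin (p + 2)) ℂ) 0
      ((Fin.cons 0 (fun _ : Fin (p + 1) => Y) : Fin (p + 2) → Matrix (Fin (p + 2)) (Fin (p + 2)) ℂ) 0) l))
      (realFrame b) = 0 := by
    unfold altSum
    refine Finset.sum_eq_zero fun σ _ => mul_eq_zero_of_right _ ?_
    rw [pairProd, Fin.prod_univ_succ]
    simp [sesq]
  have h4 (i : Fin (p + 1)) : altSum (pairProd fun l => sesq b (Function.update
      (Fin.cons X (fun _ : Fin (p + 1) => G) : Fin (p + 2) → Matrix (Fin (p + 2)) (Fin (p + 2)) ℂ) i.succ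
      ((Fin.cons 0 (fun _ : Fin (p + 1) => Y) : Fin (p + 2) → Matrix (Fin (p + 2)) (Fin (p + 2)) ℂ) i.succ) l))
      (realFrame b) =
      altSum (pairProd (Fin.cons (sesq b X) (Fin.cons (sesq b Y) fun _ : Fin p => sesq b G)))
      (realFrame b) := by
    rw [← altSum_pairProd_perm (Fin.cons (sesq b X) (Fin.cons (sesq b Y) fun _ : Fin p => sesq b G))
      (Equiv.swap 1 i.succ)]
    congr 2
    funext l
    by_cases hl : l = i.succ
    · subst hl
      rw [Equiv.swap_apply_right, Function.update_self]
      rfl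
    · rw [Function.update_of_ne hl]
      by_cases h0 : l = 1
      · subst h0
        rw [Equiv.swap_apply_left]
        have : i ≠ 0 := by rintro rfl; exact hl rfl
        obtain ⟨i', rfl⟩ := Fin.exists_succ_eq_of_ne_zero this
        rfl
      · rw [Equiv.swap_apply_of_ne_of_ne h0 hl]
        refine Fin.cases (fun _ _ => ?_) (fun l hl h0 => ?_) l hl h0
        · simp
        · have : l ≠ 0 := by rintro rfl; exact h0 rfl
          obtain ⟨l', rfl⟩ := Fin.exists_succ_eq_of_ne_zero this
          simp
  simp only [h4, h7, zero_add] at h3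
  have h5 : ((p : ℂ) + 1) ≠ 0 := by exact_mod_cast p.succ_ne_zero
  rw [Finset.sum_const, Finset.card_univ, Fintype.card_fin, nsmul_eq_mul, Nat.factorial_succ] at h3
  push_cast at h3
  refine mul_left_cancel₀ h5 ?_
  rw [h3]
  simp only [zero_smul, add_zero]
  ring

/-! ### Wirtinger calculus -/

section Wirtinger

variable {E : Type*} [NormedAddCommGroup E] [NormedSpace ℂ E]
  {W : Type*} [NormedAddCommGroup W] [NormedSpace ℂ W]

theorem linearPart_apply (L : E →L[ℝ] W) (v : E) :
    linearPart L v = (1 / 2 : ℂ) • (L v - Complex.I • L (Complex.I • v)) := rfl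

theorem antilinearPart_apply (L : E →L[ℝ] W) (v : E) :
    antilinearPart L v = (1 / 2 : ℂ) • (L v + Complex.I • L (Complex.I • v)) := rfl

theorem linearPart_add_antilinearPart (L : E →L[ℝ] W) :
    linearPart L + antilinearPart L = L := by
  ext v
  rw [add_apply, linearPart_apply, antilinearPart_apply, ← smul_add]
  rw [show L v - Complex.I • L (Complex.I • v) + (L v + Complex.I • L (Complex.I • v)) =
    (2 : ℂ) • L v by rw [two_smul]; abel]
  rw [smul_smul]
  norm_num

theorem linearPart_I_smul (L : E →L[ℝ] W) (v : E) :
    linearPart L (Complex.I • v) = Complex.I • linearPart L v := by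
  have hI : Complex.I • Complex.I • v = -v := by rw [smul_smul, Complex.I_mul_I, neg_one_smul]
  simp only [linearPart_apply, hI, map_neg]
  match_scalars <;> ring_nf <;> simp <;> norm_num

theorem antilinearPart_I_smul (L : E →L[ℝ] W) (v : E) :
    antilinearPart L (Complex.I • v) = -Complex.I • antilinearPart L v := by
  have hI : Complex.I • Complex.I • v = -v := by rw [smul_smul, Complex.I_mul_I, neg_one_smul]
  simp only [antilinearPart_apply, hI, map_neg]
  match_scalars <;> ring_nf <;> simp <;> norm_num

theorem map_complex_smul (L : E →L[ℝ] W) (c : ℂ) (v : E) :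
    L (c • v) = (c.re : ℂ) • L v + (c.im : ℂ) • L (Complex.I • v) := by
  conv_lhs => rw [← Complex.re_add_im c, add_smul, mul_smul]
  rw [map_add]
  congr 1
  · exact L.map_smul c.re v
  · exact L.map_smul c.im (Complex.I • v)

theorem linearPart_smul (L : E →L[ℝ] W) (c : ℂ) (v : E) :
    linearPart L (c • v) = c • linearPart L v := by
  rw [map_complex_smul, linearPart_I_smul, smul_smul, ← add_smul, Complex.re_add_im]

theorem antilinearPart_smul (L : E →L[ℝ] W) (c : ℂ) (v : E) :
    antilinearPart L (c • v) = star c • antilinearPart L v := by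
  rw [map_complex_smul, antilinearPart_I_smul, smul_smul, ← add_smul]
  congr 1
  apply Complex.ext <;> simp

theorem wirtinger_eq (f : E → ℂ) (v z : E) : wirtinger f v z =
    (1 / 2 : ℂ) * (fderiv ℝ f z v - Complex.I * fderiv ℝ f z (Complex.I • v)) := rfl

theorem wirtingerBar_eq (f : E → ℂ) (v z : E) : wirtingerBar f v z =
    (1 / 2 : ℂ) * (fderiv ℝ f z v + Complex.I * fderiv ℝ f z (Complex.I • v)) := rfl

theorem fderiv_eq_wirtinger_add (f : E → ℂ) (v z : E) :
    fderiv ℝ f z v = wirtinger f v z + wirtingerBar f v z := by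
  rw [wirtinger_eq, wirtingerBar_eq]; ring

theorem wirtinger_basis {n : ℕ} (b : Module.Basis (Fin n) ℂ E) (f : E → ℂ) (v z : E) :
    wirtinger f v z = ∑ j, b.repr v j * wirtinger f (b j) z := by
  conv_lhs => rw [← b.sum_repr v]
  simp only [wirtinger, map_sum, linearPart_smul, smul_eq_mul]

theorem wirtingerBar_basis {n : ℕ} (b : Module.Basis (Fin n) ℂ E) (f : E → ℂ) (v z : E) :
    wirtingerBar f v z = ∑ j, star (b.repr v j) * wirtingerBar f (b j) z := by
  conv_lhs => rw [← b.sum_repr v]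
  simp only [wirtingerBar, map_sum, antilinearPart_smul, smul_eq_mul]

section Rules

variable {f g : E → ℂ} {z : E} (v : E)

theorem wirtinger_congr (h : f =ᶠ[nhds z] g) : wirtinger f v z = wirtinger g v z := by
  rw [wirtinger, wirtinger, h.fderiv_eq]

theorem wirtingerBar_congr (h : f =ᶠ[nhds z] g) : wirtingerBar f v z = wirtingerBar g v z := by
  rw [wirtingerBar, wirtingerBar, h.fderiv_eq]

theorem wirtinger_const (c : ℂ) : wirtinger (fun _ => c) v z = 0 := by
  simp [wirtinger_eq]

theorem wirtingerBar_const (c : ℂ) : wirtingerBar (fun _ => c) v z = 0 := by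
  simp [wirtingerBar_eq]

theorem wirtinger_add (hf : DifferentiableAt ℝ f z) (hg : DifferentiableAt ℝ g z) :
    wirtinger (fun z => f z + g z) v z = wirtinger f v z + wirtinger g v z := by
  simp only [wirtinger_eq, fderiv_fun_add hf hg, add_apply]; ring

theorem wirtingerBar_add (hf : DifferentiableAt ℝ f z) (hg : DifferentiableAt ℝ g z) :
    wirtingerBar (fun z => f z + g z) v z = wirtingerBar f v z + wirtingerBar g v z := by
  simp only [wirtingerBar_eq, fderiv_fun_add hf hg, add_apply]; ring

theorem wirtinger_mul (hf : DifferentiableAt ℝ f z) (hg : DifferentiableAt ℝ g z) :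
    wirtinger (fun z => f z * g z) v z = wirtinger f v z * g z + f z * wirtinger g v z := by
  simp only [wirtinger_eq, fderiv_fun_mul hf hg, add_apply,
    smul_apply, smul_eq_mul]
  ring

theorem wirtingerBar_mul (hf : DifferentiableAt ℝ f z) (hg : DifferentiableAt ℝ g z) :
    wirtingerBar (fun z => f z * g z) v z = wirtingerBar f v z * g z + f z * wirtingerBar g v z := by
  simp only [wirtingerBar_eq, fderiv_fun_mul hf hg, add_apply,
    smul_apply, smul_eq_mul]
  ring

theorem wirtinger_const_mul (c : ℂ) (hf : DifferentiableAt ℝ f z) :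
    wirtinger (fun z => c * f z) v z = c * wirtinger f v z := by
  rw [wirtinger_mul v (differentiableAt_const c) hf, wirtinger_const, zero_mul, zero_add]

theorem wirtingerBar_const_mul (c : ℂ) (hf : DifferentiableAt ℝ f z) :
    wirtingerBar (fun z => c * f z) v z = c * wirtingerBar f v z := by
  rw [wirtingerBar_mul v (differentiableAt_const c) hf, wirtingerBar_const, zero_mul, zero_add]

theorem wirtinger_sum {ι : Type*} {s : Finset ι} {F : ι → E → ℂ}
    (hF : ∀ i ∈ s, DifferentiableAt ℝ (F i) z) :
    wirtinger (fun z => ∑ i ∈ s, F i z) v z = ∑ i ∈ s, wirtinger (F i) v z := by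
  simp only [wirtinger_eq, fderiv_fun_sum hF, sum_apply, Finset.mul_sum,
    ← Finset.sum_sub_distrib]

theorem wirtingerBar_sum {ι : Type*} {s : Finset ι} {F : ι → E → ℂ}
    (hF : ∀ i ∈ s, DifferentiableAt ℝ (F i) z) :
    wirtingerBar (fun z => ∑ i ∈ s, F i z) v z = ∑ i ∈ s, wirtingerBar (F i) v z := by
  simp only [wirtingerBar_eq, fderiv_fun_sum hF, sum_apply, Finset.mul_sum,
    ← Finset.sum_add_distrib]

theorem fderiv_star (hf : DifferentiableAt ℝ f z) (w : E) :
    fderiv ℝ (fun z => star (f z)) z w = star (fderiv ℝ f z w) := by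
  have h := ((Complex.conjCLE : ℂ →L[ℝ] ℂ).hasFDerivAt (x := f z)).comp z hf.hasFDerivAt
  have h2 : HasFDerivAt (fun z => star (f z)) ((Complex.conjCLE : ℂ →L[ℝ] ℂ).comp (fderiv ℝ f z)) z := h
  rw [h2.fderiv]
  rfl

theorem wirtingerBar_star (hf : DifferentiableAt ℝ f z) :
    wirtingerBar (fun z => star (f z)) v z = star (wirtinger f v z) := by
  rw [wirtinger_eq, wirtingerBar_eq, fderiv_star hf, fderiv_star hf]
  simp

theorem wirtinger_star (hf : DifferentiableAt ℝ f z) :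
    wirtinger (fun z => star (f z)) v z = star (wirtingerBar f v z) := by
  rw [wirtinger_eq, wirtingerBar_eq, fderiv_star hf, fderiv_star hf]
  simp
  ring

theorem wirtingerBar_eq_zero (hf : DifferentiableAt ℂ f z) : wirtingerBar f v z = 0 := by
  rw [wirtingerBar_eq, hf.fderiv_restrictScalars ℝ]
  simp only [ContinuousLinearMap.coe_restrictScalars', map_smul, smul_eq_mul, ← mul_assoc,
    Complex.I_mul_I]
  ring

theorem wirtinger_inv (hf : DifferentiableAt ℝ f z) (h0 : f z ≠ 0) :
    wirtinger (fun z => (f z)⁻¹) v z = -wirtinger f v z / f z ^ 2 := by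
  have hi : DifferentiableAt ℝ (fun z => (f z)⁻¹) z := hf.inv h0
  have h1 : wirtinger (fun z => f z * (f z)⁻¹) v z = 0 := by
    rw [wirtinger_congr (g := fun _ => 1) v, wirtinger_const]
    filter_upwards [hf.continuousAt.eventually_ne h0] with y hy using mul_inv_cancel₀ hy
  rw [wirtinger_mul v hf hi] at h1
  field_simp
  field_simp at h1
  linear_combination h1

theorem wirtingerBar_inv (hf : DifferentiableAt ℝ f z) (h0 : f z ≠ 0) :
    wirtingerBar (fun z => (f z)⁻¹) v z = -wirtingerBar f v z / f z ^ 2 := by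
  have hi : DifferentiableAt ℝ (fun z => (f z)⁻¹) z := hf.inv h0
  have h1 : wirtingerBar (fun z => f z * (f z)⁻¹) v z = 0 := by
    rw [wirtingerBar_congr (g := fun _ => 1) v, wirtingerBar_const]
    filter_upwards [hf.continuousAt.eventually_ne h0] with y hy using mul_inv_cancel₀ hy
  rw [wirtingerBar_mul v hf hi] at h1
  field_simp
  field_simp at h1
  linear_combination h1

theorem contDiffOn_wirtinger {U : Set E} (hU : IsOpen U) (hf : ContDiffOn ℝ ∞ f U) :
    ContDiffOn ℝ ∞ (AnomalyFlow.wirtinger f v) U := by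
  have h := hf.fderiv_of_isOpen hU (m := ∞) (by simp)
  exact contDiffOn_const.mul ((h.clm_apply contDiffOn_const).sub
    (contDiffOn_const.mul (h.clm_apply contDiffOn_const)))

theorem contDiffOn_wirtingerBar {U : Set E} (hU : IsOpen U) (hf : ContDiffOn ℝ ∞ f U) :
    ContDiffOn ℝ ∞ (AnomalyFlow.wirtingerBar f v) U := by
  have h := hf.fderiv_of_isOpen hU (m := ∞) (by simp)
  exact contDiffOn_const.mul ((h.clm_apply contDiffOn_const).add
    (contDiffOn_const.mul (h.clm_apply contDiffOn_const)))

theorem wirtinger_altSum {k : ℕ} {V : Type*} {m : E → (Fin k → V) → ℂ}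
    (hm : ∀ u, DifferentiableAt ℝ (fun z => m z u) z) (u : Fin k → V) :
    wirtinger (fun z => altSum (m z) u) v z = altSum (fun u => wirtinger (fun z => m z u) v z) u := by
  unfold altSum
  rw [wirtinger_sum v fun σ _ => (hm _).const_mul _]
  exact Finset.sum_congr rfl fun σ _ => wirtinger_const_mul v _ (hm _)

theorem wirtingerBar_altSum {k : ℕ} {V : Type*} {m : E → (Fin k → V) → ℂ}
    (hm : ∀ u, DifferentiableAt ℝ (fun z => m z u) z) (u : Fin k → V) :
    wirtingerBar (fun z => altSum (m z) u) v z =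
      altSum (fun u => wirtingerBar (fun z => m z u) v z) u := by
  unfold altSum
  rw [wirtingerBar_sum v fun σ _ => (hm _).const_mul _]
  exact Finset.sum_congr rfl fun σ _ => wirtingerBar_const_mul v _ (hm _)

end Rules

end Wirtinger

/-! ### Forms given by alternating sums -/

section FormCalculus

variable {E : Type*} [NormedAddCommGroup E] [NormedSpace ℂ E]

theorem fderiv_form_apply {k : ℕ} {α : E → E [⋀^Fin k]→L[ℝ] ℂ} {z : E}
    (hα : DifferentiableAt ℝ α z) (w : E) (v : Fin k → E) :
    fderiv ℝ α z w v = fderiv ℝ (fun z => α z v) z w := by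
  rw [fderiv_continuousAlternatingMap_apply_const_apply hα]

theorem extDeriv_eq_del_add_delBar {k : ℕ} (α : E → E [⋀^Fin k]→L[ℝ] ℂ) (z : E) :
    extDeriv α z = del α z + delBar α z := by
  rw [extDeriv, del, delBar, ← ContinuousAlternatingMap.alternatizeUncurryFin_add,
    linearPart_add_antilinearPart]

theorem linearPart_fderiv_form_apply {k : ℕ} {α : E → E [⋀^Fin k]→L[ℝ] ℂ} {z : E}
    (hα : DifferentiableAt ℝ α z) (w : E) (v : Fin k → E) :
    linearPart (fderiv ℝ α z) w v = wirtinger (fun z => α z v) w z := by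
  rw [wirtinger_eq, ← fderiv_form_apply hα, ← fderiv_form_apply hα]
  rfl

theorem antilinearPart_fderiv_form_apply {k : ℕ} {α : E → E [⋀^Fin k]→L[ℝ] ℂ} {z : E}
    (hα : DifferentiableAt ℝ α z) (w : E) (v : Fin k → E) :
    antilinearPart (fderiv ℝ α z) w v = wirtingerBar (fun z => α z v) w z := by
  rw [wirtingerBar_eq, ← fderiv_form_apply hα, ← fderiv_form_apply hα]
  rfl

/-- Because a form may be represented by a multilinear expression that is not alternating, the
derivative is taken of that expression and antisymmetrised once, through `altSum_cons`. -/
theorem del_apply_of_altSum {k : ℕ} {α : E → E [⋀^Fin k]→L[ℝ] ℂ} {z : E}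
    (hα : DifferentiableAt ℝ α z) {m : E → (Fin k → E) → ℂ}
    (h : ∀ᶠ y in nhds z, ∀ v, α y v = altSum (m y) v)
    (hm : ∀ u, DifferentiableAt ℝ (fun y => m y u) z) (v : Fin (k + 1) → E) :
    del α z v = altSum (fun u => wirtinger (fun y => m y (Fin.tail u)) (u 0) z) v := by
  rw [del, ContinuousAlternatingMap.alternatizeUncurryFin_apply,
    ← altSum_cons (fun w u => wirtinger (fun y => m y u) w z)]
  refine Finset.sum_congr rfl fun i _ => ?_
  rw [linearPart_fderiv_form_apply hα, ← wirtinger_altSum _ hm,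
    wirtinger_congr (g := fun y => altSum (m y) (i.removeNth v)) _ (h.mono fun y hy => hy _)]
  simp

theorem delBar_apply_of_altSum {k : ℕ} {α : E → E [⋀^Fin k]→L[ℝ] ℂ} {z : E}
    (hα : DifferentiableAt ℝ α z) {m : E → (Fin k → E) → ℂ}
    (h : ∀ᶠ y in nhds z, ∀ v, α y v = altSum (m y) v)
    (hm : ∀ u, DifferentiableAt ℝ (fun y => m y u) z) (v : Fin (k + 1) → E) :
    delBar α z v = altSum (fun u => wirtingerBar (fun y => m y (Fin.tail u)) (u 0) z) v := by
  rw [delBar, ContinuousAlternatingMap.alternatizeUncurryFin_apply,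
    ← altSum_cons (fun w u => wirtingerBar (fun y => m y u) w z)]
  refine Finset.sum_congr rfl fun i _ => ?_
  rw [antilinearPart_fderiv_form_apply hα, ← wirtingerBar_altSum _ hm,
    wirtingerBar_congr (g := fun y => altSum (m y) (i.removeNth v)) _ (h.mono fun y hy => hy _)]
  simp

theorem extDeriv_apply_of_altSum {k : ℕ} {α : E → E [⋀^Fin k]→L[ℝ] ℂ} {z : E}
    (hα : DifferentiableAt ℝ α z) {m : E → (Fin k → E) → ℂ}
    (h : ∀ᶠ y in nhds z, ∀ v, α y v = altSum (m y) v)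
    (hm : ∀ u, DifferentiableAt ℝ (fun y => m y u) z) (v : Fin (k + 1) → E) :
    extDeriv α z v = altSum (fun u => wirtinger (fun y => m y (Fin.tail u)) (u 0) z +
      wirtingerBar (fun y => m y (Fin.tail u)) (u 0) z) v := by
  rw [extDeriv_eq_del_add_delBar, ContinuousAlternatingMap.add_apply, del_apply_of_altSum hα h hm,
    delBar_apply_of_altSum hα h hm, altSum_add]

/-- A family of forms on a finite dimensional space is smooth if all its values are. -/
theorem contDiffOn_form [FiniteDimensional ℝ E] {F : Type*} [NormedAddCommGroup F]
    [NormedSpace ℝ F] {k : ℕ} {N : WithTop ℕ∞} {α : F → E [⋀^Fin k]→L[ℝ] ℂ} {s : Set F}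
    (h : ∀ v, ContDiffOn ℝ N (fun z => α z v) s) : ContDiffOn ℝ N α s := by
  let b := Module.finBasis ℝ E
  let L : (E [⋀^Fin k]→L[ℝ] ℂ) →ₗ[ℝ] ((Fin k → Fin (Module.finrank ℝ E)) → ℂ) :=
    { toFun := fun β a => β fun i => b (a i)
      map_add' := fun _ _ => rfl
      map_smul' := fun _ _ => rfl }
  have hL : LinearMap.ker L = ⊥ := by
    rw [LinearMap.ker_eq_bot']
    intro β hβ
    apply ContinuousAlternatingMap.toAlternatingMap_injective
    refine Module.Basis.ext_alternating b fun a _ => ?_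
    exact congrFun hβ a
  obtain ⟨R, hR⟩ := L.exists_leftInverse_of_injective hL
  have hα : α = fun z => R.toContinuousLinearMap (L (α z)) := by
    funext z
    exact (LinearMap.congr_fun hR (α z)).symm
  rw [hα]
  refine R.toContinuousLinearMap.contDiff.comp_contDiffOn ?_
  exact contDiffOn_pi.mpr fun a => h _

end FormCalculus

/-! ### Wedging with constant test forms: the two equations in coordinates -/

section Tests

variable {E : Type*} [NormedAddCommGroup E] [NormedSpace ℂ E]

theorem del_apply {k : ℕ} {α : E → E [⋀^Fin k]→L[ℝ] ℂ} {z : E}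
    (hα : DifferentiableAt ℝ α z) (v : Fin (k + 1) → E) :
    del α z v = ∑ i : Fin (k + 1), (-1 : ℂ) ^ (i : ℕ) *
      wirtinger (fun y => α y (i.removeNth v)) (v i) z := by
  rw [del, ContinuousAlternatingMap.alternatizeUncurryFin_apply]
  refine Finset.sum_congr rfl fun i _ => ?_
  rw [linearPart_fderiv_form_apply hα]
  simp

theorem delBar_apply {k : ℕ} {α : E → E [⋀^Fin k]→L[ℝ] ℂ} {z : E}
    (hα : DifferentiableAt ℝ α z) (v : Fin (k + 1) → E) :
    delBar α z v = ∑ i : Fin (k + 1), (-1 : ℂ) ^ (i : ℕ) *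
      wirtingerBar (fun y => α y (i.removeNth v)) (v i) z := by
  rw [delBar, ContinuousAlternatingMap.alternatizeUncurryFin_apply]
  refine Finset.sum_congr rfl fun i _ => ?_
  rw [antilinearPart_fderiv_form_apply hα]
  simp

theorem contDiffOn_form_apply {F : Type*} [NormedAddCommGroup F] [NormedSpace ℝ F] {k : ℕ}
    {N : WithTop ℕ∞} {α : F → E [⋀^Fin k]→L[ℝ] ℂ} {s : Set F} (h : ContDiffOn ℝ N α s)
    (v : Fin k → E) : ContDiffOn ℝ N (fun z => α z v) s :=
  (ContinuousAlternatingMap.apply ℝ E ℂ v).contDiff.comp_contDiffOn h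

theorem differentiableAt_of_contDiffOn {F G : Type*} [NormedAddCommGroup F] [NormedSpace ℝ F]
    [NormedAddCommGroup G] [NormedSpace ℝ G] {f : F → G} {U : Set F} (hU : IsOpen U)
    (hf : ContDiffOn ℝ ∞ f U) {z : F} (hz : z ∈ U) : DifferentiableAt ℝ f z :=
  (hf.contDiffAt (hU.mem_nhds hz)).differentiableAt (by simp)

theorem contDiffOn_del [FiniteDimensional ℝ E] {k : ℕ} {α : E → E [⋀^Fin k]→L[ℝ] ℂ} {U : Set E}
    (hU : IsOpen U) (hα : ContDiffOn ℝ ∞ α U) : ContDiffOn ℝ ∞ (AnomalyFlow.del α) U := by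
  refine contDiffOn_form fun v => ?_
  have : ContDiffOn ℝ ∞ (fun z => ∑ i : Fin (k + 1), (-1 : ℂ) ^ (i : ℕ) *
      AnomalyFlow.wirtinger (fun y => α y (i.removeNth v)) (v i) z) U :=
    ContDiffOn.sum fun i _ => contDiffOn_const.mul (contDiffOn_wirtinger _ hU (contDiffOn_form_apply hα _))
  exact this.congr fun z hz => del_apply (differentiableAt_of_contDiffOn hU hα hz) v

theorem contDiffOn_delBar [FiniteDimensional ℝ E] {k : ℕ} {α : E → E [⋀^Fin k]→L[ℝ] ℂ} {U : Set E}
    (hU : IsOpen U) (hα : ContDiffOn ℝ ∞ α U) : ContDiffOn ℝ ∞ (AnomalyFlow.delBar α) U := by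
  refine contDiffOn_form fun v => ?_
  have : ContDiffOn ℝ ∞ (fun z => ∑ i : Fin (k + 1), (-1 : ℂ) ^ (i : ℕ) *
      AnomalyFlow.wirtingerBar (fun y => α y (i.removeNth v)) (v i) z) U :=
    ContDiffOn.sum fun i _ => contDiffOn_const.mul (contDiffOn_wirtingerBar _ hU (contDiffOn_form_apply hα _))
  exact this.congr fun z hz => delBar_apply (differentiableAt_of_contDiffOn hU hα hz) v

theorem sesq_single {n : ℕ} (b : Module.Basis (Fin n) ℂ E) (j k : Fin n) (v w : E) :
    sesq b (Matrix.single j k 1) v w = b.repr v j * star (b.repr w k) := by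
  simp only [sesq, Matrix.single_apply, ite_mul, one_mul, zero_mul]
  rw [Finset.sum_eq_single k, Finset.sum_eq_single j]
  · simp
  · intro i _ hi; simp [hi.symm]
  · simp
  · intro i _ hi; simp [hi.symm]
  · simp

theorem trace_mul_single_one {n : ℕ} (M : Matrix (Fin n) (Fin n) ℂ) (j k : Fin n) :
    (M * Matrix.single j k 1).trace = M k j := by
  rw [Matrix.trace_mul_comm, Matrix.trace_single_mul]
  simp

theorem contDiffOn_pairProd {F : Type*} [NormedAddCommGroup F] [NormedSpace ℝ F] {n p : ℕ}
    (b : Module.Basis (Fin n) ℂ E) {N : WithTop ℕ∞} {U : Set F} {G : F → Matrix (Fin n) (Fin n) ℂ}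
    (hG : ∀ j k, ContDiffOn ℝ N (fun y => G y j k) U) (u : Fin (2 * p) → E) :
    ContDiffOn ℝ N (fun y => AnomalyFlow.pairProd (fun _ : Fin p => sesq b (G y)) u) U := by
  unfold AnomalyFlow.pairProd sesq
  refine contDiffOn_prod fun i _ => ContDiffOn.sum fun k _ => ContDiffOn.mul
    (ContDiffOn.sum fun j _ => (hG j k).mul contDiffOn_const) contDiffOn_const

theorem altSum_mul_altSum_tail {V : Type*} {k : ℕ} (s : V → ℂ) (m : (Fin k → V) → ℂ)
    (v : Fin (k + 1) → V) :
    altSum (fun u => s (u 0) * altSum m (Fin.tail u)) v =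
      (k.factorial : ℂ) * altSum (fun u => s (u 0) * m (Fin.tail u)) v := by
  rw [← altSum_altSum_tail (fun w u => s w * m u)]
  simp only [altSum_const_mul]

/-- Compare both sides after antisymmetrising all slots but the first: each is then reached from the
one-slot version, and the common factor (k+1)! cancels. -/
theorem altSum_mul_altSum_tail_tail {V : Type*} {k : ℕ} (s : V → V → ℂ) (m : (Fin k → V) → ℂ)
    (v : Fin (k + 1 + 1) → V) :
    altSum (fun u => s (u 0) (u 1) * altSum m (Fin.tail (Fin.tail u))) v =
      (k.factorial : ℂ) * altSum (fun u => s (u 0) (u 1) * m (Fin.tail (Fin.tail u))) v := by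
  have h0 : ((k + 1).factorial : ℂ) ≠ 0 := by exact_mod_cast (k + 1).factorial_ne_zero
  refine mul_left_cancel₀ h0 ?_
  have h1 := altSum_altSum_tail (fun w (u : Fin (k + 1) → V) => s w (u 0) * altSum m (Fin.tail u)) v
  have h2 := altSum_altSum_tail (fun w (u : Fin (k + 1) → V) => s w (u 0) * m (Fin.tail u)) v
  simp only [altSum_mul_altSum_tail, altSum_const_mul] at h1
  rw [h2] at h1
  change (k.factorial : ℂ) * (((k + 1).factorial : ℂ) *
    altSum (fun u => s (u 0) (u 1) * m (Fin.tail (Fin.tail u))) v) = ((k + 1).factorial : ℂ) *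
    altSum (fun u => s (u 0) (u 1) * altSum m (Fin.tail (Fin.tail u))) v at h1
  rw [← h1]
  ring

/-- The coordinate form of `d (ν ω ^ (n - 1)) = 0`. -/
theorem sum_wirtinger_of_extDeriv_eq_zero {p : ℕ} (b : Module.Basis (Fin (p + 1)) ℂ E)
    {α : E → E [⋀^Fin (2 * p)]→L[ℝ] ℂ} {c : ℂ} (hc : c ≠ 0) {ν : E → ℂ}
    {G : E → Matrix (Fin (p + 1)) (Fin (p + 1)) ℂ} {U : Set E} (hU : IsOpen U)
    (hα : ContDiffOn ℝ ∞ α U)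
    (h : ∀ y ∈ U, ∀ v, α y v = c * (ν y * altSum (pairProd fun _ : Fin p => sesq b (G y)) v))
    (hν : ContDiffOn ℝ ∞ ν U) (hG : ∀ j k, ContDiffOn ℝ ∞ (fun y => G y j k) U)
    (hdet : ∀ y ∈ U, IsUnit (G y).det) {z : E} (hz : z ∈ U) (hd : extDeriv α z = 0)
    (k : Fin (p + 1)) :
    ∑ j, wirtinger (fun y => ν y * ((G y).det * (G y)⁻¹ k j)) (b j) z = 0 := by
  set m : E → (Fin (2 * p) → E) → ℂ := fun y u =>
    c * ν y * pairProd (fun _ : Fin p => sesq b (G y)) u with hm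
  have hmd (u) : DifferentiableAt ℝ (fun y => m y u) z :=
    differentiableAt_of_contDiffOn hU
      ((contDiffOn_const.mul hν).mul (contDiffOn_pairProd b hG u)) hz
  have hαd := differentiableAt_of_contDiffOn hU hα hz
  have hαm : ∀ᶠ y in nhds z, ∀ v, α y v = altSum (m y) v := by
    filter_upwards [hU.mem_nhds hz] with y hy v
    rw [h y hy, hm, altSum_const_mul, mul_assoc]
  have h1 (v : Fin (2 * p + 1) → E) := extDeriv_apply_of_altSum hαd hαm hmd v
  have hz0 {l : ℕ} (v : Fin l → E) : (0 : E [⋀^Fin l]→L[ℝ] ℂ) v = 0 := rfl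
  simp only [hd, hz0] at h1
  -- This is dz̄ₖ ∧ dα evaluated on the real frame. Since dz̄ₖ is constant, it can later be moved
  -- inside the derivatives without a Leibniz rule.
  have h2 := altSum_mul_altSum_tail (fun w : E => star (b.repr w k))
    (fun u => wirtinger (fun y => m y (Fin.tail u)) (u 0) z +
      wirtingerBar (fun y => m y (Fin.tail u)) (u 0) z) (realFrame b)
  simp only [← h1, mul_zero, altSum_zero] at h2
  have h3 := (mul_eq_zero.mp h2.symm).resolve_left
    (by exact_mod_cast (2 * p + 1).factorial_ne_zero)
  -- dz̄ₖ ∧ dzⱼ ∧ ω^(n-1) is, up to a constant, the (k, j) entry of ν det(G) G⁻¹; the minus sign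
  -- comes from reordering to dzⱼ ∧ dz̄ₖ.
  have hA (j : Fin (p + 1)) (y : E) (hy : y ∈ U) :
      altSum (fun u : Fin (2 * p + 1 + 1) → E => (star (b.repr (u 0) k) * b.repr (u 1) j) *
        m y (Fin.tail (Fin.tail u))) (realFrame b) =
      -(c * (p.factorial * (-2 * Complex.I) ^ (p + 1))) * (ν y * ((G y).det * (G y)⁻¹ k j)) := by
    have e1 := altSum_comp_perm (fun u : Fin (2 * p + 1 + 1) → E =>
      (star (b.repr (u 1) k) * b.repr (u 0) j) * m y (Fin.tail (Fin.tail u))) (Equiv.swap 0 1)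
      (realFrame b)
    rw [Equiv.Perm.sign_swap (by simp)] at e1
    have e2 := altSum_pairProd_cons b (G y) (Matrix.single j k 1) (hdet y hy)
    rw [trace_mul_single_one] at e2
    have e3 : (fun u : Fin (2 * p + 1 + 1) → E => (star (b.repr (u 1) k) * b.repr (u 0) j) *
        m y (Fin.tail (Fin.tail u))) = fun u => (c * ν y) *
        pairProd (Fin.cons (sesq b (Matrix.single j k 1)) fun _ : Fin p => sesq b (G y)) u := by
      funext u
      rw [pairProd_succ]
      simp only [Fin.cons_zero, Fin.tail_cons, sesq_single, hm]
      ring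
    have e4 := altSum_const_mul (c * ν y) (pairProd (Fin.cons (sesq b (Matrix.single j k 1))
      fun _ : Fin p => sesq b (G y))) (realFrame b)
    rw [e2] at e4
    rw [e3] at e1
    refine Eq.trans ?_ ((e1.trans (congrArg _ e4)).trans ?_)
    · rfl
    · push_cast; ring
  have hB (j : Fin (p + 1)) (y : E) :
      altSum (fun u : Fin (2 * p + 1 + 1) → E => (star (b.repr (u 0) k) * star (b.repr (u 1) j)) *
        m y (Fin.tail (Fin.tail u))) (realFrame b) = 0 := by
    have e2 := altSum_pairProd_conj_conj b (G y) k j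
    have e3 : (fun u : Fin (2 * p + 1 + 1) → E => (star (b.repr (u 0) k) * star (b.repr (u 1) j)) *
        m y (Fin.tail (Fin.tail u))) = fun u => (c * ν y) *
        pairProd (Fin.cons (fun x y => star (b.repr x k) * star (b.repr y j))
          fun _ : Fin p => sesq b (G y)) u := by
      funext u
      rw [pairProd_succ]
      simp only [Fin.cons_zero, Fin.tail_cons, hm]
      ring
    have e4 := altSum_const_mul (c * ν y) (pairProd (Fin.cons
      (fun x y => star (b.repr x k) * star (b.repr y j)) fun _ : Fin p => sesq b (G y)))
      (realFrame b)
    rw [e2, mul_zero] at e4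
    rw [e3]
    exact e4
  -- The direction of differentiation is the vector in slot 1; expanding it in the basis produces
  -- the covectors dzⱼ and dz̄ⱼ.
  have h4 : ∑ j, wirtinger (fun y => altSum (fun u : Fin (2 * p + 1 + 1) → E =>
        (star (b.repr (u 0) k) * b.repr (u 1) j) * m y (Fin.tail (Fin.tail u))) (realFrame b))
        (b j) z +
      ∑ j, wirtingerBar (fun y => altSum (fun u : Fin (2 * p + 1 + 1) → E =>
        (star (b.repr (u 0) k) * star (b.repr (u 1) j)) * m y (Fin.tail (Fin.tail u)))
        (realFrame b)) (b j) z = 0 := by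
    rw [← h3]
    simp only [wirtinger_altSum _ fun u : Fin (2 * p + 1 + 1) → E => (hmd _).const_mul _,
      wirtingerBar_altSum _ fun u : Fin (2 * p + 1 + 1) → E => (hmd _).const_mul _,
      wirtinger_const_mul _ _ (hmd _), wirtingerBar_const_mul _ _ (hmd _)]
    have e := altSum_sum (Finset.univ : Finset (Fin (p + 1))) (fun _ => 1)
      (fun j (u : Fin (2 * p + 1 + 1) → E) => (star (b.repr (u 0) k) * b.repr (u 1) j) *
        wirtinger (fun y => m y (Fin.tail (Fin.tail u))) (b j) z) (realFrame b)
    have e' := altSum_sum (Finset.univ : Finset (Fin (p + 1))) (fun _ => 1)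
      (fun j (u : Fin (2 * p + 1 + 1) → E) => (star (b.repr (u 0) k) * star (b.repr (u 1) j)) *
        wirtingerBar (fun y => m y (Fin.tail (Fin.tail u))) (b j) z) (realFrame b)
    simp only [one_mul] at e e'
    rw [← e, ← e', ← altSum_add]
    congr 1
    funext u
    have t1 := wirtinger_basis b (fun y => m y (Fin.tail (Fin.tail u))) (u 1) z
    have t2 := wirtingerBar_basis b (fun y => m y (Fin.tail (Fin.tail u))) (u 1) z
    have t3 : Fin.tail u 0 = u 1 := rfl
    rw [t3, t1, t2, mul_add, Finset.mul_sum, Finset.mul_sum]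
    congr 1 <;> exact Finset.sum_congr rfl fun j _ => by ring
  have h5 (j : Fin (p + 1)) : wirtinger (fun y => altSum (fun u : Fin (2 * p + 1 + 1) → E =>
        (star (b.repr (u 0) k) * b.repr (u 1) j) * m y (Fin.tail (Fin.tail u))) (realFrame b))
        (b j) z = -(c * (p.factorial * (-2 * Complex.I) ^ (p + 1))) *
        wirtinger (fun y => ν y * ((G y).det * (G y)⁻¹ k j)) (b j) z := by
    have hne : -(c * (p.factorial * (-2 * Complex.I) ^ (p + 1))) ≠ 0 := by
      have : (p.factorial : ℂ) ≠ 0 := by exact_mod_cast p.factorial_ne_zero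
      simp [hc, this]
    set c' := -(c * (p.factorial * (-2 * Complex.I) ^ (p + 1)))
    set f := fun y => altSum (fun u : Fin (2 * p + 1 + 1) → E =>
        (star (b.repr (u 0) k) * b.repr (u 1) j) * m y (Fin.tail (Fin.tail u))) (realFrame b)
    have hf : DifferentiableAt ℝ f z :=
      DifferentiableAt.fun_sum fun σ _ => ((hmd _).const_mul _).const_mul _
    have e : (fun y => ν y * ((G y).det * (G y)⁻¹ k j)) =ᶠ[nhds z] fun y => c'⁻¹ * f y := by
      filter_upwards [hU.mem_nhds hz] with y hy
      rw [show f y = _ from hA j y hy, inv_mul_cancel_left₀ hne]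
    rw [wirtinger_congr _ e, wirtinger_const_mul _ _ hf, mul_inv_cancel_left₀ hne]
  simp only [hB, h5, wirtingerBar_const, Finset.sum_const_zero, add_zero, ← Finset.mul_sum] at h4
  refine (mul_eq_zero.mp h4).resolve_left ?_
  have : (p.factorial : ℂ) ≠ 0 := by exact_mod_cast p.factorial_ne_zero
  simp [hc, this]

/-- The coordinate form of the trace of `∂∂̄ ω ^ (n - 2) = 0`. -/
theorem sum_wirtinger_wirtingerBar_of_del_delBar_eq_zero [FiniteDimensional ℝ E] {p : ℕ}
    (b : Module.Basis (Fin (p + 2)) ℂ E)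
    {α : E → E [⋀^Fin (2 * p)]→L[ℝ] ℂ} {c : ℂ} (hc : c ≠ 0)
    {G : E → Matrix (Fin (p + 2)) (Fin (p + 2)) ℂ} {U : Set E} (hU : IsOpen U)
    (hα : ContDiffOn ℝ ∞ α U)
    (h : ∀ y ∈ U, ∀ v, α y v = c * altSum (pairProd fun _ : Fin p => sesq b (G y)) v)
    (hG : ∀ j k, ContDiffOn ℝ ∞ (fun y => G y j k) U)
    (hdet : ∀ y ∈ U, IsUnit (G y).det) {z : E} (hz : z ∈ U) (hd : del (delBar α) z = 0) :
    ∑ j, ∑ k, wirtinger (wirtingerBar (fun y => (G y).det * ((G y)⁻¹ k j * (G y)⁻¹.trace -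
      ((G y)⁻¹ * (G y)⁻¹) k j)) (b k)) (b j) z = 0 := by
  set m : E → (Fin (2 * p) → E) → ℂ := fun y u =>
    c * pairProd (fun _ : Fin p => sesq b (G y)) u with hm
  have hms (u) : ContDiffOn ℝ ∞ (fun y => m y u) U :=
    contDiffOn_const.mul (contDiffOn_pairProd b hG u)
  have hmd (u) {y} (hy : y ∈ U) : DifferentiableAt ℝ (fun y => m y u) y :=
    differentiableAt_of_contDiffOn hU (hms u) hy
  have hmw (u) (w) {y} (hy : y ∈ U) :
      DifferentiableAt ℝ (wirtingerBar (fun y => m y u) w) y :=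
    differentiableAt_of_contDiffOn hU (contDiffOn_wirtingerBar w hU (hms u)) hy
  have hαm {y} (hy : y ∈ U) : ∀ᶠ y in nhds y, ∀ v, α y v = altSum (m y) v := by
    filter_upwards [hU.mem_nhds hy] with y hy v
    rw [h y hy, hm, altSum_const_mul]
  have hbar {y} (hy : y ∈ U) (v : Fin (2 * p + 1) → E) :=
    delBar_apply_of_altSum (differentiableAt_of_contDiffOn hU hα hy) (hαm hy)
      (fun u => hmd u hy) v
  have h1 (v : Fin (2 * p + 1 + 1) → E) := del_apply_of_altSum
    (m := fun y u => wirtingerBar (fun y => m y (Fin.tail u)) (u 0) y)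
    (differentiableAt_of_contDiffOn hU (contDiffOn_delBar hU hα) hz)
    (by filter_upwards [hU.mem_nhds hz] with y hy v using hbar hy v)
    (fun u => hmw _ _ hz) v
  have hz0 {l : ℕ} (v : Fin l → E) : (0 : E [⋀^Fin l]→L[ℝ] ℂ) v = 0 := rfl
  simp only [hd, hz0] at h1
  -- The test form is the constant form with identity matrix, which at the point of interest will
  -- agree with the metric.
  have h2 := altSum_mul_altSum_tail_tail (sesq b 1)
    (fun u : Fin (2 * p + 1 + 1) → E => wirtinger (fun y => wirtingerBar
      (fun y => m y (Fin.tail (Fin.tail u))) (Fin.tail u 0) y) (u 0) z) (realFrame b)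
  simp only [← h1, mul_zero, altSum_zero] at h2
  have h3 := (mul_eq_zero.mp h2.symm).resolve_left
    (by exact_mod_cast (2 * p + 1 + 1).factorial_ne_zero)
  set N := Fin (2 * p + 1 + 1 + 1 + 1) → E
  set S : Fin (p + 2) → Fin (p + 2) → N → ℂ := fun j k u =>
    sesq b 1 (u 0) (u 1) * (b.repr (u 2) j * star (b.repr (u 3) k)) with hS
  let t4 : N → Fin (2 * p) → E := fun u => Fin.tail (Fin.tail (Fin.tail (Fin.tail u)))
  -- Mixed product of the constant form, dzⱼ ∧ dz̄ₖ and p = n - 2 copies of G, by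
  -- `altSum_pairProd_cons_cons` with X the identity matrix and Y an elementary one.
  have hA (j k : Fin (p + 2)) (y : E) (hy : y ∈ U) :
      altSum (fun u : N => S j k u * m y (t4 u)) (realFrame b) =
      (c * (p.factorial * (-2 * Complex.I) ^ (p + 2))) * ((G y).det *
        ((G y)⁻¹ k j * (G y)⁻¹.trace - ((G y)⁻¹ * (G y)⁻¹) k j)) := by
    have e2 := altSum_pairProd_cons_cons b (G y) 1 (Matrix.single j k 1) (hdet y hy)
    rw [trace_mul_single_one, mul_one, mul_one, Matrix.trace_mul_comm, ← Matrix.mul_assoc,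
      trace_mul_single_one] at e2
    have e3 : (fun u : N => S j k u * m y (t4 u)) = fun u => c *
        pairProd (Fin.cons (sesq b 1) (Fin.cons (sesq b (Matrix.single j k 1))
          fun _ : Fin p => sesq b (G y))) u := by
      funext u
      rw [pairProd_succ]
      simp only [Fin.cons_zero, Fin.tail_cons]
      have := pairProd_succ (Fin.cons (sesq b (Matrix.single j k 1))
          fun _ : Fin p => sesq b (G y)) (Fin.tail (Fin.tail u))
      erw [this]
      simp only [Fin.cons_zero, Fin.tail_cons, sesq_single, hm, hS]
      change _ = c * (_ * (b.repr (u 2) j * star (b.repr (u 3) k) * pairProd _ (t4 u)))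
      ring
    have e4 := altSum_const_mul c (pairProd (Fin.cons (sesq b 1)
      (Fin.cons (sesq b (Matrix.single j k 1)) fun _ : Fin p => sesq b (G y)))) (realFrame b)
    rw [e2] at e4
    rw [e3]
    refine e4.trans ?_
    ring
  have h4 : ∑ j, ∑ k, wirtinger (wirtingerBar (fun y => altSum (fun u : N =>
      S j k u * m y (t4 u)) (realFrame b)) (b k)) (b j) z = 0 := by
    rw [← h3]
    have e0 (j k : Fin (p + 2)) : wirtinger (wirtingerBar (fun y => altSum (fun u : N =>
      S j k u * m y (t4 u)) (realFrame b)) (b k)) (b j) z =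
      altSum (fun u : N => S j k u * wirtinger (wirtingerBar (fun y => m y (t4 u)) (b k)) (b j) z)
        (realFrame b) := by
      rw [wirtinger_congr (g := fun y => altSum (fun u : N =>
        S j k u * wirtingerBar (fun y => m y (t4 u)) (b k) y) (realFrame b))]
      · rw [wirtinger_altSum _ fun u : N => (hmw _ _ hz).const_mul _]
        congr 1
        funext u
        exact wirtinger_const_mul _ _ (hmw _ _ hz)
      · filter_upwards [hU.mem_nhds hz] with y hy
        rw [wirtingerBar_altSum _ fun u : N => (hmd _ hy).const_mul _]
        congr 1
        funext u
        exact wirtingerBar_const_mul _ _ (hmd _ hy)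
    simp only [e0]
    have e1 := altSum_sum (Finset.univ : Finset (Fin (p + 2) × Fin (p + 2))) (fun _ => 1)
      (fun q (u : N) => S q.1 q.2 u *
        wirtinger (wirtingerBar (fun y => m y (t4 u)) (b q.2)) (b q.1) z) (realFrame b)
    simp only [one_mul] at e1
    rw [Fintype.sum_prod_type] at e1
    rw [← e1]
    congr 1
    funext u
    have t3 : Fin.tail (Fin.tail u) 0 = u 2 := rfl
    have t3' : Fin.tail (Fin.tail (Fin.tail u)) 0 = u 3 := rfl
    have q1 : wirtinger (fun y => wirtingerBar (fun y => m y (t4 u)) (u 3) y) (u 2) z =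
        ∑ j, ∑ k, b.repr (u 2) j * star (b.repr (u 3) k) *
          wirtinger (wirtingerBar (fun y => m y (t4 u)) (b k)) (b j) z := by
      rw [wirtinger_basis b]
      refine Finset.sum_congr rfl fun j _ => ?_
      simp only [wirtingerBar_basis b (fun y => m y (t4 u)) (u 3)]
      rw [wirtinger_sum _ fun k _ => (hmw _ _ hz).const_mul _, Finset.mul_sum]
      refine Finset.sum_congr rfl fun k _ => ?_
      rw [wirtinger_const_mul _ _ (hmw _ _ hz), mul_assoc]
    rw [t3, t3']
    change _ = _ * wirtinger (fun y => wirtingerBar (fun y => m y (t4 u)) (u 3) y) (u 2) z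
    rw [q1, Fintype.sum_prod_type, Finset.mul_sum]
    refine Finset.sum_congr rfl fun j _ => ?_
    rw [Finset.mul_sum]
    refine Finset.sum_congr rfl fun k _ => ?_
    rw [hS]
    ring
  have hne : (c * (p.factorial * (-2 * Complex.I) ^ (p + 2))) ≠ 0 := by
    have : (p.factorial : ℂ) ≠ 0 := by exact_mod_cast p.factorial_ne_zero
    simp [hc, this]
  set c' := (c * (p.factorial * (-2 * Complex.I) ^ (p + 2)))
  refine (mul_eq_zero.mp (Eq.trans ?_ h4)).resolve_left hne
  rw [Finset.mul_sum]
  refine Finset.sum_congr rfl fun j _ => ?_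
  rw [Finset.mul_sum]
  refine Finset.sum_congr rfl fun k _ => ?_
  set f := fun y => altSum (fun u : N => S j k u * m y (t4 u)) (realFrame b)
  have hfs : ContDiffOn ℝ ∞ f U :=
    ContDiffOn.sum fun σ _ => contDiffOn_const.mul (contDiffOn_const.mul (hms _))
  have hf {y} (hy : y ∈ U) : DifferentiableAt ℝ f y := differentiableAt_of_contDiffOn hU hfs hy
  have e {y} (hy : y ∈ U) : (fun y => (G y).det * ((G y)⁻¹ k j * (G y)⁻¹.trace -
      ((G y)⁻¹ * (G y)⁻¹) k j)) =ᶠ[nhds y] fun y => c'⁻¹ * f y := by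
    filter_upwards [hU.mem_nhds hy] with y hy
    rw [show f y = _ from hA j k y hy, inv_mul_cancel_left₀ hne]
  have e' : wirtingerBar (fun y => (G y).det * ((G y)⁻¹ k j * (G y)⁻¹.trace -
      ((G y)⁻¹ * (G y)⁻¹) k j)) (b k) =ᶠ[nhds z] fun y => c'⁻¹ * wirtingerBar f (b k) y := by
    filter_upwards [hU.mem_nhds hz] with y hy
    rw [wirtingerBar_congr _ (e hy), wirtingerBar_const_mul _ _ (hf hy)]
  rw [wirtinger_congr _ e', wirtinger_const_mul _ _ (differentiableAt_of_contDiffOn hU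
    (contDiffOn_wirtingerBar _ hU hfs) hz), mul_inv_cancel_left₀ hne]

end Tests

/-! ### Derivations and matrix valued functions -/

section Derivations

variable {E : Type*} [NormedAddCommGroup E] [NormedSpace ℂ E]

theorem differentiableAt_finsetProd {ι : Type*} {s : Finset ι} {F : ι → E → ℂ} {z : E}
    (hF : ∀ i ∈ s, DifferentiableAt ℝ (F i) z) :
    DifferentiableAt ℝ (fun y => ∏ i ∈ s, F i y) z := by
  classical
  exact (HasFDerivAt.finsetProd fun i hi => (hF i hi).hasFDerivAt).differentiableAt

/-- A complex derivation at `z` of the algebra of differentiable complex functions. -/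
structure PointDerivation (z : E) where
  /-- the underlying map -/
  toFun : (E → ℂ) → ℂ
  map_add : ∀ {f g : E → ℂ}, DifferentiableAt ℝ f z → DifferentiableAt ℝ g z →
    toFun (fun y => f y + g y) = toFun f + toFun g
  map_mul : ∀ {f g : E → ℂ}, DifferentiableAt ℝ f z → DifferentiableAt ℝ g z →
    toFun (fun y => f y * g y) = toFun f * g z + f z * toFun g
  map_const : ∀ c, toFun (fun _ => c) = 0
  congr : ∀ {f g : E → ℂ}, f =ᶠ[nhds z] g → toFun f = toFun g

/-- The derivation `∂ᵥ`. -/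
def wirtingerDerivation (v z : E) : PointDerivation z where
  toFun f := wirtinger f v z
  map_add hf hg := wirtinger_add v hf hg
  map_mul hf hg := wirtinger_mul v hf hg
  map_const c := wirtinger_const v c
  congr h := wirtinger_congr v h

/-- The derivation `∂̄ᵥ`. -/
def wirtingerBarDerivation (v z : E) : PointDerivation z where
  toFun f := wirtingerBar f v z
  map_add hf hg := wirtingerBar_add v hf hg
  map_mul hf hg := wirtingerBar_mul v hf hg
  map_const c := wirtingerBar_const v c
  congr h := wirtingerBar_congr v h

namespace PointDerivation

variable {z : E} (D : PointDerivation z)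

theorem map_const_mul (c : ℂ) {f : E → ℂ} (hf : DifferentiableAt ℝ f z) :
    D.toFun (fun y => c * f y) = c * D.toFun f := by
  rw [D.map_mul (differentiableAt_const c) hf, D.map_const, zero_mul, zero_add]

theorem map_neg {f : E → ℂ} (hf : DifferentiableAt ℝ f z) :
    D.toFun (fun y => -f y) = -D.toFun f := by
  have := D.map_const_mul (-1) hf
  simpa using this

theorem map_sub {f g : E → ℂ} (hf : DifferentiableAt ℝ f z) (hg : DifferentiableAt ℝ g z) :
    D.toFun (fun y => f y - g y) = D.toFun f - D.toFun g := by
  simp only [sub_eq_add_neg]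
  rw [D.map_add hf hg.fun_neg, D.map_neg hg]

theorem map_sum {ι : Type*} {s : Finset ι} {F : ι → E → ℂ}
    (hF : ∀ i ∈ s, DifferentiableAt ℝ (F i) z) :
    D.toFun (fun y => ∑ i ∈ s, F i y) = ∑ i ∈ s, D.toFun (F i) := by
  classical
  induction s using Finset.induction_on with
  | empty => simp [D.map_const]
  | insert i s hi ih =>
    simp only [Finset.sum_insert hi]
    rw [D.map_add (hF i (Finset.mem_insert_self i s)) (DifferentiableAt.fun_sum fun j hj =>
      hF j (Finset.mem_insert_of_mem hj)), ih fun j hj => hF j (Finset.mem_insert_of_mem hj)]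

theorem map_prod {ι : Type*} [DecidableEq ι] {s : Finset ι} {F : ι → E → ℂ}
    (hF : ∀ i, DifferentiableAt ℝ (F i) z) :
    D.toFun (fun y => ∏ i ∈ s, F i y) =
      ∑ i ∈ s, D.toFun (F i) * ∏ j ∈ s.erase i, F j z := by
  induction s using Finset.induction_on with
  | empty => simp [D.map_const]
  | insert i s hi ih =>
    have hd : DifferentiableAt ℝ (fun y => ∏ i ∈ s, F i y) z :=
      differentiableAt_finsetProd fun j _ => hF j
    simp only [Finset.prod_insert hi]
    rw [D.map_mul (hF i) hd, Finset.sum_insert hi, Finset.erase_insert hi, ih, Finset.mul_sum]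
    congr 1
    refine Finset.sum_congr rfl fun j hj => ?_
    have hij : i ≠ j := fun h => hi (h ▸ hj)
    rw [Finset.erase_insert_of_ne hij, Finset.prod_insert fun h => hi (Finset.mem_of_mem_erase h)]
    ring

/-- The entrywise application of a derivation to a matrix valued function. -/
def mat {n : ℕ} (M : E → Matrix (Fin n) (Fin n) ℂ) : Matrix (Fin n) (Fin n) ℂ :=
  Matrix.of fun p q => D.toFun fun y => M y p q

variable {n : ℕ} {M N : E → Matrix (Fin n) (Fin n) ℂ}

theorem mat_mul (hM : ∀ p q, DifferentiableAt ℝ (fun y => M y p q) z)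
    (hN : ∀ p q, DifferentiableAt ℝ (fun y => N y p q) z) :
    D.mat (fun y => M y * N y) = D.mat M * N z + M z * D.mat N := by
  ext p q
  simp only [mat, Matrix.of_apply, Matrix.mul_apply, Matrix.add_apply]
  rw [D.map_sum fun i _ => (hM p i).fun_mul (hN i q), ← Finset.sum_add_distrib]
  exact Finset.sum_congr rfl fun i _ => D.map_mul (hM p i) (hN i q)

theorem map_trace (hM : ∀ p q, DifferentiableAt ℝ (fun y => M y p q) z) :
    D.toFun (fun y => (M y).trace) = (D.mat M).trace := by
  simp only [Matrix.trace, Matrix.diag]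
  rw [D.map_sum fun i _ => hM i i]
  rfl

/-- Jacobi's formula. Differentiating column by column and applying Cramer's rule gives the trace of
adj(M) times the derivative of M. -/
theorem map_det (hM : ∀ p q, DifferentiableAt ℝ (fun y => M y p q) z) (hdet : IsUnit (M z).det) :
    D.toFun (fun y => (M y).det) = (M z).det * ((M z)⁻¹ * D.mat M).trace := by
  simp only [Matrix.det_apply']
  rw [D.map_sum fun σ _ => DifferentiableAt.fun_mul (differentiableAt_const _)
    (differentiableAt_finsetProd fun i _ => hM _ _)]
  have h1 (σ : Equiv.Perm (Fin n)) : D.toFun (fun y => ((Equiv.Perm.sign σ : ℤ) : ℂ) *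
      ∏ i, M y (σ i) i) = ∑ i, ((Equiv.Perm.sign σ : ℤ) : ℂ) *
        ∏ l, (M z).updateCol i (fun p => D.mat M p i) (σ l) l := by
    rw [D.map_const_mul _ (differentiableAt_finsetProd fun i _ => hM _ _),
      D.map_prod (F := fun i y => M y (σ i) i) fun i => hM _ _, Finset.mul_sum]
    refine Finset.sum_congr rfl fun i _ => ?_
    congr 1
    rw [← Finset.mul_prod_erase Finset.univ _ (Finset.mem_univ i)]
    congr 1
    · simp [mat]
    · refine Finset.prod_congr rfl fun l hl => ?_
      rw [Matrix.updateCol_ne (Finset.ne_of_mem_erase hl)]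
  simp only [h1]
  rw [Finset.sum_comm]
  have h2 (i : Fin n) : ∑ σ : Equiv.Perm (Fin n), ((Equiv.Perm.sign σ : ℤ) : ℂ) *
        ∏ l, (M z).updateCol i (fun p => D.mat M p i) (σ l) l =
        ((M z).adjugate * D.mat M) i i := by
    rw [← Matrix.det_apply', ← Matrix.cramer_apply, Matrix.cramer_eq_adjugate_mulVec]
    rfl
  simp only [h2]
  have h3 : (M z).adjugate = (M z).det • (M z)⁻¹ := by
    rw [Matrix.inv_def, smul_smul, Ring.mul_inverse_cancel _ hdet, one_smul]
  rw [h3, Matrix.smul_mul, ← Matrix.det_apply']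
  exact Matrix.trace_smul _ _

/-- Differentiate M⁻¹ M = 1; invertibility is needed in a neighbourhood because the derivation sees
germs. -/
theorem mat_inv (hM : ∀ p q, DifferentiableAt ℝ (fun y => M y p q) z)
    (hI : ∀ p q, DifferentiableAt ℝ (fun y => (M y)⁻¹ p q) z)
    (hdet : ∀ᶠ y in nhds z, IsUnit (M y).det) :
    D.mat (fun y => (M y)⁻¹) = -((M z)⁻¹ * D.mat M * (M z)⁻¹) := by
  have h1 : D.mat (fun y => (M y)⁻¹ * M y) = 0 := by
    ext p q
    simp only [mat, Matrix.of_apply, Matrix.zero_apply]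
    rw [D.congr (g := fun _ => (1 : Matrix (Fin n) (Fin n) ℂ) p q), D.map_const]
    filter_upwards [hdet] with y hy
    rw [Matrix.nonsing_inv_mul _ hy]
  rw [D.mat_mul hI hM] at h1
  have h2 := congrArg (fun X => X * (M z)⁻¹) h1
  simp only [Matrix.add_mul, Matrix.zero_mul, Matrix.mul_assoc,
    Matrix.mul_nonsing_inv _ hdet.self_of_nhds, Matrix.mul_one] at h2
  rw [eq_neg_of_add_eq_zero_left h2, Matrix.mul_assoc]

end PointDerivation

theorem contDiffOn_det {F : Type*} [NormedAddCommGroup F] [NormedSpace ℝ F] {N : WithTop ℕ∞}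
    {n : ℕ} {U : Set F} {M : F → Matrix (Fin n) (Fin n) ℂ}
    (hM : ∀ p q, ContDiffOn ℝ N (fun y => M y p q) U) :
    ContDiffOn ℝ N (fun y => (M y).det) U := by
  simp only [Matrix.det_apply']
  exact ContDiffOn.sum fun σ _ => contDiffOn_const.mul (contDiffOn_prod fun i _ => hM _ _)

theorem contDiffOn_matrix_inv {F : Type*} [NormedAddCommGroup F] [NormedSpace ℝ F]
    {N : WithTop ℕ∞} {n : ℕ} {U : Set F} {M : F → Matrix (Fin n) (Fin n) ℂ}
    (hM : ∀ p q, ContDiffOn ℝ N (fun y => M y p q) U) (hdet : ∀ y ∈ U, IsUnit (M y).det)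
    (p q : Fin n) : ContDiffOn ℝ N (fun y => (M y)⁻¹ p q) U := by
  have h : ContDiffOn ℝ N (fun y => (M y).det⁻¹ * (M y).adjugate p q) U := by
    refine ((contDiffOn_det hM).inv fun y hy => (hdet y hy).ne_zero).mul ?_
    simp only [Matrix.adjugate_apply]
    refine contDiffOn_det fun i j => ?_
    by_cases hi : i = q
    · subst hi; simpa using contDiffOn_const
    · simpa [Matrix.updateRow_ne hi] using hM i j
  refine h.congr fun y _ => ?_
  rw [Matrix.inv_def, Ring.inverse_eq_inv']
  rfl

theorem contDiffOn_matrix_mul {F : Type*} [NormedAddCommGroup F] [NormedSpace ℝ F]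
    {N : WithTop ℕ∞} {n : ℕ} {U : Set F} {M M' : F → Matrix (Fin n) (Fin n) ℂ}
    (hM : ∀ p q, ContDiffOn ℝ N (fun y => M y p q) U)
    (hM' : ∀ p q, ContDiffOn ℝ N (fun y => M' y p q) U) (p q : Fin n) :
    ContDiffOn ℝ N (fun y => (M y * M' y) p q) U := by
  simp only [Matrix.mul_apply]
  exact ContDiffOn.sum fun i _ => (hM _ _).mul (hM' _ _)

theorem contDiffOn_trace {F : Type*} [NormedAddCommGroup F] [NormedSpace ℝ F]
    {N : WithTop ℕ∞} {n : ℕ} {U : Set F} {M : F → Matrix (Fin n) (Fin n) ℂ}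
    (hM : ∀ p q, ContDiffOn ℝ N (fun y => M y p q) U) :
    ContDiffOn ℝ N (fun y => (M y).trace) U := by
  simp only [Matrix.trace, Matrix.diag]
  exact ContDiffOn.sum fun i _ => hM _ _

end Derivations

/-! ### Second derivatives of det(G) G⁻¹ and of its traced analogue -/

section SecondDerivatives

variable {E : Type*} [NormedAddCommGroup E] [NormedSpace ℂ E] {n : ℕ}
  {G : E → Matrix (Fin n) (Fin n) ℂ} {U : Set E}

/-- The matrix `∂ᵥ G`. -/
def wirtingerMat (G : E → Matrix (Fin n) (Fin n) ℂ) (v z : E) : Matrix (Fin n) (Fin n) ℂ :=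
  Matrix.of fun p q => wirtinger (fun y => G y p q) v z

/-- The matrix `∂̄ᵥ G`. -/
def wirtingerBarMat (G : E → Matrix (Fin n) (Fin n) ℂ) (w z : E) : Matrix (Fin n) (Fin n) ℂ :=
  Matrix.of fun p q => wirtingerBar (fun y => G y p q) w z

/-- The matrix `∂ᵥ ∂̄_w G`. -/
def wirtingerMat₂ (G : E → Matrix (Fin n) (Fin n) ℂ) (v w z : E) : Matrix (Fin n) (Fin n) ℂ :=
  Matrix.of fun p q => wirtinger (wirtingerBar (fun y => G y p q) w) v z

/-- Jacobi's formula and the derivative of the inverse, applied twice. The first derivative is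
computed on a neighbourhood for general G; only after the second one is G = 1 inserted. -/
theorem wirtinger_wirtingerBar_det_mul_inv (hU : IsOpen U)
    (hG : ∀ p q, ContDiffOn ℝ ∞ (fun y => G y p q) U) (hdet : ∀ y ∈ U, IsUnit (G y).det)
    {z : E} (hz : z ∈ U) (h1 : G z = 1) (v w : E) (k j : Fin n) :
    wirtinger (wirtingerBar (fun y => (G y).det * (G y)⁻¹ k j) w) v z =
            ((wirtingerMat G v z).trace * (wirtingerBarMat G w z).trace - (wirtingerMat G v z * (wirtingerBarMat G w z)).trace + (wirtingerMat₂ G v w z).trace) * (1 : Matrix (Fin n) (Fin n) ℂ) k j -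
        (wirtingerMat G v z).trace * wirtingerBarMat G w z k j - (wirtingerBarMat G w z).trace * wirtingerMat G v z k j - wirtingerMat₂ G v w z k j + (wirtingerMat G v z * (wirtingerBarMat G w z)) k j + (wirtingerBarMat G w z * (wirtingerMat G v z)) k j := by
  set A := wirtingerMat G v z with hAdef
  set B := wirtingerBarMat G w z with hBdef
  set C := wirtingerMat₂ G v w z with hCdef
  set δ := wirtingerDerivation v z
  let Bf : E → Matrix (Fin n) (Fin n) ℂ := fun y => (wirtingerBarDerivation w y).mat G
  have hI := contDiffOn_matrix_inv hG hdet
  have hB (p q) : ContDiffOn ℝ ∞ (fun y => Bf y p q) U := contDiffOn_wirtingerBar w hU (hG p q)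
  have hIB := contDiffOn_matrix_mul hI hB
  have hIBI := contDiffOn_matrix_mul hIB hI
  have dA {f : E → ℂ} (hf : ContDiffOn ℝ ∞ f U) : DifferentiableAt ℝ f z :=
    differentiableAt_of_contDiffOn hU hf hz
  have e1 : wirtingerBar (fun y => (G y).det * (G y)⁻¹ k j) w =ᶠ[nhds z]
      fun y => (G y).det * (((G y)⁻¹ * Bf y).trace * (G y)⁻¹ k j - ((G y)⁻¹ * Bf y * (G y)⁻¹) k j) := by
    filter_upwards [hU.mem_nhds hz] with y hy
    have dy {f : E → ℂ} (hf : ContDiffOn ℝ ∞ f U) : DifferentiableAt ℝ f y :=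
      differentiableAt_of_contDiffOn hU hf hy
    have r1 := (wirtingerBarDerivation w y).map_det (fun p q => dy (hG p q)) (hdet y hy)
    have r2 := congrFun (congrFun ((wirtingerBarDerivation w y).mat_inv (fun p q => dy (hG p q))
      (fun p q => dy (hI p q)) (by filter_upwards [hU.mem_nhds hy] using hdet)) k) j
    have r3 := (wirtingerBarDerivation w y).map_mul (dy (contDiffOn_det hG)) (dy (hI k j))
    have r4 : (wirtingerBarDerivation w y).toFun (fun y => (G y)⁻¹ k j) =
      (-((G y)⁻¹ * Bf y * (G y)⁻¹)) k j := r2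
    refine r3.trans ?_
    rw [r1, r4, Matrix.neg_apply]
    ring
  rw [wirtinger_congr _ e1]
  have hA : δ.mat G = A := rfl
  have hBz : Bf z = B := rfl
  have hC : δ.mat Bf = C := rfl
  have d1 := δ.map_det (fun p q => dA (hG p q)) (hdet z hz)
  have d2 := δ.mat_inv (fun p q => dA (hG p q))
      (fun p q => dA (hI p q)) (by filter_upwards [hU.mem_nhds hz] using hdet)
  have d3 := δ.mat_mul (fun p q => dA (hI p q)) (fun p q => dA (hB p q))
  have d4 := δ.mat_mul (fun p q => dA (hIB p q)) (fun p q => dA (hI p q))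
  have d5 := δ.map_trace (fun p q => dA (hIB p q))
  have d6 := δ.map_mul (dA (contDiffOn_trace hIB)) (dA (hI k j))
  have d7 := δ.map_sub (dA ((contDiffOn_trace hIB).mul (hI k j))) (dA (hIBI k j))
  have d8 := δ.map_mul (dA (contDiffOn_det hG))
    (dA (((contDiffOn_trace hIB).mul (hI k j)).sub (hIBI k j)))
  refine d8.trans ?_
  have d9 : δ.toFun (fun y => (G y)⁻¹ k j) = δ.mat (fun y => (G y)⁻¹) k j := rfl
  have d10 : δ.toFun (fun y => ((G y)⁻¹ * Bf y * (G y)⁻¹) k j) =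
    δ.mat (fun y => (G y)⁻¹ * Bf y * (G y)⁻¹) k j := rfl
  rw [d7, d6, d5, d1, d9, d10, d4, d3, d2, hA, hC, hBz, h1]
  simp only [inv_one, Matrix.one_mul, Matrix.mul_one, Matrix.det_one, Matrix.add_apply,
    Matrix.neg_apply, Matrix.neg_mul, Matrix.mul_neg, Matrix.trace_add, Matrix.trace_neg]
  ring

/-- The same second order and quadratic terms occur as for det(G) G⁻¹, but with weights n - 2 and n
- 3, which come from tr(1) = n. The difference between the two pairs of weights is what allows the
second order terms to be eliminated later. -/
theorem wirtinger_wirtingerBar_det_mul_inv_sub (hU : IsOpen U)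
    (hG : ∀ p q, ContDiffOn ℝ ∞ (fun y => G y p q) U) (hdet : ∀ y ∈ U, IsUnit (G y).det)
    {z : E} (hz : z ∈ U) (h1 : G z = 1) (v w : E) (k j : Fin n) :
    wirtinger (wirtingerBar (fun y => (G y).det * ((G y)⁻¹ k j * (G y)⁻¹.trace -
      ((G y)⁻¹ * (G y)⁻¹) k j)) w) v z =
            ((n : ℂ) - 2) * ((wirtingerMat₂ G v w z).trace * (1 : Matrix (Fin n) (Fin n) ℂ) k j - wirtingerMat₂ G v w z k j) + ((n : ℂ) - 3) *
      (((wirtingerMat G v z).trace * (wirtingerBarMat G w z).trace - (wirtingerMat G v z * (wirtingerBarMat G w z)).trace) * (1 : Matrix (Fin n) (Fin n) ℂ) k j -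
        (wirtingerMat G v z).trace * wirtingerBarMat G w z k j - (wirtingerBarMat G w z).trace * wirtingerMat G v z k j + (wirtingerMat G v z * (wirtingerBarMat G w z)) k j + (wirtingerBarMat G w z * (wirtingerMat G v z)) k j) := by
  set A := wirtingerMat G v z with hAdef
  set B := wirtingerBarMat G w z with hBdef
  set C := wirtingerMat₂ G v w z with hCdef
  set δ := wirtingerDerivation v z
  let Bf : E → Matrix (Fin n) (Fin n) ℂ := fun y => (wirtingerBarDerivation w y).mat G
  have hI := contDiffOn_matrix_inv hG hdet
  have hB (p q) : ContDiffOn ℝ ∞ (fun y => Bf y p q) U := contDiffOn_wirtingerBar w hU (hG p q)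
  have hII := contDiffOn_matrix_mul hI hI
  have hIB := contDiffOn_matrix_mul hI hB
  have hIBI := contDiffOn_matrix_mul hIB hI
  have hIBII := contDiffOn_matrix_mul hIBI hI
  have hIIBI := contDiffOn_matrix_mul hI hIBI
  have dA {f : E → ℂ} (hf : ContDiffOn ℝ ∞ f U) : DifferentiableAt ℝ f z :=
    differentiableAt_of_contDiffOn hU hf hz
  have e1 : wirtingerBar (fun y => (G y).det * ((G y)⁻¹ k j * (G y)⁻¹.trace -
      ((G y)⁻¹ * (G y)⁻¹) k j)) w =ᶠ[nhds z]
      fun y => (G y).det * (((G y)⁻¹ * Bf y).trace * ((G y)⁻¹ k j * (G y)⁻¹.trace -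
        ((G y)⁻¹ * (G y)⁻¹) k j) + ((((G y)⁻¹ * Bf y * (G y)⁻¹ * (G y)⁻¹) k j +
          ((G y)⁻¹ * ((G y)⁻¹ * Bf y * (G y)⁻¹)) k j) -
          (((G y)⁻¹ * Bf y * (G y)⁻¹) k j * (G y)⁻¹.trace +
          (G y)⁻¹ k j * ((G y)⁻¹ * Bf y * (G y)⁻¹).trace))) := by
    filter_upwards [hU.mem_nhds hz] with y hy
    have dy {f : E → ℂ} (hf : ContDiffOn ℝ ∞ f U) : DifferentiableAt ℝ f y :=
      differentiableAt_of_contDiffOn hU hf hy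
    set ε := wirtingerBarDerivation w y
    have r1 := ε.map_det (fun p q => dy (hG p q)) (hdet y hy)
    have r2 := ε.mat_inv (fun p q => dy (hG p q))
      (fun p q => dy (hI p q)) (by filter_upwards [hU.mem_nhds hy] using hdet)
    have r3 := ε.mat_mul (fun p q => dy (hI p q)) (fun p q => dy (hI p q))
    have r4 := ε.map_trace (fun p q => dy (hI p q))
    have r5 := ε.map_mul (dy (hI k j)) (dy (contDiffOn_trace hI))
    have r6 := ε.map_sub (dy ((hI k j).mul (contDiffOn_trace hI))) (dy (hII k j))
    have r7 := ε.map_mul (dy (contDiffOn_det hG))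
      (dy (((hI k j).mul (contDiffOn_trace hI)).sub (hII k j)))
    have r8 : ε.toFun (fun y => (G y)⁻¹ k j) = ε.mat (fun y => (G y)⁻¹) k j := rfl
    have r9 : ε.toFun (fun y => ((G y)⁻¹ * (G y)⁻¹) k j) =
      ε.mat (fun y => (G y)⁻¹ * (G y)⁻¹) k j := rfl
    refine r7.trans ?_
    rw [r6, r5, r4, r1, r8, r9, r3, r2]
    change (G y).det * ((G y)⁻¹ * Bf y).trace * _ + _ * (-((G y)⁻¹ * Bf y * (G y)⁻¹) k j * _ +
      _ * (-((G y)⁻¹ * Bf y * (G y)⁻¹)).trace - (-((G y)⁻¹ * Bf y * (G y)⁻¹) * (G y)⁻¹ +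
        (G y)⁻¹ * (-((G y)⁻¹ * Bf y * (G y)⁻¹)) : Matrix (Fin n) (Fin n) ℂ) k j) = _
    simp only [Matrix.add_apply, Matrix.neg_apply, Matrix.neg_mul, Matrix.mul_neg, Matrix.trace_neg]
    ring
  rw [wirtinger_congr _ e1]
  have hA : δ.mat G = A := rfl
  have hBz : Bf z = B := rfl
  have hC : δ.mat Bf = C := rfl
  have d1 := δ.map_det (fun p q => dA (hG p q)) (hdet z hz)
  have d2 := δ.mat_inv (fun p q => dA (hG p q))
      (fun p q => dA (hI p q)) (by filter_upwards [hU.mem_nhds hz] using hdet)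
  have d3 := δ.mat_mul (fun p q => dA (hI p q)) (fun p q => dA (hB p q))
  have d4 := δ.mat_mul (fun p q => dA (hIB p q)) (fun p q => dA (hI p q))
  have d4' := δ.mat_mul (fun p q => dA (hI p q)) (fun p q => dA (hI p q))
  have d4a := δ.mat_mul (fun p q => dA (hIBI p q)) (fun p q => dA (hI p q))
  have d4b := δ.mat_mul (fun p q => dA (hI p q)) (fun p q => dA (hIBI p q))
  have d5 := δ.map_trace (fun p q => dA (hIB p q))
  have d5a := δ.map_trace (fun p q => dA (hI p q))
  have d5b := δ.map_trace (fun p q => dA (hIBI p q))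
  have hX := ((hI k j).mul (contDiffOn_trace hI)).sub (hII k j)
  have hY := (hIBII k j).add (hIIBI k j)
  have hZ1 := (hIBI k j).mul (contDiffOn_trace hI)
  have hZ2 := (hI k j).mul (contDiffOn_trace hIBI)
  have s1 := δ.map_mul (dA (hI k j)) (dA (contDiffOn_trace hI))
  have s2 := δ.map_sub (dA ((hI k j).mul (contDiffOn_trace hI))) (dA (hII k j))
  have s3 := δ.map_mul (dA (contDiffOn_trace hIB)) (dA hX)
  have s4 := δ.map_add (dA (hIBII k j)) (dA (hIIBI k j))
  have s5 := δ.map_mul (dA (hIBI k j)) (dA (contDiffOn_trace hI))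
  have s6 := δ.map_mul (dA (hI k j)) (dA (contDiffOn_trace hIBI))
  have s7 := δ.map_add (dA hZ1) (dA hZ2)
  have s8 := δ.map_sub (dA hY) (dA (hZ1.add hZ2))
  have s9 := δ.map_add (dA ((contDiffOn_trace hIB).mul hX)) (dA (hY.sub (hZ1.add hZ2)))
  have s10 := δ.map_mul (dA (contDiffOn_det hG))
    (dA (((contDiffOn_trace hIB).mul hX).add (hY.sub (hZ1.add hZ2))))
  refine s10.trans ?_
  have m1 : δ.toFun (fun y => (G y)⁻¹ k j) = δ.mat (fun y => (G y)⁻¹) k j := rfl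
  have m2 : δ.toFun (fun y => ((G y)⁻¹ * (G y)⁻¹) k j) =
    δ.mat (fun y => (G y)⁻¹ * (G y)⁻¹) k j := rfl
  have m3 : δ.toFun (fun y => ((G y)⁻¹ * Bf y * (G y)⁻¹) k j) =
    δ.mat (fun y => (G y)⁻¹ * Bf y * (G y)⁻¹) k j := rfl
  have m4 : δ.toFun (fun y => ((G y)⁻¹ * Bf y * (G y)⁻¹ * (G y)⁻¹) k j) =
    δ.mat (fun y => (G y)⁻¹ * Bf y * (G y)⁻¹ * (G y)⁻¹) k j := rfl
  have m5 : δ.toFun (fun y => ((G y)⁻¹ * ((G y)⁻¹ * Bf y * (G y)⁻¹)) k j) =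
    δ.mat (fun y => (G y)⁻¹ * ((G y)⁻¹ * Bf y * (G y)⁻¹)) k j := rfl
  rw [s9, s8, s7, s6, s5, s4, s3, s2, s1, d5, d5a, d5b, d1, m1, m2, m3, m4, m5, d4a, d4b, d4', d4,
    d3, d2, hA, hC, hBz, h1]
  -- The only place where the dimension enters the coefficients.
  have hn : (1 : Matrix (Fin n) (Fin n) ℂ).trace = n := by simp
  simp only [inv_one, Matrix.one_mul, Matrix.mul_one, Matrix.det_one, Matrix.add_apply,
    Matrix.neg_apply, Matrix.neg_mul, Matrix.mul_neg, Matrix.trace_add, Matrix.trace_neg, hn,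
    Matrix.mul_add, Matrix.trace_mul_comm B A]
  ring

end SecondDerivatives

/-! ### The pointwise identity for conformally balanced, astheno-Kähler metrics -/

section Torsion

variable {E : Type*} [NormedAddCommGroup E] [NormedSpace ℂ E] {n : ℕ}

/-- The torsion `∂ⱼ g_{l̄k} - ∂ₖ g_{l̄j}` of an array of first derivatives. -/
def torsion (A : Fin n → Matrix (Fin n) (Fin n) ℂ) (j k l : Fin n) : ℂ := A j k l - A k j l

/-- The trace of the torsion. -/
def torsionTrace (A : Fin n → Matrix (Fin n) (Fin n) ℂ) (l : Fin n) : ℂ :=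
  (A l).trace - ∑ j, A j l j

/-- Put aₗ = tr Aₗ and sₗ = ∑ⱼ (Aⱼ)ₗⱼ, so that τ = a - s. The terms in a and s complete the square
|a - s|²; what remains is minus the squared norm of A plus its pairing with the index-swapped array,
which is -½|T|². -/
theorem sum_quadratic_eq_torsion (A B : Fin n → Matrix (Fin n) (Fin n) ℂ)
    (hB : ∀ k p q, B k p q = star (A k q p)) :
    ∑ j, ∑ k, (((A j).trace * (B k).trace - (A j * B k).trace) *
      (1 : Matrix (Fin n) (Fin n) ℂ) k j - (A j).trace * B k k j - (B k).trace * A j k j +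
      (A j * B k) k j + (B k * A j) k j) =
    ∑ l, torsionTrace A l * star (torsionTrace A l) -
      (1 / 2) * ∑ j, ∑ k, ∑ l, torsion A j k l * star (torsion A j k l) := by
  set a : Fin n → ℂ := fun j => (A j).trace with ha
  set s : Fin n → ℂ := fun l => ∑ j, A j l j with hs
  have hb (k) : (B k).trace = star (a k) := by
    simp only [ha, Matrix.trace, Matrix.diag, hB, star_sum]
  have hs' (j) : ∑ k, B k k j = star (s j) := by simp only [hs, hB, star_sum]
  have e1 : ∑ j, ∑ k, ((A j).trace * (B k).trace - (A j * B k).trace) *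
      (1 : Matrix (Fin n) (Fin n) ℂ) k j = ∑ j, a j * star (a j) -
        ∑ j, ∑ k, ∑ l, A j k l * star (A j k l) := by
    rw [← Finset.sum_sub_distrib]
    refine Finset.sum_congr rfl fun j _ => ?_
    rw [Finset.sum_eq_single j]
    · rw [Matrix.one_apply_eq, mul_one, hb]
      simp only [Matrix.trace, Matrix.diag, Matrix.mul_apply, hB, ha]
    · intro k _ hk
      rw [Matrix.one_apply_ne hk, mul_zero]
    · simp
  have e2 : ∑ j, ∑ k, (A j).trace * B k k j = ∑ j, a j * star (s j) := by
    refine Finset.sum_congr rfl fun j _ => ?_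
    rw [← Finset.mul_sum, hs']
  have e3 : ∑ j, ∑ k, (B k).trace * A j k j = ∑ k, star (a k) * s k := by
    rw [Finset.sum_comm]
    refine Finset.sum_congr rfl fun k _ => ?_
    rw [← Finset.mul_sum, hb]
  have e4 : ∑ j, ∑ k, (A j * B k) k j = ∑ j, ∑ k, ∑ l, A j k l * star (A k j l) := by
    simp only [Matrix.mul_apply, hB]
  have e5 : ∑ j, ∑ k, (B k * A j) k j = ∑ l, s l * star (s l) := by
    have key (l : Fin n) : s l * star (s l) = ∑ j, ∑ k, A j l j * star (A k l k) := by
      simp only [hs, star_sum, Finset.sum_mul_sum]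
    simp only [key, Matrix.mul_apply, hB]
    rw [Finset.sum_comm (f := fun l j => ∑ k, A j l j * star (A k l k))]
    refine Finset.sum_congr rfl fun j _ => ?_
    rw [Finset.sum_comm]
    exact Finset.sum_congr rfl fun l _ => Finset.sum_congr rfl fun k _ => mul_comm _ _
  have e6 : ∑ l, torsionTrace A l * star (torsionTrace A l) = ∑ l, a l * star (a l) -
      ∑ l, a l * star (s l) - ∑ l, star (a l) * s l + ∑ l, s l * star (s l) := by
    rw [← Finset.sum_sub_distrib, ← Finset.sum_sub_distrib, ← Finset.sum_add_distrib]
    refine Finset.sum_congr rfl fun l _ => ?_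
    change (a l - s l) * star (a l - s l) = _
    rw [star_sub]; ring
  have e7 : ∑ j, ∑ k, ∑ l, A k j l * star (A k j l) = ∑ j, ∑ k, ∑ l, A j k l * star (A j k l) :=
    Finset.sum_comm
  have e8 : ∑ j, ∑ k, ∑ l, A k j l * star (A j k l) = ∑ j, ∑ k, ∑ l, A j k l * star (A k j l) :=
    Finset.sum_comm
  have e9 : ∑ j, ∑ k, ∑ l, torsion A j k l * star (torsion A j k l) =
      ∑ j, ∑ k, ∑ l, A j k l * star (A j k l) + ∑ j, ∑ k, ∑ l, A k j l * star (A k j l) -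
      ∑ j, ∑ k, ∑ l, A j k l * star (A k j l) - ∑ j, ∑ k, ∑ l, A k j l * star (A j k l) := by
    simp only [← Finset.sum_sub_distrib, ← Finset.sum_add_distrib]
    refine Finset.sum_congr rfl fun j _ => Finset.sum_congr rfl fun k _ =>
      Finset.sum_congr rfl fun l _ => ?_
    rw [torsion, star_sub]; ring
  simp only [Finset.sum_sub_distrib, Finset.sum_add_distrib]
  rw [e1, e2, e3, e4, e5, e6, e9, e7, e8]
  ring

/-- The balanced condition enters twice: its first order content at the point expresses ∂ν through
the torsion trace, and its validity on all of U lets one differentiate it once more. The second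
equation is needed only at the point. -/
theorem sum_wirtinger_wirtingerBar_eq_torsion (b : Module.Basis (Fin n) ℂ E)
    {G : E → Matrix (Fin n) (Fin n) ℂ} {ν : E → ℂ} {U : Set E} (hU : IsOpen U)
    (hG : ∀ p q, ContDiffOn ℝ ∞ (fun y => G y p q) U) (hdet : ∀ y ∈ U, IsUnit (G y).det)
    (hherm : ∀ y ∈ U, ∀ p q, star (G y p q) = G y q p)
    (hν : ContDiffOn ℝ ∞ ν U) (hνr : ∀ y ∈ U, star (ν y) = ν y) (hν0 : ∀ y ∈ U, ν y ≠ 0)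
    (hbal : ∀ y ∈ U, ∀ k, ∑ j, wirtinger (fun y => ν y * ((G y).det * (G y)⁻¹ k j)) (b j) y = 0)
    {z : E} (hz : z ∈ U) (h1 : G z = 1)
    (hast : ∑ j, ∑ k, wirtinger (wirtingerBar (fun y => (G y).det * ((G y)⁻¹ k j * (G y)⁻¹.trace -
      ((G y)⁻¹ * (G y)⁻¹) k j)) (b k)) (b j) z = 0) :
    ((n : ℂ) - 2) * ∑ j, wirtinger (wirtingerBar ν (b j)) (b j) z =
      ν z * ((2 * n - 5) * ∑ l, torsionTrace (fun j => wirtingerMat G (b j) z) l *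
        star (torsionTrace (fun j => wirtingerMat G (b j) z) l) +
        (1 / 2) * ∑ j, ∑ k, ∑ l, torsion (fun j => wirtingerMat G (b j) z) j k l *
          star (torsion (fun j => wirtingerMat G (b j) z) j k l)) := by
  set A : Fin n → Matrix (Fin n) (Fin n) ℂ := fun j => wirtingerMat G (b j) z with hA
  set B : Fin n → Matrix (Fin n) (Fin n) ℂ := fun j => wirtingerBarMat G (b j) z with hB
  have hz' := hU.mem_nhds hz
  have dU {f : E → ℂ} (hf : ContDiffOn ℝ ∞ f U) {y : E} (hy : y ∈ U) : DifferentiableAt ℝ f y :=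
    differentiableAt_of_contDiffOn hU hf hy
  have hI := contDiffOn_matrix_inv hG hdet
  have hDet := contDiffOn_det hG
  have hBA (k p q) : B k p q = star (A k q p) := by
    simp only [hA, hB, wirtingerMat, wirtingerBarMat, Matrix.of_apply]
    rw [← wirtingerBar_star _ (dU (hG q p) hz)]
    refine wirtingerBar_congr _ ?_
    filter_upwards [hz'] with y hy
    exact (hherm y hy q p).symm
  have hQ := sum_quadratic_eq_torsion A B hBA
  set Tq := ∑ j, ∑ k, ∑ l, torsion A j k l * star (torsion A j k l)
  set tq := ∑ l, torsionTrace A l * star (torsionTrace A l) with htq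
  -- the inverse of `ν`
  set r : E → ℂ := fun y => (ν y)⁻¹ with hr
  have hrs : ContDiffOn ℝ ∞ r U := hν.inv hν0
  set V : Fin n → Fin n → E → ℂ := fun k j y => ν y * ((G y).det * (G y)⁻¹ k j) with hV
  have hVs (k j) : ContDiffOn ℝ ∞ (V k j) U := hν.mul (hDet.mul (hI k j))
  have hdetr {y} (hy : y ∈ U) : star (G y).det = (G y).det := by
    rw [← Matrix.det_conjTranspose]
    congr 1
    ext p q
    exact hherm y hy q p
  have hinvr {y} (hy : y ∈ U) (p q) : star ((G y)⁻¹ p q) = (G y)⁻¹ q p := by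
    have : (G y).conjTranspose = G y := by
      ext p q
      exact hherm y hy q p
    conv_rhs => rw [← this, ← Matrix.conjTranspose_nonsing_inv]
    rfl
  have hVr {y} (hy : y ∈ U) (k j) : V k j y = star (V j k y) := by
    simp only [hV, star_mul', hνr y hy, hdetr hy, hinvr hy]
  have hbal' {y} (hy : y ∈ U) (j) : ∑ k, wirtingerBar (V k j) (b k) y = 0 := by
    have h := congrArg star (hbal y hy j)
    rw [star_sum, star_zero] at h
    rw [← h]
    refine Finset.sum_congr rfl fun k _ => ?_
    change _ = star (wirtinger (V j k) (b k) y)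
    rw [← wirtingerBar_star _ (dU (hVs j k) hy)]
    refine wirtingerBar_congr _ ?_
    filter_upwards [hU.mem_nhds hy] with x hx using hVr hx k j
  have hVz (k j) : V k j z = ν z * (1 : Matrix (Fin n) (Fin n) ℂ) k j := by
    simp only [hV, h1, inv_one, Matrix.det_one, one_mul]
  -- first derivatives of `ν`
  have hν1 (k) : wirtinger ν (b k) z = -(ν z * torsionTrace A k) := by
    have h := hbal z hz k
    have e (j) : wirtinger (V k j) (b j) z = wirtinger ν (b j) z *
        (1 : Matrix (Fin n) (Fin n) ℂ) k j + ν z * ((A j).trace *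
          (1 : Matrix (Fin n) (Fin n) ℂ) k j - A j k j) := by
      have d1 := (wirtingerDerivation (b j) z).map_det (fun p q => dU (hG p q) hz) (hdet z hz)
      have d2 := (wirtingerDerivation (b j) z).mat_inv (fun p q => dU (hG p q) hz)
        (fun p q => dU (hI p q) hz) (by filter_upwards [hz'] using hdet)
      have d3 := (wirtingerDerivation (b j) z).map_mul (dU hDet hz) (dU (hI k j) hz)
      have d4 := (wirtingerDerivation (b j) z).map_mul (dU hν hz) (dU (hDet.mul (hI k j)) hz)
      have d5 : (wirtingerDerivation (b j) z).toFun (fun y => (G y)⁻¹ k j) =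
        (wirtingerDerivation (b j) z).mat (fun y => (G y)⁻¹) k j := rfl
      refine d4.trans ?_
      have d6 : (wirtingerDerivation (b j) z).mat G = A j := rfl
      rw [d3, d1, d5, d2, d6, h1]
      simp only [inv_one, Matrix.mul_one, Matrix.det_one, Matrix.neg_apply, one_mul]
      change wirtinger ν (b j) z * _ + _ = _
      ring
    have h' : ∑ j, wirtinger (V k j) (b j) z = 0 := h
    simp only [e, Finset.sum_add_distrib, ← Finset.mul_sum, Finset.sum_sub_distrib,
      Matrix.one_apply, mul_ite, mul_one, mul_zero, Finset.sum_ite_eq, Finset.mem_univ,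
      if_true] at h'
    rw [torsionTrace]
    linear_combination h'
  have hν1' (k) : wirtingerBar ν (b k) z = -(ν z * star (torsionTrace A k)) := by
    have h := wirtingerBar_star (b k) (dU hν hz)
    rw [hν1, star_neg, star_mul', hνr z hz] at h
    rw [← h]
    refine wirtingerBar_congr _ ?_
    filter_upwards [hz'] with x hx using (hνr x hx).symm
  have hr2 (j) : wirtinger (wirtingerBar r (b j)) (b j) z =
      -wirtinger (wirtingerBar ν (b j)) (b j) z / ν z ^ 2 +
        2 * torsionTrace A j * star (torsionTrace A j) / ν z := by
    have hνb := contDiffOn_wirtingerBar (b j) hU hν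
    have e : wirtingerBar r (b j) =ᶠ[nhds z] fun y => -1 * (wirtingerBar ν (b j) y * (r y * r y)) := by
      filter_upwards [hz'] with y hy
      rw [hr, wirtingerBar_inv _ (dU hν hy) (hν0 y hy)]
      field_simp
    rw [wirtinger_congr _ e, wirtinger_const_mul _ _ (dU (hνb.mul (hrs.mul hrs)) hz),
      wirtinger_mul _ (dU hνb hz) (dU (hrs.mul hrs) hz), wirtinger_mul _ (dU hrs hz) (dU hrs hz),
      hr, wirtinger_inv _ (dU hν hz) (hν0 z hz), hν1, hν1']
    have := hν0 z hz
    field_simp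
    ring
  -- the two expressions for `∑ ∂ⱼ ∂̄ₖ (det G · G⁻¹)`
  have hX : ∑ j, ∑ k, wirtinger (wirtingerBar (fun y => (G y).det * (G y)⁻¹ k j) (b k)) (b j) z =
      ν z * ∑ j, wirtinger (wirtingerBar r (b j)) (b j) z := by
    have hrb (k) := contDiffOn_wirtingerBar (b k) hU hrs
    have hVb (k j) := contDiffOn_wirtingerBar (b k) hU (hVs k j)
    have e1 (k j) : wirtingerBar (fun y => (G y).det * (G y)⁻¹ k j) (b k) =ᶠ[nhds z] fun y =>
        wirtingerBar r (b k) y * V k j y + r y * wirtingerBar (V k j) (b k) y := by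
      filter_upwards [hz'] with y hy
      rw [← wirtingerBar_mul _ (dU hrs hy) (dU (hVs k j) hy)]
      refine wirtingerBar_congr _ ?_
      filter_upwards [hU.mem_nhds hy] with x hx
      rw [hr, hV, inv_mul_cancel_left₀ (hν0 x hx)]
    have e2 (j) : ∑ k, wirtinger (wirtingerBar (fun y => (G y).det * (G y)⁻¹ k j) (b k)) (b j) z =
        ∑ k, wirtinger (fun y => wirtingerBar r (b k) y * V k j y) (b j) z := by
      -- The ∂̄-divergence vanishes identically near z, hence so does its further derivative.
      have e3 : ∑ k, wirtinger (fun y => r y * wirtingerBar (V k j) (b k) y) (b j) z = 0 := by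
        rw [← wirtinger_sum _ fun k _ => dU (hrs.mul (hVb k j)) hz,
          wirtinger_congr (g := fun _ => 0), wirtinger_const]
        filter_upwards [hz'] with y hy
        rw [← Finset.mul_sum, hbal' hy, mul_zero]
      rw [← add_zero (∑ k, wirtinger (fun y => wirtingerBar r (b k) y * V k j y) (b j) z), ← e3,
        ← Finset.sum_add_distrib]
      refine Finset.sum_congr rfl fun k _ => ?_
      rw [wirtinger_congr _ (e1 k j), wirtinger_add _ (dU ((hrb k).mul (hVs k j)) hz)
        (dU (hrs.mul (hVb k j)) hz)]
    simp only [e2]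
    have e4 (j k) : wirtinger (fun y => wirtingerBar r (b k) y * V k j y) (b j) z =
        wirtinger (wirtingerBar r (b k)) (b j) z * (ν z * (1 : Matrix (Fin n) (Fin n) ℂ) k j) +
        wirtingerBar r (b k) z * wirtinger (V k j) (b j) z := by
      rw [← hVz, ← wirtinger_mul _ (dU (hrb k) hz) (dU (hVs k j) hz)]
    simp only [e4, Finset.sum_add_distrib]
    rw [Finset.sum_comm (f := fun j k => wirtingerBar r (b k) z * wirtinger (V k j) (b j) z)]
    -- Here the ∂-divergence of V is used; only the term with two derivatives on ν⁻¹ is left.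
    have e5 (k) : ∑ j, wirtingerBar r (b k) z * wirtinger (V k j) (b j) z = 0 := by
      rw [← Finset.mul_sum, show ∑ j, wirtinger (V k j) (b j) z = 0 from hbal z hz k, mul_zero]
    simp only [e5, Finset.sum_const_zero, add_zero, Finset.mul_sum]
    refine Finset.sum_congr rfl fun j _ => ?_
    rw [Finset.sum_eq_single j]
    · rw [Matrix.one_apply_eq]; ring
    · intro k _ hk; rw [Matrix.one_apply_ne hk]; ring
    · simp
  simp only [wirtinger_wirtingerBar_det_mul_inv hU hG hdet hz h1] at hX
  simp only [wirtinger_wirtingerBar_det_mul_inv_sub hU hG hdet hz h1] at hast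
  set Cs := ∑ j, ∑ k, ((wirtingerMat₂ G (b j) (b k) z).trace *
    (1 : Matrix (Fin n) (Fin n) ℂ) k j - wirtingerMat₂ G (b j) (b k) z k j) with hCs
  set Q := ∑ j, ∑ k, (((A j).trace * (B k).trace - (A j * B k).trace) *
      (1 : Matrix (Fin n) (Fin n) ℂ) k j - (A j).trace * B k k j - (B k).trace * A j k j +
      (A j * B k) k j + (B k * A j) k j) with hQdef
  have hX' : Cs + Q = ν z * ∑ j, wirtinger (wirtingerBar r (b j)) (b j) z := by
    rw [← hX, hCs, hQdef]
    simp only [← Finset.sum_add_distrib]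
    refine Finset.sum_congr rfl fun j _ => Finset.sum_congr rfl fun k _ => ?_
    simp only [hA, hB]
    ring
  have hast' : ((n : ℂ) - 2) * Cs + ((n : ℂ) - 3) * Q = 0 := by
    rw [← hast, hCs, hQdef]
    simp only [Finset.mul_sum, ← Finset.sum_add_distrib]
    rfl
  simp only [hr2, Finset.sum_add_distrib, ← Finset.sum_div, Finset.sum_neg_distrib] at hX'
  have hsum : ∑ j, 2 * torsionTrace A j * star (torsionTrace A j) = 2 * tq := by
    rw [htq, Finset.mul_sum]
    exact Finset.sum_congr rfl fun j _ => by ring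
  rw [hsum] at hX'
  have h0 := hν0 z hz
  set L := ∑ j, wirtinger (wirtingerBar ν (b j)) (b j) z
  have hL : L = ν z * (2 * tq - Cs - Q) := by
    have e : ν z * (-L / ν z ^ 2 + 2 * tq / ν z) = -L / ν z + 2 * tq := by field_simp
    rw [e] at hX'
    field_simp at hX'
    linear_combination hX'
  -- With L = ν (2|τ|² - C - Q) and (n-2)(C + Q) = Q, the coefficient of |τ|² is 2(n-2) - 1 = 2n -
  -- 5.
  linear_combination ((n : ℂ) - 2) * hL - ν z * hast' - ν z * hQ

end Torsion

/-! ### The strong maximum principle -/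

section MaximumPrinciple

/-- The second derivative of `φ` at `x` in the direction `ξ`. -/
def secondDeriv {F : Type*} [AddCommGroup F] [Module ℝ F] (φ : F → ℝ) (ξ x : F) : ℝ :=
  deriv (deriv fun t : ℝ => φ (x + t • ξ)) 0

theorem ContDiffAt.eventually_differentiableAt_real {g : ℝ → ℝ} {t : ℝ} (hg : ContDiffAt ℝ 2 g t) :
    ∀ᶠ u in nhds t, DifferentiableAt ℝ g u := by
  filter_upwards [hg.eventually (by simp)] with u hu
  exact hu.differentiableAt (by simp)

theorem ContDiffAt.differentiableAt_deriv_real {g : ℝ → ℝ} {t : ℝ} (hg : ContDiffAt ℝ 2 g t) :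
    DifferentiableAt ℝ (deriv g) t := by
  have h := hg.fderiv_right (m := 1) (by norm_num [one_add_one_eq_two])
  exact (h.differentiableAt (by simp)).clm_apply (differentiableAt_const 1)

/-- A positive second derivative would make t a local minimum too, hence g locally constant with
vanishing second derivative. -/
theorem deriv_deriv_nonpos_of_isLocalMax {g : ℝ → ℝ} {t : ℝ} (hg : ContDiffAt ℝ 2 g t)
    (hm : IsLocalMax g t) : deriv (deriv g) t ≤ 0 := by
  by_contra! h
  have h1 := isLocalMin_of_deriv_deriv_pos h hm.deriv_eq_zero hg.continuousAt
  have h2 : g =ᶠ[nhds t] fun _ => g t := by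
    filter_upwards [hm, h1] with u hu hu' using le_antisymm hu hu'
  have h3 : deriv g =ᶠ[nhds t] fun _ => 0 := by
    filter_upwards [h2.eventuallyEq_nhds] with u hu
    rw [hu.deriv_eq, deriv_const]
  rw [h3.deriv_eq, deriv_const] at h
  exact lt_irrefl _ h

variable {F : Type*} [NormedAddCommGroup F] [InnerProductSpace ℝ F]

theorem contDiffAt_line {φ : F → ℝ} {x ξ : F} (hφ : ContDiffAt ℝ 2 φ x) :
    ContDiffAt ℝ 2 (fun t : ℝ => φ (x + t • ξ)) 0 := by
  have h : ContDiffAt ℝ 2 (fun t : ℝ => x + t • ξ) 0 := by fun_prop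
  exact ContDiffAt.comp (0 : ℝ) (by simpa using hφ) h

theorem secondDeriv_add_mul {φ v : F → ℝ} {x : F} (hφ : ContDiffAt ℝ 2 φ x)
    (hv : ContDiffAt ℝ 2 v x) (ε : ℝ) (ξ : F) :
    secondDeriv (fun y => φ y + ε * v y) ξ x = secondDeriv φ ξ x + ε * secondDeriv v ξ x := by
  have h1 := contDiffAt_line (ξ := ξ) hφ
  have h2 := contDiffAt_line (ξ := ξ) hv
  have e : deriv (fun t : ℝ => φ (x + t • ξ) + ε * v (x + t • ξ)) =ᶠ[nhds 0]
      fun t => deriv (fun t : ℝ => φ (x + t • ξ)) t + ε * deriv (fun t : ℝ => v (x + t • ξ)) t := by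
    filter_upwards [ContDiffAt.eventually_differentiableAt_real h1,
      ContDiffAt.eventually_differentiableAt_real h2] with t ht ht'
    rw [deriv_fun_add ht (ht'.const_mul _), deriv_const_mul _ ht']
  have h1' := ContDiffAt.differentiableAt_deriv_real h1
  have h2' := ContDiffAt.differentiableAt_deriv_real h2
  unfold secondDeriv
  rw [e.deriv_eq, deriv_fun_add h1' (h2'.const_mul _), deriv_const_mul _ h2']

/-- The barrier function of the strong maximum principle. -/
def barrier (y : F) (r N : ℝ) (x : F) : ℝ :=
  (r ^ 2 - ‖x - y‖ ^ 2) + N * (r ^ 2 - ‖x - y‖ ^ 2) ^ 2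

theorem secondDeriv_barrier (y : F) (r N : ℝ) (ξ x : F) :
    secondDeriv (barrier y r N) ξ x = 8 * N * inner ℝ (x - y) ξ ^ 2 -
      2 * (1 + 2 * N * (r ^ 2 - ‖x - y‖ ^ 2)) * ‖ξ‖ ^ 2 := by
  set a := r ^ 2 - ‖x - y‖ ^ 2
  set c := inner ℝ (x - y) ξ
  set q := ‖ξ‖ ^ 2 with hq
  have e (t : ℝ) : r ^ 2 - ‖x + t • ξ - y‖ ^ 2 = a - 2 * c * t - q * t ^ 2 := by
    rw [show x + t • ξ - y = (x - y) + t • ξ by abel, norm_add_sq_real, inner_smul_right, norm_smul,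
      mul_pow, Real.norm_eq_abs, sq_abs]
    ring
  have e1 : (fun t : ℝ => barrier y r N (x + t • ξ)) = fun t : ℝ =>
      (a - 2 * c * t - q * t ^ 2) + N * (a - 2 * c * t - q * t ^ 2) ^ 2 := by
    funext t
    rw [barrier, e]
  have d0 (t : ℝ) : HasDerivAt (fun t : ℝ => a - 2 * c * t - q * t ^ 2) (-2 * c - 2 * q * t) t := by
    have := (((hasDerivAt_id t).const_mul (2 * c)).const_sub a).sub
      (((hasDerivAt_id t).pow 2).const_mul q)
    convert! this using 1
    simp; ring
  have d1 (t : ℝ) : HasDerivAt (fun t : ℝ => (a - 2 * c * t - q * t ^ 2) +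
      N * (a - 2 * c * t - q * t ^ 2) ^ 2)
      ((-2 * c - 2 * q * t) * (1 + 2 * N * (a - 2 * c * t - q * t ^ 2))) t := by
    convert! (d0 t).add (((d0 t).pow 2).const_mul N) using 1
    simp; ring
  have d2 : HasDerivAt (fun t : ℝ => (-2 * c - 2 * q * t) *
      (1 + 2 * N * (a - 2 * c * t - q * t ^ 2)))
      (-2 * q * (1 + 2 * N * a) + (-2 * c) * (2 * N * (-2 * c))) 0 := by
    have h3 : HasDerivAt (fun t : ℝ => -2 * c - 2 * q * t) (-(2 * q)) 0 := by
      simpa using ((hasDerivAt_id (0 : ℝ)).const_mul (2 * q)).const_sub (-2 * c)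
    convert! h3.mul (((d0 0).const_mul (2 * N)).const_add 1) using 1
    simp
  unfold secondDeriv
  rw [e1, show deriv (fun t : ℝ => (a - 2 * c * t - q * t ^ 2) +
      N * (a - 2 * c * t - q * t ^ 2) ^ 2) = _ from funext fun t => (d1 t).deriv, d2.deriv]
  ring

theorem contDiff_barrier (y : F) (r N : ℝ) : ContDiff ℝ 2 (barrier y r N) := by
  have h : ContDiff ℝ 2 fun x : F => r ^ 2 - ‖x - y‖ ^ 2 :=
    contDiff_const.sub ((contDiff_id.sub contDiff_const).norm_sq ℝ)
  exact h.add (contDiff_const.mul (h.pow 2))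

/-- The strong maximum principle for subsolutions of an elliptic operator without lower order
terms, which is given by a family of frames. -/
theorem eq_of_isMaxOn_ball [FiniteDimensional ℝ F] {φ : F → ℝ} {p : F} {R : ℝ}
    (hφ : ContDiffOn ℝ 2 φ (Metric.ball p R)) (hmax : ∀ x ∈ Metric.ball p R, φ x ≤ φ p)
    {ι : Type*} [Fintype ι] (ξ : F → ι → F) {Λ l : ℝ} (hΛ0 : 0 ≤ Λ) (hl0 : 0 < l)
    (hΛ : ∀ x ∈ Metric.ball p R, ∑ i, ‖ξ x i‖ ^ 2 ≤ Λ)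
    (hl : ∀ x ∈ Metric.ball p R, ∀ η, l * ‖η‖ ^ 2 ≤ ∑ i, inner ℝ η (ξ x i) ^ 2)
    (hsub : ∀ x ∈ Metric.ball p R, 0 ≤ ∑ i, secondDeriv φ (ξ x i) x)
    {y : F} (hy : y ∈ Metric.ball p (R / 4)) : φ y = φ p := by
  have : ProperSpace F := FiniteDimensional.proper_real F
  have hyR : dist y p < R / 4 := hy
  have hR : 0 < R := by have := dist_nonneg (x := y) (y := p); linarith
  by_contra hne
  have hcont : ContinuousOn φ (Metric.ball p R) := hφ.continuousOn
  have hat {x : F} (hx : x ∈ Metric.ball p R) : ContDiffAt ℝ 2 φ x :=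
    hφ.contDiffAt (Metric.isOpen_ball.mem_nhds hx)
  have hsubset : Metric.closedBall p (R / 2) ⊆ Metric.ball p R :=
    Metric.closedBall_subset_ball (by linarith)
  -- a point of the maximum set closest to `y`
  set K := Metric.closedBall p (R / 2) ∩ φ ⁻¹' {φ p} with hK
  have hKc : IsCompact K := (isCompact_closedBall p (R / 2)).of_isClosed_subset
    ((hcont.mono hsubset).preimage_isClosed_of_isClosed Metric.isClosed_closedBall
      isClosed_singleton) Set.inter_subset_left
  have hpK : p ∈ K := ⟨Metric.mem_closedBall_self (by linarith), rfl⟩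
  obtain ⟨z, hzK, hzmin⟩ := hKc.exists_isMinOn ⟨p, hpK⟩
    (f := fun x => dist x y) (by fun_prop)
  set r := dist z y with hr
  have hrp : r ≤ dist p y := hzmin hpK
  have hr4 : r < R / 4 := by rw [dist_comm] at hyR; linarith
  have hr0 : 0 < r := by
    rw [hr, dist_pos]
    rintro rfl
    exact hne hzK.2
  have hlt {x : F} (hx : dist x y < r) : φ x < φ p := by
    -- The radius R/4 is chosen for this: x lies within r < R/4 of y, and y within R/4 of p.
    have hxp : x ∈ Metric.closedBall p (R / 2) := by
      rw [Metric.mem_closedBall]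
      have := dist_triangle x y p
      linarith
    refine lt_of_le_of_ne (hmax x (hsubset hxp)) fun h => ?_
    have : r ≤ dist x y := hzmin (show x ∈ K from ⟨hxp, h⟩)
    linarith
  -- the smaller ball
  set d : F := (1 / 2 : ℝ) • (z - y) with hd
  set c : F := y + d with hc
  set ρ := r / 2 with hρ
  have hρ0 : 0 < ρ := by positivity
  have hdn : ‖d‖ = ρ := by
    rw [hd, norm_smul, ← dist_eq_norm, ← hr, hρ]
    norm_num
    ring
  have hzc : z - c = d := by
    rw [hc, hd]
    module
  -- The ball with diameter yz is internally tangent at z to the ball around y, by the parallelogram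
  -- law. So z is its only point where the maximum can be attained.
  have hin {x : F} (hx : ‖x - c‖ ≤ ρ) (hxz : x ≠ z) : φ x < φ p := by
    refine hlt ?_
    have h1 : x - y = (x - c) + d := by rw [hc]; abel
    have h2 : 0 < ‖(x - c) - d‖ := by
      rw [norm_pos_iff, ← hzc]
      intro h
      apply hxz
      have : x - z = 0 := by rw [← h]; abel
      exact sub_eq_zero.mp this
    have h3 := norm_sub_sq_real (x - c) d
    have h4 := norm_add_sq_real (x - c) d
    rw [dist_eq_norm, h1]
    have h5 : ‖x - c‖ ^ 2 ≤ ρ ^ 2 := pow_le_pow_left₀ (norm_nonneg _) hx 2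
    have h6 : 0 < ‖(x - c) - d‖ ^ 2 := by positivity
    rw [hdn] at h3 h4
    have h7 : ‖x - c + d‖ ^ 2 < r ^ 2 := by
      have : r = 2 * ρ := by rw [hρ]; ring
      rw [this]
      nlinarith
    exact lt_of_pow_lt_pow_left₀ 2 hr0.le h7
  set s : F → ℝ := fun x => ρ ^ 2 - ‖x - c‖ ^ 2 with hs
  have hsc : Continuous s := by fun_prop
  have hsz : s z = 0 := by simp only [hs, hzc, hdn, sub_self]
  -- Near z one has ‖x - c‖ > ρ/2 and 1 + 2Ns < 2. The gradient term of the barrier is then at least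
  -- 2Nlρ² = 4Λ + 2, while the negative term is at most 4Λ.
  set N : ℝ := (2 * Λ + 1) / (l * ρ ^ 2) with hN
  have hN0 : 0 < N := by positivity
  have hNl : N * (l * ρ ^ 2) = 2 * Λ + 1 := by rw [hN]; field_simp
  set v := barrier c ρ N with hv
  have hvs (x : F) : v x = s x * (1 + N * s x) := by simp only [hv, barrier, hs]; ring
  have hzR : z ∈ Metric.ball p R := hsubset hzK.1
  -- a small ball around `z`
  have hev : ∀ᶠ x in nhds z, x ∈ Metric.ball p R ∧ |2 * N * s x| < 1 ∧ ρ / 2 < ‖x - c‖ := by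
    have e1 : ∀ᶠ x in nhds z, |2 * N * s x| < 1 := by
      have hcont' : ContinuousAt (fun x => |2 * N * s x|) z := by fun_prop
      refine hcont'.eventually (gt_mem_nhds ?_)
      simp [hsz]
    have e2 : ∀ᶠ x in nhds z, ρ / 2 < ‖x - c‖ := by
      have hcont' : ContinuousAt (fun x => ‖x - c‖) z := by fun_prop
      refine hcont'.eventually (lt_mem_nhds ?_)
      change ρ / 2 < ‖z - c‖
      rw [hzc, hdn]
      linarith
    filter_upwards [Metric.isOpen_ball.mem_nhds hzR, e1, e2] with x h1 h2 h3 using ⟨h1, h2, h3⟩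
  obtain ⟨κ, hκ0, hκ⟩ := Metric.nhds_basis_closedBall.mem_iff.mp hev
  have hpos {x : F} (hx : x ∈ Metric.closedBall z κ) : 0 < ∑ i, secondDeriv v (ξ x i) x := by
    obtain ⟨h1, h2, h3⟩ := hκ hx
    have h2' := abs_lt.mp h2
    simp only [hv, secondDeriv_barrier, Finset.sum_sub_distrib, ← Finset.mul_sum]
    have h4 := hl x h1 (x - c)
    have h5 := hΛ x h1
    have h6 : ρ ^ 2 / 4 ≤ ‖x - c‖ ^ 2 := by
      have := pow_le_pow_left₀ (by positivity) h3.le 2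
      linarith [this, show (ρ / 2) ^ 2 = ρ ^ 2 / 4 by ring]
    have h7 : N * (l * (ρ ^ 2 / 4)) ≤ N * ∑ i, inner ℝ (x - c) (ξ x i) ^ 2 :=
      mul_le_mul_of_nonneg_left ((mul_le_mul_of_nonneg_left h6 hl0.le).trans h4) hN0.le
    have h8 : (1 + 2 * N * s x) * ∑ i, ‖ξ x i‖ ^ 2 ≤ 2 * Λ := by
      refine mul_le_mul (by linarith) h5 (Finset.sum_nonneg fun i _ => by positivity) (by norm_num)
    have h9 : 2 * (1 + 2 * N * (ρ ^ 2 - ‖x - c‖ ^ 2)) * ∑ i, ‖ξ x i‖ ^ 2 ≤ 4 * Λ := by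
      have : 2 * (1 + 2 * N * (ρ ^ 2 - ‖x - c‖ ^ 2)) * ∑ i, ‖ξ x i‖ ^ 2 =
        2 * ((1 + 2 * N * s x) * ∑ i, ‖ξ x i‖ ^ 2) := by rw [hs]; ring
      linarith
    have h10 : N * (l * (ρ ^ 2 / 4)) = (2 * Λ + 1) / 4 := by rw [← hNl]; ring
    linarith
  -- the gap on the part of the sphere inside the ball
  have hgap : ∃ δ > 0, ∀ x ∈ Metric.sphere z κ, 0 ≤ s x → φ x ≤ φ p - δ := by
    have hSc : IsCompact (Metric.sphere z κ ∩ s ⁻¹' Set.Ici 0) :=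
      (isCompact_sphere z κ).inter_right (isClosed_Ici.preimage hsc)
    rcases (Metric.sphere z κ ∩ s ⁻¹' Set.Ici 0).eq_empty_or_nonempty with h | h
    · refine ⟨1, one_pos, fun x hx hsx => ?_⟩
      exact absurd (show x ∈ Metric.sphere z κ ∩ s ⁻¹' Set.Ici 0 from ⟨hx, hsx⟩) (by simp [h])
    · obtain ⟨x₀, hx₀, hx₀max⟩ := hSc.exists_isMaxOn h (f := φ)
        (hcont.mono fun x hx => (hκ (Metric.sphere_subset_closedBall hx.1)).1)
      refine ⟨φ p - φ x₀, sub_pos.mpr (hin ?_ ?_), fun x hx hsx => ?_⟩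
      · have : 0 ≤ ρ ^ 2 - ‖x₀ - c‖ ^ 2 := hx₀.2
        exact le_of_sq_le_sq (by linarith) hρ0.le
      · rintro rfl
        have := hx₀.1
        simp only [Metric.mem_sphere, dist_self] at this
        exact hκ0.ne this
      · have : φ x ≤ φ x₀ := hx₀max ⟨hx, hsx⟩
        linarith
  obtain ⟨δ, hδ0, hδ⟩ := hgap
  -- On the small sphere N v ≤ 1 where s ≥ 0, so the perturbation εv is at most δ/2 there, less than
  -- the gap δ; where s < 0 the barrier is negative.
  set ε := δ * N / 2 with hε
  have hε0 : 0 < ε := by positivity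
  have hbd {x : F} (hx : x ∈ Metric.sphere z κ) : φ x + ε * v x < φ p := by
    obtain ⟨h1, h2, h3⟩ := hκ (Metric.sphere_subset_closedBall hx)
    have h2' := abs_lt.mp h2
    have h4 : 0 < 1 + N * s x := by linarith
    rcases lt_or_ge (s x) 0 with h | h
    · have : v x < 0 := by rw [hvs]; exact mul_neg_of_neg_of_pos h h4
      have := mul_neg_of_pos_of_neg hε0 this
      linarith [hmax x h1]
    · have h5 := hδ x hx h
      have h6 : N * v x ≤ 1 := by
        have : N * v x = (N * s x) * (1 + N * s x) := by rw [hvs]; ring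
        rw [this]
        have : 0 ≤ N * s x := by positivity
        nlinarith
      have h7 : ε * v x = δ / 2 * (N * v x) := by rw [hε]; ring
      have h8 : δ / 2 * (N * v x) ≤ δ / 2 * 1 := mul_le_mul_of_nonneg_left h6 (by linarith)
      linarith
  obtain ⟨x₀, hx₀, hx₀max⟩ := (isCompact_closedBall z κ).exists_isMaxOn
    ⟨z, Metric.mem_closedBall_self hκ0.le⟩ (f := fun x => φ x + ε * v x)
    ((hcont.mono fun x hx => (hκ hx).1).add
      (continuous_const.mul (contDiff_barrier c ρ N).continuous).continuousOn)
  have hx₀z : φ p ≤ φ x₀ + ε * v x₀ := by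
    have h : φ z + ε * v z ≤ φ x₀ + ε * v x₀ := hx₀max (Metric.mem_closedBall_self hκ0.le)
    have h' : φ z = φ p := hzK.2
    rwa [hvs z, hsz, zero_mul, mul_zero, add_zero, h'] at h
  have hx₀b : x₀ ∈ Metric.ball z κ := by
    rcases (Metric.mem_closedBall.mp hx₀).lt_or_eq with h | h
    · exact h
    · exact absurd (hbd (x := x₀) h) (not_lt.mpr hx₀z)
  have hloc : IsLocalMax (fun x => φ x + ε * v x) x₀ := by
    filter_upwards [Metric.isOpen_ball.mem_nhds hx₀b] with x hx
    exact hx₀max (Metric.ball_subset_closedBall hx)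
  have hx₀R := (hκ hx₀).1
  have hvc : ContDiffAt ℝ 2 v x₀ := (contDiff_barrier c ρ N).contDiffAt
  -- Only the frame at the single point x₀ is used, so no continuity of the frame field is required.
  have hneg (i : ι) : secondDeriv φ (ξ x₀ i) x₀ + ε * secondDeriv v (ξ x₀ i) x₀ ≤ 0 := by
    rw [← secondDeriv_add_mul (hat hx₀R) hvc]
    refine deriv_deriv_nonpos_of_isLocalMax
      (contDiffAt_line ((hat hx₀R).add (contDiffAt_const.mul hvc))) ?_
    have hline : Filter.Tendsto (fun t : ℝ => x₀ + t • ξ x₀ i) (nhds 0) (nhds x₀) := by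
      have : Continuous fun t : ℝ => x₀ + t • ξ x₀ i := by fun_prop
      simpa using this.tendsto 0
    have := hline.eventually hloc
    simpa [IsLocalMax, IsMaxFilter] using this
  have hsum := Finset.sum_nonpos fun i (_ : i ∈ Finset.univ) => hneg i
  rw [Finset.sum_add_distrib, ← Finset.mul_sum] at hsum
  have h1 := hsub x₀ hx₀R
  have h2 := mul_pos hε0 (hpos hx₀)
  linarith

end MaximumPrinciple

/-! ### Unitary bases for a Hermitian form -/

section UnitaryBasis

variable {E : Type*} [AddCommGroup E] [Module ℂ E]

theorem exists_unitary_basis [FiniteDimensional ℂ E] {n : ℕ} (hn : Module.finrank ℂ E = n)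
    (H : E →ₗ[ℂ] E →ₗ⋆[ℂ] ℂ) (hsymm : ∀ v w, star (H w v) = H v w)
    (hpos : ∀ v, v ≠ 0 → 0 < (H v v).re) :
    ∃ b : Module.Basis (Fin n) ℂ E, ∀ i j, H (b i) (b j) = if i = j then 1 else 0 := by
  -- The slots are exchanged because an inner product is conjugate linear in its first argument,
  -- while H is so in its second.
  let core : InnerProductSpace.Core ℂ E :=
    { inner := fun v w => H w v
      conj_inner_symm := fun v w => hsymm w v
      re_inner_nonneg := fun v => by
        by_cases hv : v = 0
        · simp [hv]
        · exact (hpos v hv).le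
      add_left := fun u v w => by simp
      smul_left := fun u v c => by simp
      definite := fun v hv => by
        by_contra h
        have := hpos v h
        rw [hv] at this
        simp at this }
  let : NormedAddCommGroup E := core.toNormedAddCommGroup
  let : InnerProductSpace ℂ E := InnerProductSpace.ofCore core.toCore
  refine ⟨((stdOrthonormalBasis ℂ E).reindex (finCongr hn)).toBasis, fun i j => ?_⟩
  have h := orthonormal_iff_ite.mp ((stdOrthonormalBasis ℂ E).reindex (finCongr hn)).orthonormal j i
  rw [OrthonormalBasis.coe_toBasis]
  change H _ _ = _ at h
  rw [h]
  simp only [eq_comm]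

end UnitaryBasis

/-! ### The complex Laplacian through real second derivatives -/

section Laplacian

variable {E : Type*} [NormedAddCommGroup E] [NormedSpace ℂ E]

theorem secondDeriv_eq_fderiv {φ : E → ℝ} {z : E} (hφ : ContDiffAt ℝ 2 φ z) (v : E) :
    secondDeriv φ v z = fderiv ℝ (fun y => fderiv ℝ φ y v) z v := by
  have hd : ∀ᶠ y in nhds z, DifferentiableAt ℝ φ y := by
    filter_upwards [hφ.eventually (by simp)] with y hy using hy.differentiableAt (by simp)
  have hline (t : ℝ) : HasDerivAt (fun t : ℝ => z + t • v) v t := by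
    simpa using ((hasDerivAt_id t).smul_const v).const_add z
  have hcont : Filter.Tendsto (fun t : ℝ => z + t • v) (nhds 0) (nhds z) := by
    have : Continuous fun t : ℝ => z + t • v := by fun_prop
    simpa using this.tendsto 0
  have h1 : deriv (fun t : ℝ => φ (z + t • v)) =ᶠ[nhds 0]
      fun t => fderiv ℝ φ (z + t • v) v := by
    filter_upwards [hcont.eventually hd] with t ht
    exact (ht.hasFDerivAt.comp_hasDerivAt t (hline t)).deriv
  have h2 : DifferentiableAt ℝ (fun y => fderiv ℝ φ y v) z :=
    ((hφ.fderiv_right (m := 1) (by norm_num)).differentiableAt (by simp)).clm_apply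
      (differentiableAt_const v)
  rw [secondDeriv, h1.deriv_eq]
  have h3 : HasFDerivAt (fun y => fderiv ℝ φ y v) (fderiv ℝ (fun y => fderiv ℝ φ y v) z)
      (z + (0 : ℝ) • v) := by
    simpa using h2.hasFDerivAt
  exact (h3.comp_hasDerivAt (0 : ℝ) (hline 0)).deriv

/-- Expand ∂ᵥ∂̄ᵥ = ¼ (Dᵥ - i Dᵢᵥ)(Dᵥ + i Dᵢᵥ). For real φ the mixed terms are purely imaginary, so
symmetry of second derivatives is not needed. -/
theorem re_wirtinger_wirtingerBar {φ : E → ℝ} {z : E} (hφ : ContDiffAt ℝ 2 φ z) (v : E) :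
    4 * (wirtinger (wirtingerBar (fun y => (φ y : ℂ)) v) v z).re =
      secondDeriv φ v z + secondDeriv φ (Complex.I • v) z := by
  have hd : ∀ᶠ y in nhds z, DifferentiableAt ℝ φ y := by
    filter_upwards [hφ.eventually (by simp)] with y hy using hy.differentiableAt (by simp)
  have hof {f : E → ℝ} {y : E} (hf : DifferentiableAt ℝ f y) (w : E) :
      fderiv ℝ (fun y => (f y : ℂ)) y w = (fderiv ℝ f y w : ℂ) := by
    have := (Complex.ofRealCLM.hasFDerivAt (x := f y)).comp y hf.hasFDerivAt
    rw [show (fun y => (f y : ℂ)) = Complex.ofRealCLM ∘ f from rfl, this.fderiv]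
    rfl
  have hD (w : E) : DifferentiableAt ℝ (fun y => fderiv ℝ φ y w) z :=
    ((hφ.fderiv_right (m := 1) (by norm_num)).differentiableAt (by simp)).clm_apply
      (differentiableAt_const w)
  have hDc (w : E) : DifferentiableAt ℝ (fun y => (fderiv ℝ φ y w : ℂ)) z :=
    Complex.ofRealCLM.differentiableAt.comp z (hD w)
  have h1 : wirtingerBar (fun y => (φ y : ℂ)) v =ᶠ[nhds z] fun y =>
      (1 / 2 : ℂ) * ((fderiv ℝ φ y v : ℂ) + Complex.I * (fderiv ℝ φ y (Complex.I • v) : ℂ)) := by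
    filter_upwards [hd] with y hy
    rw [wirtingerBar_eq, hof hy, hof hy]
  rw [wirtinger_congr v h1, wirtinger_const_mul, wirtinger_add, wirtinger_const_mul,
    wirtinger_eq, wirtinger_eq, hof (hD _), hof (hD _), hof (hD _), hof (hD _),
    secondDeriv_eq_fderiv hφ, secondDeriv_eq_fderiv hφ]
  · simp
    ring
  · exact hDc _
  · exact hDc _
  · exact (hDc _).const_mul _
  · exact (hDc _).add ((hDc _).const_mul _)

end Laplacian

/-! ### The maximum principle for a Hermitian metric in a chart -/

section LocalMaximum

variable {E : Type*} [NormedAddCommGroup E] [NormedSpace ℂ E]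

theorem sesquilinear_sum {n : ℕ} (H : E →ₗ[ℂ] E →ₗ⋆[ℂ] ℂ) (b : Module.Basis (Fin n) ℂ E) (v w : E) :
    H v w = ∑ j, ∑ k, b.repr v j * star (b.repr w k) * H (b j) (b k) := by
  conv_lhs => rw [← b.sum_repr v, ← b.sum_repr w]
  rw [map_sum, Finset.sum_comm]
  refine Finset.sum_congr rfl fun k _ => ?_
  rw [map_sum, LinearMap.sum_apply]
  refine Finset.sum_congr rfl fun j _ => ?_
  simp only [map_smul, map_smulₛₗ, LinearMap.smul_apply, smul_eq_mul, starRingEnd_apply]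
  ring

/-- H(v, v) has a positive minimum and a maximum on the compact set K × unit sphere; homogeneity
extends the bounds to all v. This supplies the ellipticity constants. -/
theorem exists_bounds_of_isCompact [FiniteDimensional ℂ E]
    (H : E → E →ₗ[ℂ] E →ₗ⋆[ℂ] ℂ) {K : Set E} (hK : IsCompact K)
    (hcont : ∀ v w, ContinuousOn (fun y => H y v w) K)
    (hpos : ∀ y ∈ K, ∀ v, v ≠ 0 → 0 < (H y v v).re) :
    ∃ c C : ℝ, 0 < c ∧ 0 < C ∧ ∀ y ∈ K, ∀ v, c * ‖v‖ ^ 2 ≤ (H y v v).re ∧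
      (H y v v).re ≤ C * ‖v‖ ^ 2 := by
  have : FiniteDimensional ℝ E := FiniteDimensional.complexToReal E
  have : ProperSpace E := FiniteDimensional.proper_real E
  let b := Module.finBasis ℂ E
  have hS : IsCompact (K ×ˢ Metric.sphere (0 : E) 1) := hK.prod (isCompact_sphere 0 1)
  have hrepr (j) : Continuous fun v : E => b.repr v j :=
    (b.coord j).continuous_of_finiteDimensional
  have hc : ContinuousOn (fun q : E × E => (H q.1 q.2 q.2).re) (K ×ˢ Metric.sphere (0 : E) 1) := by
    refine Complex.continuous_re.comp_continuousOn ?_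
    have : (fun q : E × E => H q.1 q.2 q.2) = fun q => ∑ j, ∑ k, b.repr q.2 j *
        star (b.repr q.2 k) * H q.1 (b j) (b k) := by
      funext q
      exact sesquilinear_sum _ b _ _
    rw [this]
    refine continuousOn_finsetSum _ fun j _ => continuousOn_finsetSum _ fun k _ => ?_
    refine ContinuousOn.mul ?_ ((hcont (b j) (b k)).comp continuousOn_fst fun q hq => hq.1)
    exact (((hrepr j).comp continuous_snd).mul
      ((hrepr k).comp continuous_snd).star).continuousOn
  have hscale (y v : E) (hv : v ≠ 0) :
      (H y v v).re = ‖v‖ ^ 2 * (H y ((‖v‖⁻¹ : ℂ) • v) ((‖v‖⁻¹ : ℂ) • v)).re := by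
    have hv' : (‖v‖ : ℂ) ≠ 0 := by exact_mod_cast norm_ne_zero_iff.mpr hv
    have : H y v v = ((‖v‖ ^ 2 : ℝ) : ℂ) * H y ((‖v‖⁻¹ : ℂ) • v) ((‖v‖⁻¹ : ℂ) • v) := by
      simp
      field_simp
    conv_lhs => rw [this]
    rw [Complex.re_ofReal_mul]
  have hunit (v : E) (hv : v ≠ 0) : ((‖v‖⁻¹ : ℂ) • v) ∈ Metric.sphere (0 : E) 1 := by
    simp [norm_smul, norm_ne_zero_iff.mpr hv]
  rcases (K ×ˢ Metric.sphere (0 : E) 1).eq_empty_or_nonempty with he | hne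
  · refine ⟨1, 1, one_pos, one_pos, fun y hy v => ?_⟩
    by_cases hv : v = 0
    · simp [hv]
    · exact absurd (show (y, _) ∈ K ×ˢ Metric.sphere (0 : E) 1 from ⟨hy, hunit v hv⟩) (by simp [he])
  obtain ⟨q, hq, hqmin⟩ := hS.exists_isMinOn hne hc
  obtain ⟨q', hq', hqmax⟩ := hS.exists_isMaxOn hne hc
  have hne0 {q : E × E} (hq : q ∈ K ×ˢ Metric.sphere (0 : E) 1) : q.2 ≠ 0 := by
    rintro h
    have := hq.2
    simp [h] at this
  refine ⟨_, _, hpos _ hq.1 _ (hne0 hq), hpos _ hq'.1 _ (hne0 hq'), fun y hy v => ?_⟩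
  by_cases hv : v = 0
  · simp [hv]
  have hm : (y, (‖v‖⁻¹ : ℂ) • v) ∈ K ×ˢ Metric.sphere (0 : E) 1 := ⟨hy, hunit v hv⟩
  have h1 : (H q.1 q.2 q.2).re ≤ _ := hqmin hm
  have h2 : _ ≤ (H q'.1 q'.2 q'.2).re := hqmax hm
  rw [hscale y v hv]
  have h3 : 0 ≤ ‖v‖ ^ 2 := by positivity
  exact ⟨by rw [mul_comm]; exact mul_le_mul_of_nonneg_left h1 h3,
    by rw [mul_comm _ (‖v‖ ^ 2)]; exact mul_le_mul_of_nonneg_left h2 h3⟩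

/-- A unitary basis βⱼ at each point gives the real frame βⱼ, iβⱼ, in which the Laplacian is a sum
of pure second derivatives. A linear isomorphism to Euclidean space, where the norm comes from an
inner product, reduces the claim to `eq_of_isMaxOn_ball`. -/
theorem eventually_eq_of_isMaxOn [FiniteDimensional ℂ E] {n : ℕ} (hn : Module.finrank ℂ E = n)
    {φ : E → ℝ} {U : Set E} (hU : IsOpen U) (hφ : ContDiffOn ℝ 2 φ U)
    (H : E → E →ₗ[ℂ] E →ₗ⋆[ℂ] ℂ) (hcont : ∀ v w, ContinuousOn (fun y => H y v w) U)
    (hsymm : ∀ y ∈ U, ∀ v w, star (H y w v) = H y v w)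
    (hpos : ∀ y ∈ U, ∀ v, v ≠ 0 → 0 < (H y v v).re)
    (hsub : ∀ y ∈ U, ∀ b : Module.Basis (Fin n) ℂ E,
      (∀ i j, H y (b i) (b j) = if i = j then 1 else 0) →
      0 ≤ (∑ j, wirtinger (wirtingerBar (fun y => (φ y : ℂ)) (b j)) (b j) y).re)
    {p : E} (hp : p ∈ U) (hmax : ∀ y ∈ U, φ y ≤ φ p) : ∀ᶠ y in nhds p, φ y = φ p := by
  have : FiniteDimensional ℝ E := FiniteDimensional.complexToReal E
  set e : E ≃L[ℝ] EuclideanSpace ℝ (Fin (Module.finrank ℝ E)) := toEuclidean with he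
  have hV : IsOpen (e.symm ⁻¹' U) := hU.preimage e.symm.continuous
  obtain ⟨R, hR, hRU⟩ := Metric.nhds_basis_closedBall.mem_iff.mp
    (hV.mem_nhds (show e p ∈ e.symm ⁻¹' U by simpa using hp))
  set K : Set E := e.symm '' Metric.closedBall (e p) R with hKdef
  have hK : IsCompact K := (isCompact_closedBall _ _).image e.symm.continuous
  have hKU : K ⊆ U := by
    rintro _ ⟨x, hx, rfl⟩
    exact hRU hx
  obtain ⟨c, C, hc0, hC0, hcC⟩ := exists_bounds_of_isCompact H hK
    (fun v w => (hcont v w).mono hKU) fun y hy => hpos y (hKU hy)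
  have : Nonempty (Module.Basis (Fin n) ℂ E) := ⟨(Module.finBasis ℂ E).reindex (finCongr hn)⟩
  -- The bases are chosen independently at each point; the maximum principle tolerates a
  -- discontinuous frame.
  choose! β hβ using fun y (hy : y ∈ U) => exists_unitary_basis hn (H y) (hsymm y hy) (hpos y hy)
  set ξ : E → Fin n × Bool → E := fun y i => bif i.2 then Complex.I • β y i.1 else β y i.1 with hξ
  have hHξ {y : E} (hy : y ∈ U) (i) : H y (ξ y i) (ξ y i) = 1 := by
    rcases i with ⟨j, _ | _⟩
    · simp [hξ, hβ y hy]
    · simp [hξ, hβ y hy]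
  have hexp (y u : E) : u = ∑ j, (((β y).repr u j).re • β y j +
      ((β y).repr u j).im • (Complex.I • β y j)) := by
    conv_lhs => rw [← (β y).sum_repr u]
    refine Finset.sum_congr rfl fun j _ => ?_
    rw [← Complex.coe_smul, ← Complex.coe_smul, smul_smul, ← add_smul, Complex.re_add_im]
  have hHu {y : E} (hy : y ∈ U) (u : E) :
      (H y u u).re = ∑ j, (((β y).repr u j).re ^ 2 + ((β y).repr u j).im ^ 2) := by
    rw [sesquilinear_sum _ (β y)]
    simp [hβ y hy]
    refine Finset.sum_congr rfl fun j _ => by ring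
  have hball {x} (hx : x ∈ Metric.ball (e p) R) : e.symm x ∈ K :=
    ⟨x, Metric.ball_subset_closedBall hx, rfl⟩
  have hfr : ∀ x ∈ Metric.ball (e p) R, ∑ i, ‖e (ξ (e.symm x) i)‖ ^ 2 ≤
      ∑ _i : Fin n × Bool, ‖(e : E →L[ℝ] EuclideanSpace ℝ (Fin (Module.finrank ℝ E)))‖ ^ 2 * c⁻¹ := by
    intro x hx
    refine Finset.sum_le_sum fun i _ => ?_
    have h1 := (hcC _ (hball hx) (ξ (e.symm x) i)).1
    rw [hHξ (hKU (hball hx)), Complex.one_re] at h1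
    have h2 : ‖ξ (e.symm x) i‖ ^ 2 ≤ c⁻¹ := by
      rw [← one_div, le_div_iff₀ hc0]
      linarith
    calc ‖e (ξ (e.symm x) i)‖ ^ 2 ≤ (‖(e : E →L[ℝ] EuclideanSpace ℝ (Fin (Module.finrank ℝ E)))‖ * ‖ξ (e.symm x) i‖) ^ 2 :=
          pow_le_pow_left₀ (norm_nonneg _) ((e : E →L[ℝ] EuclideanSpace ℝ (Fin (Module.finrank ℝ E))).le_opNorm _) 2
      _ = ‖(e : E →L[ℝ] EuclideanSpace ℝ (Fin (Module.finrank ℝ E)))‖ ^ 2 * ‖ξ (e.symm x) i‖ ^ 2 := by ring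
      _ ≤ _ := mul_le_mul_of_nonneg_left h2 (by positivity)
  -- Expand η in the frame with coefficients a. Cauchy–Schwarz gives ‖η‖⁴ ≤ |a|² times the
  -- right-hand side, and |a|² = H(u, u) is at most D‖η‖². The added 1 keeps the constant positive
  -- even when D = 0.
  have hel : ∀ x ∈ Metric.ball (e p) R, ∀ η,
      (C * ‖(e.symm : EuclideanSpace ℝ (Fin (Module.finrank ℝ E)) →L[ℝ] E)‖ ^ 2 + 1)⁻¹ * ‖η‖ ^ 2 ≤
        ∑ i, inner ℝ η (e (ξ (e.symm x) i)) ^ 2 := by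
    intro x hx η
    set y := e.symm x with hy
    have hyU : y ∈ U := hKU (hball hx)
    set u := e.symm η with hu
    set a : Fin n × Bool → ℝ := fun i => bif i.2 then ((β y).repr u i.1).im else
      ((β y).repr u i.1).re with ha
    have h1 : η = ∑ i, a i • e (ξ y i) := by
      have : u = ∑ i, a i • ξ y i := by
        rw [Fintype.sum_prod_type]
        conv_lhs => rw [hexp y u]
        refine Finset.sum_congr rfl fun j _ => ?_
        simp [ha, hξ, add_comm]
      have h := congrArg e this
      simpa [hu, map_sum] using h
    have h2 : ‖η‖ ^ 2 = ∑ i, a i * inner ℝ η (e (ξ y i)) := by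
      rw [← real_inner_self_eq_norm_sq]
      conv_lhs => rw [h1, inner_sum]
      rw [← h1]
      simp [inner_smul_right]
    have h3 : ∑ i, a i ^ 2 = (H y u u).re := by
      rw [hHu hyU, Fintype.sum_prod_type]
      refine Finset.sum_congr rfl fun j _ => ?_
      simp [ha, add_comm]
    have h4 : (H y u u).re ≤ C * ‖(e.symm : EuclideanSpace ℝ (Fin (Module.finrank ℝ E)) →L[ℝ] E)‖ ^ 2 * ‖η‖ ^ 2 := by
      refine (hcC y (hball hx) u).2.trans ?_
      rw [mul_assoc, ← mul_pow]
      exact mul_le_mul_of_nonneg_left (pow_le_pow_left₀ (norm_nonneg _)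
        ((e.symm : EuclideanSpace ℝ (Fin (Module.finrank ℝ E)) →L[ℝ] E).le_opNorm η) 2) hC0.le
    have h5 := Finset.sum_mul_sq_le_sq_mul_sq Finset.univ a fun i => inner ℝ η (e (ξ y i))
    rw [← h2, h3] at h5
    set S := ∑ i, inner ℝ η (e (ξ y i)) ^ 2 with hS
    have hS0 : 0 ≤ S := Finset.sum_nonneg fun i _ => sq_nonneg _
    rw [inv_mul_le_iff₀ (by positivity)]
    set D := C * ‖(e.symm : EuclideanSpace ℝ (Fin (Module.finrank ℝ E)) →L[ℝ] E)‖ ^ 2 with hD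
    have hD0 : 0 ≤ D := by positivity
    rcases (sq_nonneg ‖η‖).eq_or_lt with h0 | h0
    · rw [← h0]; positivity
    · have h6 : ‖η‖ ^ 2 * ‖η‖ ^ 2 ≤ ‖η‖ ^ 2 * (D * S) := by
        have := mul_le_mul_of_nonneg_right h4 hS0
        nlinarith
      have := le_of_mul_le_mul_left h6 h0
      linarith
  have hsb : ∀ x ∈ Metric.ball (e p) R, 0 ≤
      ∑ i, secondDeriv (fun x => φ (e.symm x)) (e (ξ (e.symm x) i)) x := by
    intro x hx
    have hyU : e.symm x ∈ U := hKU (hball hx)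
    have h1 := hsub _ hyU _ (hβ _ hyU)
    have hat : ContDiffAt ℝ 2 φ (e.symm x) := hφ.contDiffAt (hU.mem_nhds hyU)
    have h2 (i) : secondDeriv (fun x => φ (e.symm x)) (e (ξ (e.symm x) i)) x =
        secondDeriv φ (ξ (e.symm x) i) (e.symm x) := by
      simp [secondDeriv]
    simp only [h2]
    rw [Fintype.sum_prod_type]
    have h3 (j) : ∑ i : Bool, secondDeriv φ (ξ (e.symm x) (j, i)) (e.symm x) =
        4 * (wirtinger (wirtingerBar (fun y => (φ y : ℂ)) (β (e.symm x) j)) (β (e.symm x) j)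
          (e.symm x)).re := by
      rw [re_wirtinger_wirtingerBar hat]
      simp [hξ, add_comm]
    simp only [h3]
    rw [← Finset.mul_sum, ← Complex.re_sum]
    positivity
  have key := fun y => eq_of_isMaxOn_ball (φ := fun x => φ (e.symm x)) (p := e p) (R := R)
    (ξ := fun x i => e (ξ (e.symm x) i)) (ι := Fin n × Bool)
    (Λ := ∑ _i : Fin n × Bool, ‖(e : E →L[ℝ] EuclideanSpace ℝ (Fin (Module.finrank ℝ E)))‖ ^ 2 * c⁻¹)
    (l := (C * ‖(e.symm : EuclideanSpace ℝ (Fin (Module.finrank ℝ E)) →L[ℝ] E)‖ ^ 2 + 1)⁻¹)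
    (y := y) (hφ.comp e.symm.contDiff.contDiffOn fun x hx => hKU (hball hx))
    (fun x hx => by simpa using hmax _ (hKU (hball hx)))
    (by positivity) (by positivity) hfr hel hsb
  have hev : ∀ᶠ y in nhds p, e y ∈ Metric.ball (e p) (R / 4) :=
    e.continuous.continuousAt.eventually (Metric.ball_mem_nhds _ (by positivity))
  filter_upwards [hev] with y hy
  simpa using key _ hy

end LocalMaximum

/-! ### The norm of the holomorphic volume form -/

section TopForms

variable {E : Type*} [NormedAddCommGroup E] [NormedSpace ℂ E] {n : ℕ}

/-- The frame is a real basis and top degree forms span a line, so one value determines the form. -/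
theorem ext_realFrame (b : Module.Basis (Fin n) ℂ E) {α β : E [⋀^Fin (2 * n)]→L[ℝ] ℂ}
    (h : α (realFrame b) = β (realFrame b)) : α = β := by
  let ε : Fin 2 × Fin n ≃ Fin (2 * n) :=
    ((finTwoEquiv.prodCongr (Equiv.refl _)).trans (Equiv.boolProdEquivSum _)).trans (interleave n)
  let B : Module.Basis (Fin (2 * n)) ℝ E := (Complex.basisOneI.smulTower b).reindex ε
  have hB : ⇑B = realFrame b := by
    funext r
    obtain ⟨i, rfl⟩ := ε.surjective r
    rw [Module.Basis.reindex_apply, Equiv.symm_apply_apply, Module.Basis.smulTower_apply]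
    rcases i with ⟨i, j⟩
    fin_cases i
    · change _ = realFrame b (evenIdx j)
      simp
    · change _ = realFrame b (oddIdx j)
      simp
  apply ContinuousAlternatingMap.toAlternatingMap_injective
  refine Module.Basis.ext_alternating B fun v hv => ?_
  let σ : Equiv.Perm (Fin (2 * n)) := Equiv.ofBijective v (Finite.injective_iff_bijective.1 hv)
  change α.toAlternatingMap (B ∘ σ) = β.toAlternatingMap (B ∘ σ)
  rw [AlternatingMap.map_perm, AlternatingMap.map_perm, hB]
  exact congrArg _ h

theorem topQuotient_eq {V : Type*} [AddCommGroup V] [Module ℝ V] [TopologicalSpace V] {k : ℕ}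
    {α β : V [⋀^Fin k]→L[ℝ] ℂ} {c : ℂ} (h : α = c • β) {v : Fin k → V} (hv : β v ≠ 0) :
    topQuotient α β = c := by
  have h1 : α = topQuotient α β • β := Classical.epsilon_spec (p := fun c : ℂ => α = c • β) ⟨c, h⟩
  have h2 : topQuotient α β * β v = c * β v := by
    have := congrArg (fun γ : V [⋀^Fin k]→L[ℝ] ℂ => γ v) (h1.symm.trans h)
    simpa using this
  exact mul_right_cancel₀ hv h2

/-- The permutation sorting the interleaved indices. -/
def unshuffle (n : ℕ) : Equiv.Perm (Fin n ⊕ Fin n) :=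
  (finSumFinEquiv.trans (finCongr (two_mul n).symm)).trans (interleave n).symm

theorem interleave_unshuffle (n : ℕ) (j : Fin n ⊕ Fin n) :
    interleave n (unshuffle n j) = Fin.cast (two_mul n).symm (finSumFinEquiv j) := by
  simp [unshuffle]

/-- Count inversions: sorting puts even positions before odd ones, so the inverted pairs are (2x+1,
2y) with x < y. Each y contributes y of them. -/
theorem sign_unshuffle (n : ℕ) :
    Equiv.Perm.sign (unshuffle n) = (-1) ^ ∑ i ∈ Finset.range n, i := by
  set σ := (interleave n).permCongr (unshuffle n) with hσ
  let g (i j : Fin (2 * n)) : ℤˣ := if i < j then if σ i < σ j then 1 else -1 else 1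
  rw [← Equiv.Perm.sign_permCongr (interleave n), ← hσ, Equiv.Perm.sign_eq_prod_prod_Iio]
  have h (j : Fin (2 * n)) : ∏ i ∈ Finset.Iio j, (if σ i < σ j then (1 : ℤˣ) else -1) =
      ∏ i, g (interleave n i) j := by
    rw [(interleave n).prod_comp fun i => g i j, ← Finset.prod_filter]
    congr 1
    ext
    simp
  have hl (x : Fin n) : (evenIdx x : ℕ) = 2 * x := rfl
  have hr (x : Fin n) : (oddIdx x : ℕ) = 2 * x + 1 := rfl
  have hσl (x : Fin n) : (σ (evenIdx x) : ℕ) = x := by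
    rw [hσ, ← interleave_inl, Equiv.permCongr_apply, Equiv.symm_apply_apply, interleave_unshuffle]
    simp
  have hσr (x : Fin n) : (σ (oddIdx x) : ℕ) = n + x := by
    rw [hσ, ← interleave_inr, Equiv.permCongr_apply, Equiv.symm_apply_apply, interleave_unshuffle]
    simp [add_comm]
  have e1 (x y : Fin n) : g (evenIdx x) (evenIdx y) = 1 := by
    unfold g
    split_ifs with h1 h2 <;> first
      | rfl | (rw [Fin.lt_def, hl, hl] at h1; rw [Fin.lt_def, hσl, hσl] at h2; omega)
  have e2 (x y : Fin n) : g (oddIdx x) (evenIdx y) = if x < y then -1 else 1 := by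
    unfold g
    have := y.2
    split_ifs with h1 h2 h3 h3 h3 <;> first
      | rfl
      | (rw [Fin.lt_def, hr, hl] at h1; rw [Fin.lt_def, hσr, hσl] at h2; omega)
      | (rw [Fin.lt_def, hr, hl] at h1; rw [Fin.lt_def] at h3; omega)
  have e3 (x y : Fin n) : g (evenIdx x) (oddIdx y) = 1 := by
    unfold g
    split_ifs with h1 h2 <;> first
      | rfl | (rw [Fin.lt_def, hl, hr] at h1; rw [Fin.lt_def, hσl, hσr] at h2; omega)
  have e4 (x y : Fin n) : g (oddIdx x) (oddIdx y) = 1 := by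
    unfold g
    split_ifs with h1 h2 <;> first
      | rfl | (rw [Fin.lt_def, hr, hr] at h1; rw [Fin.lt_def, hσr, hσr] at h2; omega)
  simp only [h]
  rw [← (interleave n).prod_comp]
  simp only [Fintype.prod_sum_type, interleave_inl, interleave_inr, e1, e2, e3, e4,
    Finset.prod_const_one, one_mul, mul_one]
  have e5 (y : Fin n) : ∏ x : Fin n, (if x < y then (-1 : ℤˣ) else 1) = (-1) ^ (y : ℕ) := by
    rw [← Finset.prod_filter, Finset.prod_const]
    congr 1
    rw [Finset.filter_gt_eq_Iio, Fin.card_Iio]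
  simp only [e5]
  rw [Finset.prod_pow_eq_pow_sum, Finset.sum_range]

/-- Here n² = 2·(n(n-1)/2) + n, so i^(n²) contributes the sorting sign a second time and the factor
iⁿ. This is why the normalisation i^(n²) makes ‖Ω‖² positive. -/
theorem I_pow_sq_mul_sign (n : ℕ) : Complex.I ^ (n ^ 2) *
    (((Equiv.Perm.sign (unshuffle n) : ℤ) : ℂ) * (-2 * Complex.I) ^ n) = 2 ^ n := by
  have h1 : n ^ 2 = 2 * (∑ i ∈ Finset.range n, i) + n := by
    rw [mul_comm, Finset.sum_range_id_mul_two]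
    cases n with
    | zero => rfl
    | succ m => rw [Nat.add_sub_cancel]; ring
  rw [h1, sign_unshuffle, pow_add, pow_mul, Complex.I_sq]
  push_cast
  have h2 : ((-1 : ℂ) ^ ∑ i ∈ Finset.range n, i) * (-1) ^ ∑ i ∈ Finset.range n, i = 1 := by
    rw [← mul_pow]; norm_num
  have h3 : Complex.I ^ n * (-2 * Complex.I) ^ n = 2 ^ n := by
    rw [← mul_pow]
    congr 1
    linear_combination (-2) * Complex.I_mul_I
  linear_combination (Complex.I ^ n * (-2 * Complex.I) ^ n) * h2 + h3

theorem map_eq_altSum (b : Module.Basis (Fin n) ℂ E) (Φ : E [⋀^Fin n]→L[ℂ] ℂ) (v : Fin n → E) :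
    Φ v = Φ b * altSum (fun u => ∏ i, b.repr (u i) i) v := by
  have h := congrArg (fun f : E [⋀^Fin n]→ₗ[ℂ] ℂ => f v) (Φ.toAlternatingMap.eq_smul_basis_det b)
  rw [altSum_prod_eq_det (fun i w => b.repr w i)]
  exact h.trans (by
    rw [AlternatingMap.smul_apply, smul_eq_mul, Module.Basis.det_apply]
    rfl)

/-- Φ ∧ Φ̄ is |f|² times the determinant of all dz followed by all dz̄. Compared with `det_frame`,
its columns are permuted by `unshuffle`. -/
theorem wedge_conjForm_realFrame (b : Module.Basis (Fin n) ℂ E) {Φ : E [⋀^Fin n]→L[ℝ] ℂ} {f : ℂ}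
    (hΦ : ∀ v, Φ v = f * altSum (fun u => ∏ i, b.repr (u i) i) v) :
    castForm (two_mul n).symm (wedge Φ (conjForm Φ)) (realFrame b) =
      f * star f * (((Equiv.Perm.sign (unshuffle n) : ℤ) : ℂ) * (-2 * Complex.I) ^ n) := by
  have h1 (v : Fin n → E) : conjForm Φ v =
      star f * altSum (fun u => ∏ i, star (b.repr (u i) i)) v := by
    rw [conjForm_apply, hΦ, star_mul', altSum_prod_eq_det (fun i w => b.repr w i),
      altSum_prod_eq_det (fun i w => star (b.repr w i)), ← starRingEnd_apply,
      ← starRingEnd_apply, RingHom.map_det]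
    rfl
  rw [castForm_apply, wedge_apply_of_altSum hΦ h1]
  congr 1
  have h2 (u : Fin (n + n) → E) : (∏ i, b.repr (u (Fin.castAdd n i)) i) *
      ∏ i, star (b.repr (u (Fin.natAdd n i)) i) = ∏ i : Fin (n + n),
      (Sum.elim (fun i v => b.repr v i) (fun i v => star (b.repr v i))
        (finSumFinEquiv.symm i) : E → ℂ) (u i) := by
    rw [Fin.prod_univ_add]
    simp only [finSumFinEquiv_symm_apply_castAdd, finSumFinEquiv_symm_apply_natAdd, Sum.elim_inl,
      Sum.elim_inr]
  simp only [h2]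
  rw [altSum_prod_eq_det (fun i : Fin (n + n) => (Sum.elim (fun i v => b.repr v i)
    (fun i v => star (b.repr v i)) (finSumFinEquiv.symm i) : E → ℂ)),
    ← det_frame b, ← Matrix.det_permute', ← Matrix.det_submatrix_equiv_self finSumFinEquiv]
  congr 1
  ext i j
  simp [interleave_unshuffle]

end TopForms

/-! ### Positivity of Gram matrices -/

section Gram

variable {E : Type*} [NormedAddCommGroup E] [NormedSpace ℂ E] {n : ℕ}

open scoped ComplexOrder in
theorem gram_posDef (b : Module.Basis (Fin n) ℂ E) (H : E →ₗ[ℂ] E →ₗ⋆[ℂ] ℂ)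
    (hsymm : ∀ v w, star (H w v) = H v w) (hpos : ∀ v, v ≠ 0 → 0 < (H v v).re) :
    (Matrix.of fun j k => H (b j) (b k)).PosDef := by
  rw [Matrix.posDef_iff_dotProduct_mulVec]
  refine ⟨Matrix.IsHermitian.ext fun i j => hsymm _ _, fun x hx => ?_⟩
  set v : E := ∑ i, star (x i) • b i with hv
  have hv0 : v ≠ 0 := by
    intro h
    apply hx
    have := Fintype.linearIndependent_iff.mp b.linearIndependent _ h
    funext i
    simpa using this i
  have hrepr (i) : b.repr v i = star (x i) := by
    rw [hv, b.repr_sum_self]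
  have h1 : star x ⬝ᵥ (Matrix.of fun j k => H (b j) (b k)).mulVec x = H v v := by
    rw [sesquilinear_sum H b]
    simp only [hrepr, star_star, dotProduct, Matrix.mulVec, Finset.mul_sum, Matrix.of_apply,
      Pi.star_apply]
    refine Finset.sum_congr rfl fun j _ => Finset.sum_congr rfl fun k _ => by ring
  rw [h1, Complex.pos_iff]
  refine ⟨hpos v hv0, ?_⟩
  have := congrArg Complex.im (hsymm v v)
  simp at this
  linarith

end Gram

/-! ### Smoothness of holomorphic functions of several variables -/

section Holomorphic

variable {E : Type*} [NormedAddCommGroup E] [NormedSpace ℂ E]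

/-- Cauchy's formula on the complex line through z in direction v writes the derivative as a circle
integral of values of f. This integral can be differentiated in z under the integral sign, with
Cauchy's estimate as dominating bound. -/
theorem differentiableOn_fderiv_apply [FiniteDimensional ℂ E] {f : E → ℂ} {U : Set E}
    (hU : IsOpen U) (hf : DifferentiableOn ℂ f U) (v : E) :
    DifferentiableOn ℂ (fun z => fderiv ℂ f z v) U := by
  intro z₀ hz₀
  have : ProperSpace E := FiniteDimensional.proper ℂ E
  borelize E
  have hev : ∀ᶠ z in nhds z₀, z ∈ U ∧ dist (f z) (f z₀) < 1 :=
    (hU.eventually_mem hz₀).and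
      ((hf.differentiableAt (hU.mem_nhds hz₀)).continuousAt.eventually (Metric.ball_mem_nhds _ one_pos))
  obtain ⟨R, hR, hRU⟩ := Metric.eventually_nhds_iff_ball.mp hev
  set ρ := R / 3 with hρ
  have hρ0 : 0 < ρ := by positivity
  have hd {x : E} (hx : x ∈ Metric.ball z₀ R) : DifferentiableAt ℂ f x :=
    hf.differentiableAt (hU.mem_nhds (hRU x hx).1)
  have hbound {x : E} (hx : x ∈ Metric.ball z₀ (2 * ρ)) : ‖fderiv ℂ f x‖ ≤ 2 / ρ := by
    have hsub : Metric.ball x ρ ⊆ Metric.ball z₀ R := Metric.ball_subset_ball' (by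
      have := Metric.mem_ball.mp hx
      linarith)
    refine Complex.norm_fderiv_le_div_of_mapsTo_ball
      (fun y hy => (hd (hsub hy)).differentiableWithinAt) (fun y hy => ?_) hρ0
    have h1 := (hRU y (hsub hy)).2
    have h2 := (hRU x (hsub (Metric.mem_ball_self hρ0))).2
    rw [Metric.mem_closedBall]
    have := dist_triangle_right (f y) (f x) (f z₀)
    linarith
  -- Small enough that the circle of radius r in direction v moves a point by less than ρ, also when
  -- v = 0.
  set r := ρ / (‖v‖ + 1) with hr
  have hr0 : 0 < r := by positivity
  have hrv : r * ‖v‖ < ρ := by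
    rw [hr, div_mul_eq_mul_div, div_lt_iff₀ (by positivity)]
    nlinarith
  have hmem {z : E} (hz : z ∈ Metric.ball z₀ ρ) {t : ℂ} (ht : ‖t‖ ≤ r) :
      z + t • v ∈ Metric.ball z₀ (2 * ρ) := by
    rw [mem_ball_iff_norm] at hz ⊢
    calc ‖z + t • v - z₀‖ = ‖(z - z₀) + t • v‖ := by congr 1; abel
      _ ≤ ‖z - z₀‖ + ‖t‖ * ‖v‖ := (norm_add_le _ _).trans (by rw [norm_smul])
      _ ≤ ‖z - z₀‖ + r * ‖v‖ := by gcongr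
      _ < 2 * ρ := by linarith
  have hsub2 : Metric.ball z₀ (2 * ρ) ⊆ Metric.ball z₀ R := Metric.ball_subset_ball (by linarith)
  have hcirc (θ : ℝ) : ‖circleMap 0 r θ‖ ≤ r := by simp [abs_of_pos hr0]
  set K : ℝ → ℂ := fun θ => deriv (circleMap 0 r) θ * (1 / (circleMap 0 r θ - 0) ^ 2) with hK
  have hne (θ : ℝ) : circleMap 0 r θ - 0 ≠ 0 := by
    rw [sub_zero]
    exact circleMap_ne_center hr0.ne'
  have hKc : Continuous K := by
    have h1 : Continuous fun θ => deriv (circleMap 0 r) θ := by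
      simp only [deriv_circleMap]
      fun_prop
    refine h1.mul (Continuous.div continuous_const (by fun_prop) fun θ => pow_ne_zero 2 (hne θ))
  have hformula {z : E} (hz : z ∈ Metric.ball z₀ ρ) : fderiv ℂ f z v =
      (2 * Real.pi * Complex.I : ℂ)⁻¹ *
        ∫ θ in (0 : ℝ)..2 * Real.pi, K θ * f (z + circleMap 0 r θ • v) := by
    have hline (t : ℂ) : HasDerivAt (fun t : ℂ => z + t • v) v t := by
      simpa using ((hasDerivAt_id t).smul_const v).const_add z
    have hdiff : DifferentiableOn ℂ (fun t : ℂ => f (z + t • v)) (Metric.closedBall 0 r) := by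
      intro t ht
      have := (hd (hsub2 (hmem hz (by simpa using ht)))).hasFDerivAt.comp_hasDerivAt t (hline t)
      exact this.differentiableAt.differentiableWithinAt
    have h1 := DifferentiableOn.deriv_eq_smul_circleIntegral hr0 hdiff
    have h2 : deriv (fun t : ℂ => f (z + t • v)) 0 = fderiv ℂ f z v := by
      have h3 : HasFDerivAt f (fderiv ℂ f z) (z + (0 : ℂ) • v) := by
        have := (hd (hsub2 (hmem hz (t := 0) (by simpa using hr0.le)))).hasFDerivAt
        simpa using this
      exact (h3.comp_hasDerivAt (0 : ℂ) (hline 0)).deriv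
    rw [h2, smul_eq_mul] at h1
    rw [eq_inv_mul_iff_mul_eq₀ (by simp [Real.pi_ne_zero]), ← h1, circleIntegral]
    simp only [hK, smul_eq_mul, mul_assoc]
  have hFc {z : E} (hz : z ∈ Metric.ball z₀ ρ) :
      Continuous fun θ => K θ * f (z + circleMap 0 r θ • v) := by
    refine hKc.mul (continuous_iff_continuousAt.mpr fun θ => ?_)
    refine ContinuousAt.comp (f := fun θ => z + circleMap 0 r θ • v)
      (hd (hsub2 (hmem hz (hcirc θ)))).continuousAt ?_
    fun_prop
  have key := intervalIntegral.hasFDerivAt_integral_of_dominated_of_fderiv_le (𝕜 := ℂ)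
    (μ := MeasureTheory.volume) (a := 0) (b := 2 * Real.pi)
    (F := fun z θ => K θ * f (z + circleMap 0 r θ • v))
    (F' := fun z θ => K θ • fderiv ℂ f (z + circleMap 0 r θ • v)) (x₀ := z₀)
    (bound := fun θ => ‖K θ‖ * (2 / ρ)) (s := Metric.ball z₀ ρ) (Metric.ball_mem_nhds _ hρ0)
    (by
      filter_upwards [Metric.ball_mem_nhds z₀ hρ0] with z hz
      exact (hFc hz).aestronglyMeasurable)
    ((hFc (Metric.mem_ball_self hρ0)).intervalIntegrable _ _)
    (by
      refine hKc.aestronglyMeasurable.smul ?_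
      have h1 : Measurable fun θ : ℝ => fderiv ℂ f (z₀ + circleMap 0 r θ • v) :=
        (measurable_fderiv ℂ f).comp (by fun_prop : Continuous fun θ : ℝ =>
          z₀ + circleMap 0 r θ • v).measurable
      exact h1.aestronglyMeasurable)
    (Filter.Eventually.of_forall fun θ _ z hz => by
      rw [norm_smul]
      exact mul_le_mul_of_nonneg_left (hbound (hmem hz (hcirc θ))) (norm_nonneg _))
    ((by fun_prop : Continuous fun θ => ‖K θ‖ * (2 / ρ)).intervalIntegrable _ _)
    (Filter.Eventually.of_forall fun θ _ z hz => by
      have h1 := (hd (hsub2 (hmem hz (hcirc θ)))).hasFDerivAt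
      have h2 : HasFDerivAt (fun z : E => z + circleMap 0 r θ • v) (ContinuousLinearMap.id ℂ E) z :=
        (hasFDerivAt_id z).add_const _
      exact (h1.comp z h2).const_smul (K θ))
  have h3 : DifferentiableAt ℂ (fun z => fderiv ℂ f z v) z₀ := by
    refine (key.differentiableAt.const_mul (2 * Real.pi * Complex.I : ℂ)⁻¹).congr_of_eventuallyEq ?_
    filter_upwards [Metric.ball_mem_nhds z₀ hρ0] with z hz using hformula hz
  exact h3.differentiableWithinAt

theorem contDiffOn_of_differentiableOn_complex [FiniteDimensional ℂ E] {U : Set E}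
    (hU : IsOpen U) (m : ℕ) : ∀ {f : E → ℂ}, DifferentiableOn ℂ f U → ContDiffOn ℂ m f U := by
  induction m with
  | zero => exact fun hf => contDiffOn_zero.mpr hf.continuousOn
  | succ m ih =>
    intro f hf
    rw [Nat.cast_succ, contDiffOn_succ_iff_fderiv_of_isOpen hU]
    refine ⟨hf, by simp, contDiffOn_clm_apply.mpr fun v => ih (differentiableOn_fderiv_apply hU hf v)⟩

theorem contDiffOn_real_of_differentiableOn_complex [FiniteDimensional ℂ E] {U : Set E}
    (hU : IsOpen U) {f : E → ℂ} (hf : DifferentiableOn ℂ f U) : ContDiffOn ℝ ∞ f U :=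
  contDiffOn_infty.mpr fun m =>
    (contDiffOn_of_differentiableOn_complex hU m hf).restrict_scalars ℝ

end Holomorphic

/-! ### Local expressions of a Hermitian metric -/

section Charts

variable {E : Type*} [NormedAddCommGroup E] [NormedSpace ℂ E]
  {X : Type*} [TopologicalSpace X] [ChartedSpace E X] {n : ℕ}

theorem chartInvDeriv_bijective [IsManifold 𝓘(ℂ, E) ω X] (x₀ : X) {z : E}
    (hz : z ∈ (chartAt E x₀).target) : Function.Bijective (chartInvDeriv (X := X) x₀ z) :=
  (mdifferentiable_chart (I := 𝓘(ℂ, E)) x₀).symm.mfderiv_bijective hz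

/-- The Hermitian inner product of a metric, in the chart around `x₀`. -/
def HermitianMetric.chartInner (g : HermitianMetric E X) (x₀ : X) (z : E) :
    E →ₗ[ℂ] E →ₗ⋆[ℂ] ℂ :=
  LinearMap.mk₂'ₛₗ (RingHom.id ℂ) (starRingEnd ℂ)
    (fun v w => g.inner ((chartAt E x₀).symm z) (chartInvDeriv x₀ z v) (chartInvDeriv x₀ z w))
    (by simp) (by simp) (by simp) (by simp)

theorem HermitianMetric.chartInner_symm (g : HermitianMetric E X) (x₀ : X) (z v w : E) :
    star (g.chartInner x₀ z w v) = g.chartInner x₀ z v w := g.conj_symm _ _ _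

theorem HermitianMetric.chartInner_pos [IsManifold 𝓘(ℂ, E) ω X] (g : HermitianMetric E X) (x₀ : X)
    {z : E} (hz : z ∈ (chartAt E x₀).target) (v : E) (hv : v ≠ 0) :
    0 < (g.chartInner x₀ z v v).re := by
  refine g.pos _ _ fun h => hv ?_
  exact (chartInvDeriv_bijective x₀ hz).1 (h.trans (map_zero _).symm)

/-- The Gram matrix `(j, k) ↦ g(∂/∂zⱼ, ∂/∂zₖ)`, in the chart around `x₀`. -/
def HermitianMetric.gram (g : HermitianMetric E X) (x₀ : X) (b : Module.Basis (Fin n) ℂ E) (z : E) :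
    Matrix (Fin n) (Fin n) ℂ := Matrix.of fun j k => g.chartInner x₀ z (b j) (b k)

theorem HermitianMetric.chartInner_eq_sesq (g : HermitianMetric E X) (x₀ : X)
    (b : Module.Basis (Fin n) ℂ E) (z v w : E) :
    g.chartInner x₀ z v w = sesq b (g.gram x₀ b z) v w := by
  rw [sesquilinear_sum _ b, Finset.sum_comm, sesq]
  refine Finset.sum_congr rfl fun k _ => ?_
  rw [Finset.sum_mul]
  refine Finset.sum_congr rfl fun j _ => ?_
  rw [HermitianMetric.gram, Matrix.of_apply]
  ring

theorem HermitianMetric.coeff_eq_gram (g : HermitianMetric E X) (x₀ : X)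
    (b : Module.Basis (Fin n) ℂ E) (z : E) : g.coeff x₀ b z = (g.gram x₀ b z).transpose := rfl

theorem HermitianMetric.star_gram (g : HermitianMetric E X) (x₀ : X)
    (b : Module.Basis (Fin n) ℂ E) (z : E) (p q : Fin n) :
    star (g.gram x₀ b z p q) = g.gram x₀ b z q p := g.chartInner_symm _ _ _ _

open scoped ComplexOrder in
theorem HermitianMetric.det_gram_pos [IsManifold 𝓘(ℂ, E) ω X] (g : HermitianMetric E X) (x₀ : X)
    (b : Module.Basis (Fin n) ℂ E) {z : E} (hz : z ∈ (chartAt E x₀).target) :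
    0 < (g.gram x₀ b z).det :=
  (gram_posDef b _ (g.chartInner_symm x₀ z) (g.chartInner_pos x₀ hz)).det_pos

open scoped ComplexOrder in
theorem HermitianMetric.isUnit_det_gram [IsManifold 𝓘(ℂ, E) ω X] (g : HermitianMetric E X) (x₀ : X)
    (b : Module.Basis (Fin n) ℂ E) {z : E} (hz : z ∈ (chartAt E x₀).target) :
    IsUnit (g.gram x₀ b z).det :=
  (gram_posDef b _ (g.chartInner_symm x₀ z) (g.chartInner_pos x₀ hz)).det_pos.ne'.isUnit

theorem HermitianMetric.kahlerForm_apply (g : HermitianMetric E X) (x : X)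
    (v : Fin 2 → TangentSpace 𝓘(ℂ, E) x) :
    g.kahlerForm x v = Complex.I * altSum (fun u => g.inner x (u 0) (u 1)) v := by
  simp only [kahlerForm, ContinuousAlternatingMap.smul_apply, smul_eq_mul, altSum,
    ContinuousMultilinearMap.alternatization_apply_apply]
  congr 1
  refine Finset.sum_congr rfl fun σ _ => ?_
  rw [Units.smul_def, zsmul_eq_mul]
  rfl

theorem HermitianMetric.kahlerForm_inChart_apply (g : HermitianMetric E X) (x₀ : X)
    (b : Module.Basis (Fin n) ℂ E) (z : E) (v : Fin 2 → E) :
    g.kahlerForm.inChart x₀ z v =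
      Complex.I * altSum (fun u => sesq b (g.gram x₀ b z) (u 0) (u 1)) v := by
  have h := g.kahlerForm_apply ((chartAt E x₀).symm z) fun i => chartInvDeriv x₀ z (v i)
  refine h.trans ?_
  simp only [← g.chartInner_eq_sesq x₀ b]
  rfl

theorem HermitianMetric.kahlerPow_inChart_apply (g : HermitianMetric E X) (x₀ : X)
    (b : Module.Basis (Fin n) ℂ E) (p : ℕ) (z : E) (v : Fin (2 * p) → E) :
    (g.kahlerPow p).inChart x₀ z v =
      Complex.I ^ p * altSum (pairProd fun _ : Fin p => sesq b (g.gram x₀ b z)) v := by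
  change wedgePow (g.kahlerForm ((chartAt E x₀).symm z)) p (fun i => chartInvDeriv x₀ z (v i)) = _
  rw [wedgePow_apply (B := fun v w => g.inner ((chartAt E x₀).symm z) v w) (g.kahlerForm_apply _)]
  have h : (pairProd fun _ : Fin p => sesq b (g.gram x₀ b z)) =
      pairProd fun _ : Fin p => fun v w => g.chartInner x₀ z v w := by
    funext u
    simp only [pairProd, ← g.chartInner_eq_sesq x₀ b]
  rw [h]
  rfl

theorem HermitianMetric.kahlerPow_realFrame (g : HermitianMetric E X) (x₀ : X)
    (b : Module.Basis (Fin n) ℂ E) (z : E) :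
    (g.kahlerPow n).inChart x₀ z (realFrame b) =
      n.factorial * 2 ^ n * (g.gram x₀ b z).det := by
  rw [g.kahlerPow_inChart_apply x₀ b, altSum_pairProd_sesq]
  have h : Complex.I ^ n * (-2 * Complex.I) ^ n = 2 ^ n := by
    rw [← mul_pow]
    congr 1
    linear_combination (-2) * Complex.I_mul_I
  linear_combination (n.factorial * (g.gram x₀ b z).det : ℂ) * h

/-- The coefficient of a holomorphic `(n,0)`-form with respect to `dz₁ ∧ ⋯ ∧ dzₙ`. -/
def HolomorphicVolumeForm.chartCoeff (Ω : HolomorphicVolumeForm E X n) (x₀ : X)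
    (b : Module.Basis (Fin n) ℂ E) (z : E) : ℂ :=
  Ω.form ((chartAt E x₀).symm z) fun i => chartInvDeriv x₀ z (b i)

theorem inChart_injective [IsManifold 𝓘(ℂ, E) ω X] {k : ℕ} {α β : DForm E X k} {x₀ : X} {z : E}
    (hz : z ∈ (chartAt E x₀).target) (h : α.inChart x₀ z = β.inChart x₀ z) :
    α ((chartAt E x₀).symm z) = β ((chartAt E x₀).symm z) := by
  ext v
  choose w hw using fun i => (chartInvDeriv_bijective x₀ hz).2 (v i)
  have := congrArg (fun γ : E [⋀^Fin k]→L[ℝ] ℂ => γ w) h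
  rw [← funext hw]
  exact this

theorem HolomorphicVolumeForm.chartCoeff_ne_zero [IsManifold 𝓘(ℂ, E) ω X]
    (Ω : HolomorphicVolumeForm E X n) (x₀ : X)
    (b : Module.Basis (Fin n) ℂ E) {z : E} (hz : z ∈ (chartAt E x₀).target) :
    Ω.chartCoeff x₀ b z ≠ 0 := by
  intro h
  refine Ω.ne_zero ((chartAt E x₀).symm z) ?_
  ext v
  choose w hw using fun i => (chartInvDeriv_bijective x₀ hz).2 (v i)
  rw [← funext hw]
  have := map_eq_altSum b ((Ω.form ((chartAt E x₀).symm z)).compContinuousLinearMap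
    (chartInvDeriv x₀ z)) w
  refine this.trans ?_
  have h' : ((Ω.form ((chartAt E x₀).symm z)).compContinuousLinearMap
    (chartInvDeriv x₀ z)) b = 0 := h
  rw [h', zero_mul]
  rfl

/-- Both top degree forms are evaluated on the real frame: one gives n! 2ⁿ |f|², the other n! 2ⁿ det
G. -/
theorem HermitianMetric.normOf_eq [IsManifold 𝓘(ℂ, E) ω X] (g : HermitianMetric E X)
    (Ω : HolomorphicVolumeForm E X n) (x₀ : X)
    (b : Module.Basis (Fin n) ℂ E) {z : E} (hz : z ∈ (chartAt E x₀).target) :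
    g.normOf Ω ((chartAt E x₀).symm z) = Real.sqrt
      (Ω.chartCoeff x₀ b z * star (Ω.chartCoeff x₀ b z) / (g.gram x₀ b z).det).re := by
  set f := Ω.chartCoeff x₀ b z with hf
  have hdet := (g.isUnit_det_gram x₀ b hz).ne_zero
  have hfac : (n.factorial : ℂ) ≠ 0 := by exact_mod_cast n.factorial_ne_zero
  have hpow : (g.kahlerPow n).inChart x₀ z (realFrame b) ≠ 0 := by
    rw [g.kahlerPow_realFrame]
    exact mul_ne_zero (mul_ne_zero hfac (pow_ne_zero _ two_ne_zero)) hdet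
  let Θ : DForm E X (2 * n) := fun x => (Complex.I ^ (n ^ 2) * (n.factorial : ℂ)) •
      castForm (two_mul n).symm (wedge (Ω.toDForm x) (conjForm (Ω.toDForm x)))
  let Ξ : DForm E X (2 * n) := fun x => (f * star f / (g.gram x₀ b z).det) • g.kahlerPow n x
  have key : Θ.inChart x₀ z = Ξ.inChart x₀ z := by
    refine ext_realFrame b ?_
    have h1 : Θ.inChart x₀ z (realFrame b) = (Complex.I ^ (n ^ 2) * (n.factorial : ℂ)) *
        castForm (two_mul n).symm (wedge (Ω.toDForm.inChart x₀ z)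
          (conjForm (Ω.toDForm.inChart x₀ z))) (realFrame b) := by
      rw [castForm_apply, wedge_apply]
      change (Complex.I ^ (n ^ 2) * (n.factorial : ℂ)) * castForm _ _ _ = _
      rw [castForm_apply, wedge_apply]
      rfl
    have h2 : Ξ.inChart x₀ z (realFrame b) = (f * star f / (g.gram x₀ b z).det) *
      (g.kahlerPow n).inChart x₀ z (realFrame b) := rfl
    rw [h1, h2, g.kahlerPow_realFrame, wedge_conjForm_realFrame b (f := f) fun v => map_eq_altSum b
      ((Ω.form ((chartAt E x₀).symm z)).compContinuousLinearMap (chartInvDeriv x₀ z)) v]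
    field_simp
    linear_combination (f * star f) * I_pow_sq_mul_sign n
  have h3 := topQuotient_eq (inChart_injective hz key)
    (v := fun i => chartInvDeriv x₀ z (realFrame b i)) hpow
  rw [normOf]
  exact congrArg (fun c : ℂ => Real.sqrt c.re) h3

theorem HermitianMetric.normOf_mul_self [IsManifold 𝓘(ℂ, E) ω X] (g : HermitianMetric E X)
    (Ω : HolomorphicVolumeForm E X n) (x₀ : X)
    (b : Module.Basis (Fin n) ℂ E) {z : E} (hz : z ∈ (chartAt E x₀).target) :
    0 < g.normOf Ω ((chartAt E x₀).symm z) ∧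
    ((g.normOf Ω ((chartAt E x₀).symm z) : ℝ) : ℂ) ^ 2 * (g.gram x₀ b z).det =
      Ω.chartCoeff x₀ b z * star (Ω.chartCoeff x₀ b z) := by
  have h0 := Ω.chartCoeff_ne_zero x₀ b hz
  obtain ⟨h1, h2⟩ := Complex.pos_iff.mp (g.det_gram_pos x₀ b hz)
  have hd : (g.gram x₀ b z).det = (((g.gram x₀ b z).det.re : ℝ) : ℂ) :=
    Complex.ext rfl (by simpa using h2.symm)
  have hf : Ω.chartCoeff x₀ b z * star (Ω.chartCoeff x₀ b z) =
      ((Complex.normSq (Ω.chartCoeff x₀ b z) : ℝ) : ℂ) := Complex.mul_conj _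
  rw [g.normOf_eq Ω x₀ b hz, hf, hd, ← Complex.ofReal_div, Complex.ofReal_re]
  have h3 := Complex.normSq_pos.mpr h0
  refine ⟨Real.sqrt_pos.mpr (by positivity), ?_⟩
  rw [← Complex.ofReal_pow, Real.sq_sqrt (by positivity), ← Complex.ofReal_mul,
    div_mul_cancel₀ _ h1.ne']

theorem HolomorphicVolumeForm.differentiableOn_chartCoeff (Ω : HolomorphicVolumeForm E X n)
    (x₀ : X) (b : Module.Basis (Fin n) ℂ E) :
    DifferentiableOn ℂ (Ω.chartCoeff x₀ b) (chartAt E x₀).target := Ω.holomorphic x₀ b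

theorem HolomorphicVolumeForm.contDiffOn_chartCoeff [FiniteDimensional ℂ E]
    (Ω : HolomorphicVolumeForm E X n)
    (x₀ : X) (b : Module.Basis (Fin n) ℂ E) :
    ContDiffOn ℝ ∞ (Ω.chartCoeff x₀ b) (chartAt E x₀).target :=
  contDiffOn_real_of_differentiableOn_complex (chartAt E x₀).open_target
    (Ω.differentiableOn_chartCoeff x₀ b)

/-- The square root is smooth because its argument |f|² / det G is positive. The parameter space F
is arbitrary so that the result covers both a fixed metric (F = E) and a family over space-time (F =
ℝ × E). -/
theorem HermitianMetric.contDiffOn_normOf [FiniteDimensional ℂ E] [IsManifold 𝓘(ℂ, E) ω X]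
    {F : Type*} [NormedAddCommGroup F] [NormedSpace ℝ F] {s : Set F}
    (g : F → HermitianMetric E X) (ζ : F → E) (Ω : HolomorphicVolumeForm E X n) (x₀ : X)
    (b : Module.Basis (Fin n) ℂ E) (hζ : ContDiffOn ℝ ∞ ζ s)
    (hζs : Set.MapsTo ζ s (chartAt E x₀).target)
    (hg : ∀ p q, ContDiffOn ℝ ∞ (fun y => (g y).gram x₀ b (ζ y) p q) s) :
    ContDiffOn ℝ ∞ (fun y => (g y).normOf Ω ((chartAt E x₀).symm (ζ y))) s := by
  have hf := (Ω.contDiffOn_chartCoeff x₀ b).comp hζ hζs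
  have hquot : ContDiffOn ℝ ∞ (fun y => (Ω.chartCoeff x₀ b (ζ y) * star (Ω.chartCoeff x₀ b (ζ y)) /
      ((g y).gram x₀ b (ζ y)).det).re) s := by
    suffices h : ContDiffOn ℝ ∞ (fun y => Ω.chartCoeff x₀ b (ζ y) *
        star (Ω.chartCoeff x₀ b (ζ y)) / ((g y).gram x₀ b (ζ y)).det) s from
      Complex.reCLM.contDiff.comp_contDiffOn h
    simp only [div_eq_mul_inv]
    refine (hf.mul (((Complex.conjCLE : ℂ →L[ℝ] ℂ).contDiff (n := ∞)).comp_contDiffOn hf)).mul ?_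
    exact (contDiffOn_det hg).inv fun y hy => ((g y).isUnit_det_gram x₀ b (hζs hy)).ne_zero
  refine (hquot.sqrt fun y hy h => ?_).congr fun y hy => (g y).normOf_eq Ω x₀ b (hζs hy)
  have h1 := ((g y).normOf_mul_self Ω x₀ b (hζs hy)).1
  rw [(g y).normOf_eq Ω x₀ b (hζs hy), h, Real.sqrt_zero] at h1
  exact lt_irrefl _ h1

theorem HermitianMetric.contDiffOn_gram (g : HermitianMetric E X) (x₀ : X)
    (b : Module.Basis (Fin n) ℂ E) (p q : Fin n) :
    ContDiffOn ℝ ∞ (fun y => g.gram x₀ b y p q) (chartAt E x₀).target := g.smooth x₀ (b p) (b q)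

end Charts

/-! ### Pullback of `∂` and `∂̄` by holomorphic maps -/

section Pullback

variable {E : Type*} [NormedAddCommGroup E] [NormedSpace ℂ E] {k : ℕ}

theorem antilinearPart_add {W : Type*} [NormedAddCommGroup W] [NormedSpace ℂ W] (L M : E →L[ℝ] W) :
    antilinearPart (L + M) = antilinearPart L + antilinearPart M := by
  ext v
  simp only [add_apply, antilinearPart_apply, smul_add]
  abel

theorem del_congr {α β : E → E [⋀^Fin k]→L[ℝ] ℂ} {z : E} (h : α =ᶠ[nhds z] β) :
    del α z = del β z := by
  rw [del, del, h.fderiv_eq]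

theorem delBar_congr {α β : E → E [⋀^Fin k]→L[ℝ] ℂ} {z : E} (h : α =ᶠ[nhds z] β) :
    delBar α z = delBar β z := by
  rw [delBar, delBar, h.fderiv_eq]

theorem del_eq_extDeriv_sub {α : E → E [⋀^Fin k]→L[ℝ] ℂ} {z : E} :
    del α z = extDeriv α z - delBar α z := by
  rw [extDeriv_eq_del_add_delBar, add_sub_cancel_right]

/-- The derivative of a holomorphic map is again holomorphic, so its derivative is complex linear in
the direction of differentiation. -/
theorem fderiv_fderiv_I_smul {τ : E → E} {z : E} (hτ : ContDiffAt ℂ 2 τ z) (v w : E) :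
    fderiv ℝ (fderiv ℝ τ) z (Complex.I • v) w = Complex.I • fderiv ℝ (fderiv ℝ τ) z v w := by
  have hev : ∀ᶠ y in nhds z, DifferentiableAt ℂ τ y := by
    filter_upwards [hτ.eventually (by simp)] with y hy using hy.differentiableAt (by simp)
  have hdc : DifferentiableAt ℂ (fun y => fderiv ℂ τ y w) z :=
    ((hτ.fderiv_right (m := 1) (by norm_num)).differentiableAt (by simp)).clm_apply
      (differentiableAt_const w)
  have hdr : DifferentiableAt ℝ (fderiv ℝ τ) z :=
    ((hτ.restrict_scalars ℝ).fderiv_right (m := 1) (by norm_num)).differentiableAt (by simp)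
  have h1 (u : E) : fderiv ℝ (fderiv ℝ τ) z u w = fderiv ℂ (fun y => fderiv ℂ τ y w) z u := by
    have h2 : fderiv ℝ (fun y => fderiv ℝ τ y w) z u = fderiv ℝ (fderiv ℝ τ) z u w := by
      rw [fderiv_clm_apply hdr (differentiableAt_const w)]
      simp
    have h3 : (fun y => fderiv ℝ τ y w) =ᶠ[nhds z] fun y => fderiv ℂ τ y w := by
      filter_upwards [hev] with y hy
      rw [hy.fderiv_restrictScalars ℝ]
      rfl
    rw [← h2, h3.fderiv_eq, hdc.fderiv_restrictScalars ℝ]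
    rfl
  rw [h1, h1, map_smul]

/-- The derivative of the pulled back form has a part in the second derivative of τ and a part in
the derivative of β. The first is symmetric in two slots and dies under alternation; in the second,
dτ commutes with i and so preserves antilinear parts. -/
theorem delBar_pullback {β : E → E [⋀^Fin k]→L[ℝ] ℂ} {τ : E → E} {z : E}
    (hβ : DifferentiableAt ℝ β (τ z)) (hτ : ContDiffAt ℂ 2 τ z) :
    delBar (fun y => (β (τ y)).compContinuousLinearMap (fderiv ℝ τ y)) z =
      (delBar β (τ z)).compContinuousLinearMap (fderiv ℝ τ z) := by
  have hdr : DifferentiableAt ℝ (fderiv ℝ τ) z :=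
    ((hτ.restrict_scalars ℝ).fderiv_right (m := 1) (by norm_num)).differentiableAt (by simp)
  have hd : DifferentiableAt ℝ τ z := (hτ.restrict_scalars ℝ).differentiableAt (by simp)
  have hI (w : E) : fderiv ℝ τ z (Complex.I • w) = Complex.I • fderiv ℝ τ z w := by
    rw [(hτ.differentiableAt (by simp)).fderiv_restrictScalars ℝ]
    exact map_smul (fderiv ℂ τ z) _ _
  have hsymm : ∀ x y, fderiv ℝ (fderiv ℝ τ) z x y = fderiv ℝ (fderiv ℝ τ) z y x :=
    (hτ.restrict_scalars ℝ).isSymmSndFDerivAt (by simp)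
  set H := fderiv ℝ (fderiv ℝ τ) z with hH
  set f := β (τ z) with hf
  have hzero (S : E →L[ℝ] E →L[ℝ] E) (hS : ∀ x y, S x y = S y x) :=
    ContinuousAlternatingMap.alternatizeUncurryFin_fderivCompContinuousLinearMap_eq_zero f
      (fderiv ℝ τ z) hS
  have h2 : ContinuousAlternatingMap.alternatizeUncurryFin
      (antilinearPart (f.fderivCompContinuousLinearMap (fderiv ℝ τ z) ∘L H)) = 0 := by
    have h3 : antilinearPart (f.fderivCompContinuousLinearMap (fderiv ℝ τ z) ∘L H) =
        (1 / 2 : ℂ) • ((f.fderivCompContinuousLinearMap (fderiv ℝ τ z) ∘L H) +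
          Complex.I • (f.fderivCompContinuousLinearMap (fderiv ℝ τ z) ∘L (H ∘L mulI E))) := rfl
    rw [h3, ContinuousAlternatingMap.alternatizeUncurryFin_smul,
      ContinuousAlternatingMap.alternatizeUncurryFin_add,
      ContinuousAlternatingMap.alternatizeUncurryFin_smul, hzero H hsymm, hzero, smul_zero,
      add_zero, smul_zero]
    -- For ∂̄ the bilinear map (x, y) ↦ D²τ(ix, y) must be symmetric as well, and this is where
    -- holomorphy of τ enters.
    intro x y
    change H (Complex.I • x) y = H (Complex.I • y) x
    rw [hH, fderiv_fderiv_I_smul hτ, fderiv_fderiv_I_smul hτ, ← hH, hsymm]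
  rw [delBar, fderiv_continuousAlternatingMapCompContinuousLinearMap
    (f := fun y => β (τ y)) (hβ.comp z hd) hdr,
    antilinearPart_add, ContinuousAlternatingMap.alternatizeUncurryFin_add, h2, add_zero,
    fderiv_fun_comp z hβ hd]
  ext v
  simp only [ContinuousAlternatingMap.alternatizeUncurryFin_apply, delBar,
    ContinuousAlternatingMap.compContinuousLinearMap_apply, antilinearPart_apply]
  refine Finset.sum_congr rfl fun i _ => ?_
  congr 1
  have h4 : fderiv ℝ τ z ∘ (v ∘ i.succAbove) = fun j => fderiv ℝ τ z (v (i.succAbove j)) := rfl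
  simp [hI]
  rfl

theorem del_pullback {β : E → E [⋀^Fin k]→L[ℝ] ℂ} {τ : E → E} {z : E}
    (hβ : DifferentiableAt ℝ β (τ z)) (hτ : ContDiffAt ℂ 2 τ z) :
    del (fun y => (β (τ y)).compContinuousLinearMap (fderiv ℝ τ y)) z =
      (del β (τ z)).compContinuousLinearMap (fderiv ℝ τ z) := by
  rw [del_eq_extDeriv_sub, del_eq_extDeriv_sub, delBar_pullback hβ hτ,
    extDeriv_pullback hβ (hτ.restrict_scalars ℝ) (by simp)]
  rfl

end Pullback

/-! ### Independence of the chart -/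

section ChartIndependence

variable {E : Type*} [NormedAddCommGroup E] [NormedSpace ℂ E]
  {X : Type*} [TopologicalSpace X] [ChartedSpace E X] {k : ℕ}

theorem DForm.apply_congr (α : DForm E X k) {x x' : X} (h : x = x')
    {v : Fin k → TangentSpace 𝓘(ℂ, E) x} {v' : Fin k → TangentSpace 𝓘(ℂ, E) x'}
    (hv : ∀ i, HEq (v i) (v' i)) : α x v = α x' v' := by
  subst h
  congr 1
  funext i
  exact eq_of_heq (hv i)

/-- The change of coordinates from the chart around `x₀` to the preferred chart at the point with
coordinate `z`. -/
def transition (x₀ : X) (z : E) : E → E :=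
  chartAt E ((chartAt E x₀).symm z) ∘ (chartAt E x₀).symm

variable (x₀ : X) {z : E}

theorem eventually_symm_mem_source (hz : z ∈ (chartAt E x₀).target) :
    ∀ᶠ y in nhds z, y ∈ (chartAt E x₀).target ∧
      (chartAt E x₀).symm y ∈ (chartAt E ((chartAt E x₀).symm z)).source := by
  refine ((chartAt E x₀).open_target.eventually_mem hz).and ?_
  refine ((chartAt E x₀).continuousAt_symm hz).eventually ?_
  exact (chartAt E _).open_source.eventually_mem (mem_chart_source E _)

variable [IsManifold 𝓘(ℂ, E) ω X]

theorem contDiffAt_transition (hz : z ∈ (chartAt E x₀).target) :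
    ContDiffAt ℂ 2 (transition (X := X) x₀ z) z := by
  have h1 : ContMDiffAt 𝓘(ℂ, E) 𝓘(ℂ, E) 2 (chartAt E x₀).symm z :=
    (contMDiffOn_chart_symm (x := x₀)).contMDiffAt ((chartAt E x₀).open_target.mem_nhds hz)
  have h2 : ContMDiffAt 𝓘(ℂ, E) 𝓘(ℂ, E) 2 (chartAt E ((chartAt E x₀).symm z))
      ((chartAt E x₀).symm z) :=
    contMDiffOn_chart.contMDiffAt ((chartAt E _).open_source.mem_nhds (mem_chart_source E _))
  exact contMDiffAt_iff_contDiffAt.mp (h2.comp z h1)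

theorem fderiv_transition {y : E} (hy : y ∈ (chartAt E x₀).target)
    (hy' : (chartAt E x₀).symm y ∈ (chartAt E ((chartAt E x₀).symm z)).source) :
    fderiv ℝ (transition (X := X) x₀ z) y = ((mfderiv 𝓘(ℂ, E) 𝓘(ℂ, E)
      (chartAt E ((chartAt E x₀).symm z)) ((chartAt E x₀).symm y)).comp
        (chartInvDeriv x₀ y)).restrictScalars ℝ := by
  have h1 := mdifferentiableAt_atlas_symm (I := 𝓘(ℂ, E)) (chart_mem_atlas E x₀) hy
  have h2 := mdifferentiableAt_atlas (I := 𝓘(ℂ, E))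
    (chart_mem_atlas E ((chartAt E x₀).symm z)) hy'
  have h3 := mfderiv_comp y h2 h1
  have h4 : DifferentiableAt ℂ (transition (X := X) x₀ z) y :=
    mdifferentiableAt_iff_differentiableAt.mp (h2.comp y h1)
  rw [h4.fderiv_restrictScalars ℝ, ← mfderiv_eq_fderiv]
  exact congrArg (ContinuousLinearMap.restrictScalars ℝ) h3

theorem chartInvDeriv_fderiv_transition {y : E} (hy : y ∈ (chartAt E x₀).target)
    (hy' : (chartAt E x₀).symm y ∈ (chartAt E ((chartAt E x₀).symm z)).source) (v : E) :
    HEq (chartInvDeriv ((chartAt E x₀).symm z) (transition (X := X) x₀ z y)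
      (fderiv ℝ (transition (X := X) x₀ z) y v)) (chartInvDeriv x₀ y v) := by
  set x := (chartAt E x₀).symm z with hx
  have h1 := (mdifferentiable_chart (I := 𝓘(ℂ, E)) x).symm_comp_deriv hy'
  rw [fderiv_transition x₀ hy hy']
  have h2 := congrArg (fun L : TangentSpace 𝓘(ℂ, E) ((chartAt E x₀).symm y) →L[ℂ]
    TangentSpace 𝓘(ℂ, E) ((chartAt E x₀).symm y) => L (chartInvDeriv x₀ y v)) h1
  exact heq_of_eq h2

/-- Near z a local expression is the pullback, by a holomorphic transition map, of the expression in
the preferred chart of the point. The latter is the chart used to define d, ∂ and ∂̄ there. -/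
theorem DForm.inChart_eventuallyEq (α : DForm E X k) (hz : z ∈ (chartAt E x₀).target) :
    α.inChart x₀ =ᶠ[nhds z] fun y => (α.inChart ((chartAt E x₀).symm z)
      (transition x₀ z y)).compContinuousLinearMap (fderiv ℝ (transition (X := X) x₀ z) y) := by
  filter_upwards [eventually_symm_mem_source x₀ hz] with y hy
  ext v
  refine α.apply_congr ?_ fun i => (chartInvDeriv_fderiv_transition x₀ hy.1 hy.2 (v i)).symm
  exact ((chartAt E _).left_inv hy.2).symm

end ChartIndependence

/-! ### Smooth forms and their operators in an arbitrary chart -/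

section Smooth

variable {E : Type*} [NormedAddCommGroup E] [NormedSpace ℂ E]
  {X : Type*} [TopologicalSpace X] [ChartedSpace E X] {k : ℕ} {x₀ : X} {z : E}

/-- A form is smooth if its local expressions are. -/
def DForm.IsSmooth (α : DForm E X k) : Prop :=
  ∀ x₀ : X, ContDiffOn ℝ ∞ (α.inChart x₀) (chartAt E x₀).target

theorem DForm.IsSmooth.differentiableAt {α : DForm E X k} (hα : α.IsSmooth)
    (hz : z ∈ (chartAt E x₀).target) : DifferentiableAt ℝ (α.inChart x₀) z :=
  ((hα x₀).contDiffAt ((chartAt E x₀).open_target.mem_nhds hz)).differentiableAt (by simp)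

theorem DForm.IsSmooth.differentiableAt_transition {α : DForm E X k} (hα : α.IsSmooth) (x₀ : X)
    (z : E) : DifferentiableAt ℝ (α.inChart ((chartAt E x₀).symm z)) (transition x₀ z z) :=
  hα.differentiableAt (mem_chart_target E _)

variable [IsManifold 𝓘(ℂ, E) ω X]

theorem DForm.IsSmooth.d_inChart {α : DForm E X k} (hα : α.IsSmooth)
    (hz : z ∈ (chartAt E x₀).target) : α.d.inChart x₀ z = extDeriv (α.inChart x₀) z := by
  rw [(α.inChart_eventuallyEq x₀ hz).extDeriv_eq, extDeriv_pullback (r := 2)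
    (hα.differentiableAt_transition x₀ z) ((contDiffAt_transition x₀ hz).restrict_scalars ℝ)
    (by simp), fderiv_transition x₀ hz (mem_chart_source E _)]
  rfl

theorem DForm.IsSmooth.delBar_inChart {α : DForm E X k} (hα : α.IsSmooth)
    (hz : z ∈ (chartAt E x₀).target) :
    α.delBar.inChart x₀ z = AnomalyFlow.delBar (α.inChart x₀) z := by
  rw [delBar_congr (α.inChart_eventuallyEq x₀ hz), delBar_pullback
    (hα.differentiableAt_transition x₀ z) (contDiffAt_transition x₀ hz),
    fderiv_transition x₀ hz (mem_chart_source E _)]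
  rfl

theorem DForm.IsSmooth.del_inChart {α : DForm E X k} (hα : α.IsSmooth)
    (hz : z ∈ (chartAt E x₀).target) : α.del.inChart x₀ z = AnomalyFlow.del (α.inChart x₀) z := by
  rw [del_congr (α.inChart_eventuallyEq x₀ hz), del_pullback
    (hα.differentiableAt_transition x₀ z) (contDiffAt_transition x₀ hz),
    fderiv_transition x₀ hz (mem_chart_source E _)]
  rfl

theorem DForm.IsSmooth.delBar [FiniteDimensional ℂ E] {α : DForm E X k} (hα : α.IsSmooth) :
    α.delBar.IsSmooth := fun x₀ =>
  (contDiffOn_delBar (chartAt E x₀).open_target (hα x₀)).congr fun _ hz => hα.delBar_inChart hz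

theorem DForm.IsSmooth.iDelDelBar_inChart [FiniteDimensional ℂ E] {α : DForm E X k}
    (hα : α.IsSmooth) (hz : z ∈ (chartAt E x₀).target) :
    α.iDelDelBar.inChart x₀ z =
      Complex.I • AnomalyFlow.del (AnomalyFlow.delBar (α.inChart x₀)) z := by
  have h : α.delBar.inChart x₀ =ᶠ[nhds z] AnomalyFlow.delBar (α.inChart x₀) := by
    filter_upwards [(chartAt E x₀).open_target.eventually_mem hz] with y hy
    exact hα.delBar_inChart hy
  rw [← del_congr h, ← hα.delBar.del_inChart hz]
  rfl

end Smooth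

/-! ### The flow preserves the conformally balanced condition -/

section DelBar

variable {E : Type*} [NormedAddCommGroup E] [NormedSpace ℂ E] {k : ℕ}

variable (E) in
/-- The antilinear part, as a continuous linear map. -/
def antilinearPartCLM (W : Type*) [NormedAddCommGroup W] [NormedSpace ℂ W] :
    (E →L[ℝ] W) →L[ℝ] (E →L[ℝ] W) :=
  (1 / 2 : ℂ) • (ContinuousLinearMap.id ℝ (E →L[ℝ] W) +
    Complex.I • (ContinuousLinearMap.compL ℝ E E W).flip (mulI E))

theorem antilinearPartCLM_apply {W : Type*} [NormedAddCommGroup W] [NormedSpace ℂ W]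
    (L : E →L[ℝ] W) : antilinearPartCLM E W L = antilinearPart L := rfl

/-- Taking antilinear parts in both arguments keeps the second derivative symmetric, and alternation
kills symmetric maps. -/
theorem delBar_delBar {α : E → E [⋀^Fin k]→L[ℝ] ℂ} {z : E} (hα : ContDiffAt ℝ 2 α z) :
    delBar (delBar α) z = 0 := by
  have hd : DifferentiableAt ℝ (fderiv ℝ α) z :=
    (hα.fderiv_right (m := 1) (by norm_num)).differentiableAt (by simp)
  have hsymm : ∀ x y, fderiv ℝ (fderiv ℝ α) z x y = fderiv ℝ (fderiv ℝ α) z y x :=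
    hα.isSymmSndFDerivAt (by simp)
  set H := fderiv ℝ (fderiv ℝ α) z with hH
  set A := ContinuousAlternatingMap.alternatizeUncurryFinCLM ℝ E ℂ (n := k) with hA
  set P := antilinearPartCLM E (E [⋀^Fin k]→L[ℝ] ℂ) with hP
  have h1 : fderiv ℝ (delBar α) z = A ∘L (P ∘L H) :=
    ((A ∘L P).hasFDerivAt.comp z hd.hasFDerivAt).fderiv
  have h2 : antilinearPart (A ∘L (P ∘L H)) = A ∘L (antilinearPart (P ∘L H)) := by
    ext w v
    simp only [antilinearPart_apply, ContinuousLinearMap.comp_apply, hA,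
      ContinuousAlternatingMap.alternatizeUncurryFinCLM_apply,
      ContinuousAlternatingMap.alternatizeUncurryFin_smul,
      ContinuousAlternatingMap.alternatizeUncurryFin_add]
  rw [delBar, h1, h2]
  refine ContinuousAlternatingMap.alternatizeUncurryFin_alternatizeUncurryFinCLM_comp_of_symmetric
    fun x y => ?_
  rw [antilinearPart_apply, antilinearPart_apply]
  simp only [ContinuousLinearMap.comp_apply, hP, antilinearPartCLM_apply, smul_apply, add_apply,
    antilinearPart_apply]
  rw [hsymm x y, hsymm x (Complex.I • y), hsymm (Complex.I • x) y,
    hsymm (Complex.I • x) (Complex.I • y)]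
  module

/-- By ∂̄² = 0 the form ∂∂̄α equals d∂̄α near z, and d² = 0. -/
theorem extDeriv_del_delBar [FiniteDimensional ℝ E] {α : E → E [⋀^Fin k]→L[ℝ] ℂ} {U : Set E}
    (hU : IsOpen U) (hα : ContDiffOn ℝ ∞ α U) {z : E} (hz : z ∈ U) :
    extDeriv (del (delBar α)) z = 0 := by
  have h1 : del (delBar α) =ᶠ[nhds z] extDeriv (delBar α) := by
    filter_upwards [hU.eventually_mem hz] with y hy
    rw [extDeriv_eq_del_add_delBar, delBar_delBar, add_zero]
    exact (hα.contDiffAt (hU.mem_nhds hy)).of_le (ENat.LEInfty.out)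
  rw [h1.extDeriv_eq]
  exact extDeriv_extDeriv_apply (r := 2)
    (((contDiffOn_delBar hU hα).contDiffAt (hU.mem_nhds hz)).of_le (ENat.LEInfty.out)) (by simp)

theorem extDeriv_castForm {l : ℕ} (h : k = l) (α : E → E [⋀^Fin k]→L[ℝ] ℂ) (z : E)
    (hα : extDeriv α z = 0) : extDeriv (fun y => castForm h (α y)) z = 0 := by
  subst h
  exact hα

end DelBar

/-! ### Exchanging time and space derivatives -/

section TimeDerivative

variable {E : Type*} [NormedAddCommGroup E] [NormedSpace ℝ E]

theorem fderiv_prodMk_apply {a : ℝ × E → ℂ} {t : ℝ} {z : E} (ha : DifferentiableAt ℝ a (t, z))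
    (u : E) : fderiv ℝ (fun y => a (t, y)) z u = fderiv ℝ a (t, z) (0, u) := by
  have h : HasFDerivAt (fun y : E => (t, y)) (ContinuousLinearMap.inr ℝ ℝ E) z :=
    hasFDerivAt_prodMk_right t z
  have h2 := (ha.hasFDerivAt.comp z h).fderiv
  exact congrArg (fun L : E →L[ℝ] ℂ => L u) h2

/-- Both derivatives are mixed entries of the second derivative of a on space-time, which is
symmetric. Openness of S restricts this to interior times. -/
theorem hasDerivAt_fderiv_of_hasDerivAt {a : ℝ × E → ℂ} {S : Set ℝ} {U : Set E} (hS : IsOpen S)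
    (hU : IsOpen U) (ha : ContDiffOn ℝ ∞ a (S ×ˢ U)) {β : ℝ → E → ℂ}
    (h : ∀ t ∈ S, ∀ y ∈ U, HasDerivAt (fun s => a (s, y)) (β t y) t) {t : ℝ} (ht : t ∈ S)
    {z : E} (hz : z ∈ U) (u : E) :
    HasDerivAt (fun s => fderiv ℝ (fun y => a (s, y)) z u) (fderiv ℝ (β t) z u) t := by
  have hSU := hS.prod hU
  have hat {s : ℝ} {y : E} (hs : s ∈ S) (hy : y ∈ U) : ContDiffAt ℝ 2 a (s, y) :=
    (ha.contDiffAt (hSU.mem_nhds ⟨hs, hy⟩)).of_le (ENat.LEInfty.out)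
  have hda {s : ℝ} {y : E} (hs : s ∈ S) (hy : y ∈ U) : DifferentiableAt ℝ a (s, y) :=
    (hat hs hy).differentiableAt (by simp)
  have hd : HasFDerivAt (fderiv ℝ a) (fderiv ℝ (fderiv ℝ a) (t, z)) (t, z) :=
    (((hat ht hz).fderiv_right (m := 1) (by norm_num)).differentiableAt (by simp)).hasFDerivAt
  have hsymm : ∀ x y, fderiv ℝ (fderiv ℝ a) (t, z) x y = fderiv ℝ (fderiv ℝ a) (t, z) y x :=
    (hat ht hz).isSymmSndFDerivAt (by simp)
  have hl (s : ℝ) (y : E) : HasDerivAt (fun s : ℝ => (s, y)) ((1 : ℝ), (0 : E)) s :=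
    (hasDerivAt_id s).prodMk (hasDerivAt_const s y)
  have h1 : (fun s => fderiv ℝ (fun y => a (s, y)) z u) =ᶠ[nhds t]
      fun s => fderiv ℝ a (s, z) (0, u) := by
    filter_upwards [hS.eventually_mem ht] with s hs using fderiv_prodMk_apply (hda hs hz) u
  have h2 : β t =ᶠ[nhds z] fun y => fderiv ℝ a (t, y) (1, 0) := by
    filter_upwards [hU.eventually_mem hz] with y hy
    exact (h t ht y hy).unique ((hda ht hy).hasFDerivAt.comp_hasDerivAt t (hl t y))
  have h3 : fderiv ℝ (β t) z u = fderiv ℝ (fderiv ℝ a) (t, z) (0, u) (1, 0) := by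
    rw [h2.fderiv_eq]
    have h4 := (hd.comp z (hasFDerivAt_prodMk_right t z)).clm_apply
      (hasFDerivAt_const ((1 : ℝ), (0 : E)) z)
    refine (congrArg (fun L : E →L[ℝ] ℂ => L u) h4.fderiv).trans ?_
    simp
  rw [h3, hsymm]
  refine HasDerivAt.congr_of_eventuallyEq ?_ h1
  exact ((ContinuousLinearMap.apply ℝ ℂ ((0 : ℝ), u)).hasFDerivAt.comp (t, z) hd).comp_hasDerivAt t
    (hl t z)

/-- S need not be open here: the derivative within S × U is continuous up to the initial time, and
in space directions it is the ordinary derivative. This is how t = 0 is reached. -/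
theorem continuousOn_fderiv_prodMk {a : ℝ × E → ℂ} {S : Set ℝ} {U : Set E}
    (hS : UniqueDiffOn ℝ S) (hU : IsOpen U) (ha : ContDiffOn ℝ ∞ a (S ×ˢ U)) {z : E} (hz : z ∈ U)
    (u : E) : ContinuousOn (fun s => fderiv ℝ (fun y => a (s, y)) z u) S := by
  have h1 : ContinuousOn (fun s => fderivWithin ℝ a (S ×ˢ U) (s, z) (0, u)) S := by
    have h2 := ha.continuousOn_fderivWithin (hS.prod hU.uniqueDiffOn) (by simp)
    exact (h2.comp (f := fun s : ℝ => (s, z)) (by fun_prop) fun s hs => ⟨hs, hz⟩).clm_apply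
      continuousOn_const
  refine h1.congr fun s hs => ?_
  have h3 := ((ha.differentiableOn (by simp)) (s, z) ⟨hs, hz⟩).hasFDerivWithinAt
  have h4 := (h3.comp z (hasFDerivAt_prodMk_right s z).hasFDerivWithinAt
    fun y (hy : y ∈ U) => ⟨hs, hy⟩).hasFDerivAt (hU.mem_nhds hz)
  exact congrArg (fun L : E →L[ℝ] ℂ => L u) h4.fderiv

theorem eq_of_hasDerivAt_zero {f : ℝ → ℂ} {t : ℝ} (ht : 0 ≤ t)
    (hc : ContinuousOn f (Set.Icc 0 t)) (hd : ∀ s ∈ Set.Ioc 0 t, HasDerivAt f 0 s) :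
    f t = f 0 := by
  rcases ht.eq_or_lt with rfl | ht
  · rfl
  have h1 : ∀ s ∈ Set.Ioc 0 t, f s = f t := fun s hs =>
    (constant_of_has_deriv_right_zero (hc.mono (Set.Icc_subset_Icc_left hs.1.le))
      (fun x hx => (hd x ⟨hs.1.trans_le hx.1, hx.2.le⟩).hasDerivWithinAt) t ⟨hs.2, le_rfl⟩).symm
  have h2 : Filter.Tendsto f (nhdsWithin 0 (Set.Ioc 0 t)) (nhds (f 0)) :=
    ((hc 0 ⟨le_rfl, ht.le⟩).mono Set.Ioc_subset_Icc_self)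
  have h3 : Filter.Tendsto f (nhdsWithin 0 (Set.Ioc 0 t)) (nhds (f t)) :=
    tendsto_const_nhds.congr' (by
      filter_upwards [self_mem_nhdsWithin] with s hs using (h1 s hs).symm)
  have : (nhdsWithin 0 (Set.Ioc 0 t)).NeBot := by
    rw [nhdsWithin_Ioc_eq_nhdsGT ht]
    infer_instance
  exact tendsto_nhds_unique h3 h2

end TimeDerivative

/-! ### Conformal balance along the flow, and the stationary equation -/

section Flow

variable {E : Type*} [NormedAddCommGroup E] [NormedSpace ℂ E]
  {X : Type*} [TopologicalSpace X] [ChartedSpace E X] {n : ℕ}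

theorem HermitianMetric.contDiffOn_kahlerPow {F : Type*} [NormedAddCommGroup F] [NormedSpace ℝ F]
    {s : Set F} (g : F → HermitianMetric E X) (ζ : F → E) (x₀ : X) (b : Module.Basis (Fin n) ℂ E)
    (hg : ∀ p q, ContDiffOn ℝ ∞ (fun y => (g y).gram x₀ b (ζ y) p q) s) (p : ℕ)
    (v : Fin (2 * p) → E) :
    ContDiffOn ℝ ∞ (fun y => ((g y).kahlerPow p).inChart x₀ (ζ y) v) s := by
  simp only [fun y => (g y).kahlerPow_inChart_apply x₀ b p (ζ y) v]
  refine contDiffOn_const.mul ?_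
  unfold altSum
  exact ContDiffOn.sum fun σ _ => contDiffOn_const.mul (contDiffOn_pairProd b hg _)

theorem HermitianMetric.normMulPow_inChart_apply (g : HermitianMetric E X)
    (Ω : HolomorphicVolumeForm E X n) (x₀ : X) (z : E) (v : Fin (2 * (n - 1)) → E) :
    (g.normMulPow Ω).inChart x₀ z v =
      (g.normOf Ω ((chartAt E x₀).symm z) : ℂ) * (g.kahlerPow (n - 1)).inChart x₀ z v :=
  Complex.real_smul

variable [FiniteDimensional ℂ E]

theorem HermitianMetric.kahlerPow_isSmooth (g : HermitianMetric E X) (p : ℕ) :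
    (g.kahlerPow p).IsSmooth := fun x₀ => by
  have : FiniteDimensional ℝ E := FiniteDimensional.complexToReal E
  exact contDiffOn_form fun v => contDiffOn_kahlerPow (fun _ => g) id x₀ (Module.finBasis ℂ E)
    (g.contDiffOn_gram x₀ _) p v

variable [IsManifold 𝓘(ℂ, E) ω X]

theorem HermitianMetric.contDiffOn_normMulPow {F : Type*} [NormedAddCommGroup F] [NormedSpace ℝ F]
    {s : Set F} (g : F → HermitianMetric E X) (ζ : F → E) (Ω : HolomorphicVolumeForm E X n)
    (x₀ : X) (b : Module.Basis (Fin n) ℂ E) (hζ : ContDiffOn ℝ ∞ ζ s)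
    (hζs : Set.MapsTo ζ s (chartAt E x₀).target)
    (hg : ∀ p q, ContDiffOn ℝ ∞ (fun y => (g y).gram x₀ b (ζ y) p q) s)
    (v : Fin (2 * (n - 1)) → E) :
    ContDiffOn ℝ ∞ (fun y => ((g y).normMulPow Ω).inChart x₀ (ζ y) v) s := by
  simp only [normMulPow_inChart_apply]
  refine ContDiffOn.mul ?_ (contDiffOn_kahlerPow g ζ x₀ b hg _ v)
  exact Complex.ofRealCLM.contDiff.comp_contDiffOn (contDiffOn_normOf g ζ Ω x₀ b hζ hζs hg)

theorem HermitianMetric.normMulPow_isSmooth (g : HermitianMetric E X)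
    (Ω : HolomorphicVolumeForm E X n) (b : Module.Basis (Fin n) ℂ E) :
    (g.normMulPow Ω).IsSmooth := fun x₀ => by
  have : FiniteDimensional ℝ E := FiniteDimensional.complexToReal E
  exact contDiffOn_form fun v => contDiffOn_normMulPow (fun _ => g) id Ω x₀ b contDiffOn_id
    (Set.mapsTo_id _) (g.contDiffOn_gram x₀ _) v

theorem HermitianMetric.IsConformallyBalanced.extDeriv_eq_zero {g : HermitianMetric E X}
    {Ω : HolomorphicVolumeForm E X n} (h : g.IsConformallyBalanced Ω)
    (b : Module.Basis (Fin n) ℂ E) (x₀ : X) {z : E} (hz : z ∈ (chartAt E x₀).target) :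
    extDeriv ((g.normMulPow Ω).inChart x₀) z = 0 := by
  rw [← (g.normMulPow_isSmooth Ω b).d_inChart hz, DForm.inChart, h]
  rfl

/-- In a fixed chart every component of d(ν ω^(n-1)) has time derivative equal to a component of
d(i∂∂̄ω^(n-2)) = 0 at positive times. Continuity at time 0 links it to the initial value. -/
theorem IsAnomalyFlow.extDeriv_eq_zero {hn : 3 ≤ n} {Ω : HolomorphicVolumeForm E X n}
    {T : ℝ} {g : ℝ → HermitianMetric E X} (hflow : IsAnomalyFlow hn Ω g (Set.Ico 0 T))
    (hinit : (g 0).IsConformallyBalanced Ω) (b : Module.Basis (Fin n) ℂ E)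
    {t : ℝ} (ht : t ∈ Set.Ico 0 T) (x₀ : X) {z : E} (hz : z ∈ (chartAt E x₀).target) :
    extDeriv (((g t).normMulPow Ω).inChart x₀) z = 0 := by
  have : FiniteDimensional ℝ E := FiniteDimensional.complexToReal E
  have hU := (chartAt E x₀).open_target
  set U := (chartAt E x₀).target with hUdef
  have hgram (p q : Fin n) : ContDiffOn ℝ ∞ (fun y : ℝ × E => (g y.1).gram x₀ b y.2 p q)
      (Set.Ico 0 T ×ˢ U) := hflow.smooth x₀ (b p) (b q)
  have ha (w : Fin (2 * (n - 1)) → E) :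
      ContDiffOn ℝ ∞ (fun y : ℝ × E => ((g y.1).normMulPow Ω).inChart x₀ y.2 w)
      (Set.Ico 0 T ×ˢ U) :=
    HermitianMetric.contDiffOn_normMulPow (fun y : ℝ × E => g y.1) Prod.snd Ω x₀ b contDiffOn_snd
      (fun y hy => hy.2) hgram w
  have hcast : 2 * (n - 2) + 2 = 2 * (n - 1) := by omega
  let B : ℝ → E → E [⋀^Fin (2 * (n - 1))]→L[ℝ] ℂ := fun t y =>
    castForm hcast (Complex.I • del (delBar (((g t).kahlerPow (n - 2)).inChart x₀)) y)
  have hB {s : ℝ} (hs : s ∈ Set.Ioo 0 T) {y : E} (hy : y ∈ U) (w : Fin (2 * (n - 1)) → E) :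
      HasDerivAt (fun s => ((g s).normMulPow Ω).inChart x₀ y w) (B s y w) s := by
    have h1 := (hflow.evolution s ⟨hs.1.le, hs.2⟩ ((chartAt E x₀).symm y)
      fun i => chartInvDeriv x₀ y (w i)).hasDerivAt (Ico_mem_nhds hs.1 hs.2)
    refine h1.congr_deriv ?_
    have h2 := ((g s).kahlerPow_isSmooth (n - 2)).iDelDelBar_inChart hy
    change _ = castForm hcast _ w
    rw [← h2, castForm_apply, castForm_apply]
    rfl
  have hdB {s : ℝ} : extDeriv (B s) z = 0 := by
    refine extDeriv_castForm hcast _ z ?_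
    have h1 := extDeriv_del_delBar hU ((g s).kahlerPow_isSmooth (n - 2) x₀) hz
    have h2 : DifferentiableAt ℝ (del (delBar (((g s).kahlerPow (n - 2)).inChart x₀))) z :=
      differentiableAt_of_contDiffOn hU
        (contDiffOn_del hU (contDiffOn_delBar hU ((g s).kahlerPow_isSmooth (n - 2) x₀))) hz
    have h3 : fderiv ℝ (fun y => Complex.I • del (delBar (((g s).kahlerPow (n - 2)).inChart x₀)) y) z
        = Complex.I • fderiv ℝ (del (delBar (((g s).kahlerPow (n - 2)).inChart x₀))) z :=
      fderiv_const_smul h2 Complex.I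
    rw [extDeriv, h3, ContinuousAlternatingMap.alternatizeUncurryFin_smul]
    exact (congrArg _ h1).trans (smul_zero _)
  have hBsmooth {s : ℝ} : DifferentiableAt ℝ (B s) z := by
    have h2 := contDiffOn_del hU (contDiffOn_delBar hU ((g s).kahlerPow_isSmooth (n - 2) x₀))
    refine differentiableAt_of_contDiffOn hU (contDiffOn_form fun v => ?_) hz
    have h3 := contDiffOn_form_apply h2 (fun i => v (Fin.cast hcast i))
    refine (contDiffOn_const.mul h3 : ContDiffOn ℝ ∞ (fun y => Complex.I * _) U).congr fun y _ => ?_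
    change castForm hcast _ v = _
    rw [castForm_apply]
    rfl
  have hA (s : ℝ) : DifferentiableAt ℝ (((g s).normMulPow Ω).inChart x₀) z :=
    ((g s).normMulPow_isSmooth Ω b).differentiableAt hz
  ext v
  have hderiv (s : ℝ) (hs : s ∈ Set.Ioo 0 T) :
      HasDerivAt (fun s => extDeriv (((g s).normMulPow Ω).inChart x₀) z v) 0 s := by
    have h0 : extDeriv (B s) z v = 0 := by rw [hdB]; rfl
    rw [extDeriv_apply hBsmooth] at h0
    rw [← h0]
    simp only [fun s => extDeriv_apply (hA s) v]
    refine HasDerivAt.fun_sum fun i _ => HasDerivAt.const_smul _ ?_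
    refine hasDerivAt_fderiv_of_hasDerivAt
      (a := fun y : ℝ × E => ((g y.1).normMulPow Ω).inChart x₀ y.2 (i.removeNth v))
      (β := fun s y => B s y (i.removeNth v)) isOpen_Ioo hU
      ((ha _).mono (Set.prod_mono Set.Ioo_subset_Ico_self subset_rfl)) ?_ hs hz (v i)
    exact fun s hs y hy => hB hs hy _
  have hcont : ContinuousOn (fun s => extDeriv (((g s).normMulPow Ω).inChart x₀) z v)
      (Set.Ico 0 T) := by
    simp only [fun s => extDeriv_apply (hA s) v]
    refine continuousOn_finsetSum _ fun i _ => ContinuousOn.const_smul ?_ _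
    exact continuousOn_fderiv_prodMk (uniqueDiffOn_Ico 0 T) hU (ha (i.removeNth v)) hz (v i)
  have h1 := eq_of_hasDerivAt_zero ht.1 (hcont.mono (Set.Icc_subset_Ico_right ht.2))
    fun s hs => hderiv s ⟨hs.1, hs.2.trans_lt ht.2⟩
  rw [h1, hinit.extDeriv_eq_zero b x₀ hz]

theorem IsStationaryPoint.del_delBar_eq_zero {hn : 3 ≤ n} {Ω : HolomorphicVolumeForm E X n}
    {g : HermitianMetric E X} (hstat : IsStationaryPoint hn Ω g)
    (x₀ : X) {z : E} (hz : z ∈ (chartAt E x₀).target) :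
    del (delBar ((g.kahlerPow (n - 2)).inChart x₀)) z = 0 := by
  have hcast : 2 * (n - 2) + 2 = 2 * (n - 1) := by omega
  have h2 := (g.kahlerPow_isSmooth (n - 2)).iDelDelBar_inChart hz
  have h3 : (g.kahlerPow (n - 2)).iDelDelBar.inChart x₀ z = 0 := by
    ext w
    have h1 := hstat.evolution 0 Set.self_mem_Ici ((chartAt E x₀).symm z)
      fun i => chartInvDeriv x₀ z (w (Fin.cast hcast.symm i))
    -- The constant family has derivative zero, and one-sided derivatives at 0 are unique.
    have h4 := (uniqueDiffWithinAt_Ici (0 : ℝ)).eq_deriv _ h1 (hasDerivWithinAt_const _ _ _)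
    rw [castForm_apply] at h4
    exact h4
  rw [h2] at h3
  exact (smul_eq_zero.mp h3).resolve_left Complex.I_ne_zero

end Flow

/-! ### Constancy of the norm of the holomorphic volume form -/

section Constancy

/-- With dimension m + 3 the coefficients n - 2 and 2n - 5 become m + 1 and 2m + 1, visibly
positive, so the right-hand side is a positive combination of squared norms. -/
theorem nonneg_of_eq_mul_normSq {m n : ℕ} {ν : ℝ} (hν : 0 < ν) {Δ : ℂ} {t : Fin n → ℂ}
    {T : Fin n → Fin n → Fin n → ℂ}
    (h : (((m + 3 : ℕ) : ℂ) - 2) * Δ = (ν : ℂ) * ((2 * ((m + 3 : ℕ) : ℂ) - 5) *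
      ∑ l, t l * star (t l) + (1 / 2) * ∑ j, ∑ k, ∑ l, T j k l * star (T j k l))) :
    0 ≤ Δ.re ∧ (Δ.re = 0 → ∀ j k l, T j k l = 0) := by
  have hns (w : ℂ) : w * star w = (Complex.normSq w : ℂ) := Complex.mul_conj w
  simp only [hns] at h
  have h1 : ((m : ℝ) + 1) * Δ.re = ν * ((2 * m + 1) * ∑ l, Complex.normSq (t l) +
      (1 / 2) * ∑ j, ∑ k, ∑ l, Complex.normSq (T j k l)) := by
    have h2 : (((m : ℝ) + 1 : ℝ) : ℂ) * Δ = ((ν * ((2 * m + 1) * ∑ l, Complex.normSq (t l) +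
        (1 / 2) * ∑ j, ∑ k, ∑ l, Complex.normSq (T j k l)) : ℝ) : ℂ) := by
      push_cast at h ⊢
      rw [← sub_eq_zero] at h ⊢
      rw [← h]
      ring
    have h3 := congrArg Complex.re h2
    rwa [Complex.re_ofReal_mul, Complex.ofReal_re] at h3
  have ht0 : 0 ≤ ∑ l, Complex.normSq (t l) := Finset.sum_nonneg fun _ _ => Complex.normSq_nonneg _
  have hT0 : 0 ≤ ∑ j, ∑ k, ∑ l, Complex.normSq (T j k l) := Finset.sum_nonneg fun _ _ =>
    Finset.sum_nonneg fun _ _ => Finset.sum_nonneg fun _ _ => Complex.normSq_nonneg _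
  refine ⟨?_, fun h0 => ?_⟩
  · have : 0 ≤ ((m : ℝ) + 1) * Δ.re := by
      rw [h1]
      positivity
    exact nonneg_of_mul_nonneg_right this (by positivity)
  · rw [h0, mul_zero] at h1
    have h2 := (mul_eq_zero.mp h1.symm).resolve_left hν.ne'
    have h3 : 0 ≤ (2 * (m : ℝ) + 1) * ∑ l, Complex.normSq (t l) := by positivity
    have h4 : ∑ j, ∑ k, ∑ l, Complex.normSq (T j k l) = 0 := by linarith
    intro j k l
    have h5 := (Finset.sum_eq_zero_iff_of_nonneg fun _ _ => Finset.sum_nonneg fun _ _ =>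
      Finset.sum_nonneg fun _ _ => Complex.normSq_nonneg _).mp h4 j (Finset.mem_univ _)
    have h6 := (Finset.sum_eq_zero_iff_of_nonneg fun _ _ =>
      Finset.sum_nonneg fun _ _ => Complex.normSq_nonneg _).mp h5 k (Finset.mem_univ _)
    have h7 := (Finset.sum_eq_zero_iff_of_nonneg fun _ _ => Complex.normSq_nonneg _).mp h6 l
      (Finset.mem_univ _)
    exact Complex.normSq_eq_zero.mp h7

variable {E : Type*} [NormedAddCommGroup E] [NormedSpace ℂ E] [FiniteDimensional ℂ E]
  {X : Type*} [TopologicalSpace X] [ChartedSpace E X] [IsManifold 𝓘(ℂ, E) ω X] {m : ℕ}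

theorem HermitianMetric.contDiffOn_ofReal_normOf {n : ℕ} (g : HermitianMetric E X)
    (Ω : HolomorphicVolumeForm E X n) (x₀ : X) (b : Module.Basis (Fin n) ℂ E) :
    ContDiffOn ℝ ∞ (fun z => (g.normOf Ω ((chartAt E x₀).symm z) : ℂ)) (chartAt E x₀).target :=
  Complex.ofRealCLM.contDiff.comp_contDiffOn (contDiffOn_normOf (fun _ => g) id Ω x₀ b
    contDiffOn_id (Set.mapsTo_id _) (g.contDiffOn_gram x₀ b))

theorem HermitianMetric.laplacian_normOf (g : HermitianMetric E X)
    (Ω : HolomorphicVolumeForm E X (m + 3)) (x₀ : X)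
    (hbal : ∀ z ∈ (chartAt E x₀).target, extDeriv ((g.normMulPow Ω).inChart x₀) z = 0)
    (hast : ∀ z ∈ (chartAt E x₀).target, del (delBar ((g.kahlerPow (m + 1)).inChart x₀)) z = 0)
    {z : E} (hz : z ∈ (chartAt E x₀).target) (b : Module.Basis (Fin (m + 3)) ℂ E)
    (hb : ∀ i j, g.chartInner x₀ z (b i) (b j) = if i = j then 1 else 0) :
    (((m + 3 : ℕ) : ℂ) - 2) * ∑ j, wirtinger (wirtingerBar
      (fun y => (g.normOf Ω ((chartAt E x₀).symm y) : ℂ)) (b j)) (b j) z =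
      (g.normOf Ω ((chartAt E x₀).symm z) : ℂ) * ((2 * ((m + 3 : ℕ) : ℂ) - 5) *
        ∑ l, torsionTrace (fun j => wirtingerMat (g.gram x₀ b) (b j) z) l *
          star (torsionTrace (fun j => wirtingerMat (g.gram x₀ b) (b j) z) l) +
        (1 / 2) * ∑ j, ∑ k, ∑ l, torsion (fun j => wirtingerMat (g.gram x₀ b) (b j) z) j k l *
          star (torsion (fun j => wirtingerMat (g.gram x₀ b) (b j) z) j k l)) := by
  have : FiniteDimensional ℝ E := FiniteDimensional.complexToReal E
  have hU := (chartAt E x₀).open_target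
  have hI (p : ℕ) : Complex.I ^ p ≠ 0 := pow_ne_zero _ Complex.I_ne_zero
  have hν := g.contDiffOn_ofReal_normOf Ω x₀ b
  refine sum_wirtinger_wirtingerBar_eq_torsion b hU (g.contDiffOn_gram x₀ b)
    (fun y hy => g.isUnit_det_gram x₀ b hy) (fun y _ => g.star_gram x₀ b y) hν
    (fun y _ => Complex.conj_ofReal _)
    (fun y hy => Complex.ofReal_ne_zero.mpr (g.normOf_mul_self Ω x₀ b hy).1.ne') ?_ hz ?_ ?_
  · intro y hy k
    refine sum_wirtinger_of_extDeriv_eq_zero b (hI (m + 2)) hU (g.normMulPow_isSmooth Ω b x₀)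
      (fun y _ v => ?_) hν (g.contDiffOn_gram x₀ b) (fun y hy => g.isUnit_det_gram x₀ b hy) hy
      (hbal y hy) k
    refine (g.normMulPow_inChart_apply Ω x₀ y v).trans ?_
    rw [g.kahlerPow_inChart_apply x₀ b]
    exact mul_left_comm _ _ _
  · ext i j
    exact (hb i j).trans (Matrix.one_apply).symm
  · exact sum_wirtinger_wirtingerBar_of_del_delBar_eq_zero b (hI (m + 1)) hU
      (g.kahlerPow_isSmooth (m + 1) x₀) (fun y _ v => g.kahlerPow_inChart_apply x₀ b _ y v)
      (g.contDiffOn_gram x₀ b) (fun y hy => g.isUnit_det_gram x₀ b hy) hz (hast z hz)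

theorem HermitianMetric.laplacian_normOf_nonneg (g : HermitianMetric E X)
    (Ω : HolomorphicVolumeForm E X (m + 3)) (x₀ : X)
    (hbal : ∀ z ∈ (chartAt E x₀).target, extDeriv ((g.normMulPow Ω).inChart x₀) z = 0)
    (hast : ∀ z ∈ (chartAt E x₀).target, del (delBar ((g.kahlerPow (m + 1)).inChart x₀)) z = 0)
    {z : E} (hz : z ∈ (chartAt E x₀).target) (b : Module.Basis (Fin (m + 3)) ℂ E)
    (hb : ∀ i j, g.chartInner x₀ z (b i) (b j) = if i = j then 1 else 0) :
    0 ≤ (∑ j, wirtinger (wirtingerBar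
      (fun y => (g.normOf Ω ((chartAt E x₀).symm y) : ℂ)) (b j)) (b j) z).re ∧
    ((∑ j, wirtinger (wirtingerBar
      (fun y => (g.normOf Ω ((chartAt E x₀).symm y) : ℂ)) (b j)) (b j) z).re = 0 →
      ∀ j k l, torsion (fun j => wirtingerMat (g.gram x₀ b) (b j) z) j k l = 0) := by
  exact nonneg_of_eq_mul_normSq (g.normOf_mul_self Ω x₀ b hz).1
    (g.laplacian_normOf Ω x₀ hbal hast hz b hb)

theorem HermitianMetric.continuous_normOf {n : ℕ} (g : HermitianMetric E X)
    (Ω : HolomorphicVolumeForm E X n) (b : Module.Basis (Fin n) ℂ E) :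
    Continuous (g.normOf Ω) := by
  refine continuous_iff_continuousAt.mpr fun x => ?_
  have h1 : ContinuousAt (fun z => g.normOf Ω ((chartAt E x).symm z)) (chartAt E x x) :=
    (contDiffOn_normOf (fun _ => g) id Ω x b contDiffOn_id (Set.mapsTo_id _)
      (g.contDiffOn_gram x b)).continuousOn.continuousAt
      ((chartAt E x).open_target.mem_nhds (mem_chart_target E x))
  refine (h1.comp ((chartAt E x).continuousAt (mem_chart_source E x))).congr ?_
  filter_upwards [(chartAt E x).open_source.mem_nhds (mem_chart_source E x)] with y hy
  simp [(chartAt E x).left_inv hy]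

/-- X is not assumed connected, so the argument runs on the component of x, which is open and
compact. There the set where ν attains its maximum is closed by continuity and open by the strong
maximum principle. -/
theorem HermitianMetric.eventually_normOf_eq [CompactSpace X]
    (hE : Module.finrank ℂ E = m + 3) (g : HermitianMetric E X)
    (Ω : HolomorphicVolumeForm E X (m + 3))
    (hbal : ∀ x₀ : X, ∀ z ∈ (chartAt E x₀).target, extDeriv ((g.normMulPow Ω).inChart x₀) z = 0)
    (hast : ∀ x₀ : X, ∀ z ∈ (chartAt E x₀).target,
      del (delBar ((g.kahlerPow (m + 1)).inChart x₀)) z = 0) (x : X) :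
    ∀ᶠ y in nhds x, g.normOf Ω y = g.normOf Ω x := by
  let b : Module.Basis (Fin (m + 3)) ℂ E := (Module.finBasis ℂ E).reindex (finCongr hE)
  have : LocallyConnectedSpace X := ChartedSpace.locallyConnectedSpace E X
  have hcont := g.continuous_normOf Ω b
  set C := connectedComponent x with hC
  have hCo : IsOpen C := isOpen_connectedComponent
  have hCc : IsClosed C := isClosed_connectedComponent
  obtain ⟨p, hp, hpmax⟩ := hCc.isCompact.exists_isMaxOn ⟨x, mem_connectedComponent⟩
    hcont.continuousOn
  set M := {y | y ∈ C ∧ g.normOf Ω y = g.normOf Ω p} with hM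
  have hMc : IsClosed M := hCc.inter (isClosed_eq hcont continuous_const)
  have hMo : IsOpen M := by
    refine isOpen_iff_mem_nhds.mpr fun y hy => ?_
    set φ := chartAt E y with hφ
    set U := φ.target ∩ φ.symm ⁻¹' C with hU
    have hUo : IsOpen U := φ.isOpen_inter_preimage_symm hCo
    have hyU : φ y ∈ U := ⟨mem_chart_target E y, by
      simpa [hφ, φ.left_inv (mem_chart_source E y)] using hy.1⟩
    have hsymm : φ.symm (φ y) = y := φ.left_inv (mem_chart_source E y)
    have key := eventually_eq_of_isMaxOn hE (φ := fun z => g.normOf Ω (φ.symm z)) hUo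
      (((contDiffOn_normOf (fun _ => g) id Ω y b contDiffOn_id (Set.mapsTo_id _)
        (g.contDiffOn_gram y b)).of_le ENat.LEInfty.out).mono Set.inter_subset_left)
      (g.chartInner y) (fun v w => (g.smooth y v w).continuousOn.mono Set.inter_subset_left)
      (fun z _ => g.chartInner_symm y z) (fun z hz => g.chartInner_pos y hz.1)
      (fun z hz b' hb' => (g.laplacian_normOf_nonneg Ω y (hbal y) (hast y) hz.1 b' hb').1)
      hyU (fun z hz => by
        rw [hsymm, hy.2]
        exact hpmax hz.2)
    have h1 := (φ.continuousAt (mem_chart_source E y)).eventually key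
    filter_upwards [h1, hCo.mem_nhds hy.1, φ.open_source.mem_nhds (mem_chart_source E y)]
      with w hw hwC hws
    refine ⟨hwC, ?_⟩
    rw [φ.left_inv hws, hsymm] at hw
    exact hw.trans hy.2
  have hsub : C ⊆ M := by
    have h1 := (show IsClopen M from ⟨hMc, hMo⟩).connectedComponent_subset (show p ∈ M from ⟨hp, rfl⟩)
    rwa [← connectedComponent_eq hp] at h1
  filter_upwards [hCo.mem_nhds mem_connectedComponent] with y hy
  rw [(hsub hy).2, (hsub mem_connectedComponent).2]

end Constancy

/-! ### From constant norm to the Kähler and Ricci-flat conditions -/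

section Kahler

theorem altSum_eq_zero_of_swap {V : Type*} {k : ℕ} {m : (Fin k → V) → ℂ} {i j : Fin k}
    (hij : i ≠ j) (h : ∀ u, m (fun l => u (Equiv.swap i j l)) = m u) (v : Fin k → V) :
    altSum m v = 0 := by
  have h1 := altSum_comp_perm m (Equiv.swap i j) v
  simp only [h, Equiv.Perm.sign_swap hij] at h1
  push_cast at h1
  linear_combination (1 / 2 : ℂ) * h1

variable {E : Type*} [NormedAddCommGroup E] [NormedSpace ℂ E] {n : ℕ}

theorem sesq_eq_sum (b : Module.Basis (Fin n) ℂ E) (M : Matrix (Fin n) (Fin n) ℂ) (v w : E) :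
    sesq b M v w = ∑ j, ∑ k, (b.repr v j * star (b.repr w k)) * M j k := by
  rw [sesq, Finset.sum_comm]
  refine Finset.sum_congr rfl fun k _ => ?_
  rw [Finset.sum_mul]
  exact Finset.sum_congr rfl fun j _ => by ring

theorem star_sesq (b : Module.Basis (Fin n) ℂ E) {M : Matrix (Fin n) (Fin n) ℂ}
    (hM : ∀ p q, star (M p q) = M q p) (v w : E) : star (sesq b M v w) = sesq b M w v := by
  rw [sesq_eq_sum, sesq_eq_sum, Finset.sum_comm]
  simp only [star_sum]
  refine Finset.sum_congr rfl fun k _ => Finset.sum_congr rfl fun j _ => ?_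
  rw [star_mul', star_mul', hM, star_star, mul_comm (star _)]

theorem differentiableAt_sesq (b : Module.Basis (Fin n) ℂ E) {G : E → Matrix (Fin n) (Fin n) ℂ}
    {z : E} (hG : ∀ p q, DifferentiableAt ℝ (fun y => G y p q) z) (v w : E) :
    DifferentiableAt ℝ (fun y => sesq b (G y) v w) z := by
  simp only [sesq_eq_sum]
  exact DifferentiableAt.fun_sum fun j _ => DifferentiableAt.fun_sum fun k _ =>
    (hG j k).const_mul _

theorem wirtinger_sesq (b : Module.Basis (Fin n) ℂ E) {G : E → Matrix (Fin n) (Fin n) ℂ}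
    {z : E} (hG : ∀ p q, DifferentiableAt ℝ (fun y => G y p q) z) (u v w : E) :
    wirtinger (fun y => sesq b (G y) v w) u z = sesq b (wirtingerMat G u z) v w := by
  simp only [sesq_eq_sum]
  rw [wirtinger_sum u fun j _ => DifferentiableAt.fun_sum fun k _ => (hG j k).const_mul _]
  refine Finset.sum_congr rfl fun j _ => ?_
  rw [wirtinger_sum u fun k _ => (hG j k).const_mul _]
  exact Finset.sum_congr rfl fun k _ => wirtinger_const_mul u _ (hG j k)

/-- Vanishing torsion in a basis means symmetry of ∂ᵤ g(v, w) in u and v on basis vectors; both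
slots are complex linear, so the symmetry extends. -/
theorem wirtinger_sesq_comm (b : Module.Basis (Fin n) ℂ E) {G : E → Matrix (Fin n) (Fin n) ℂ}
    {z : E} (hG : ∀ p q, DifferentiableAt ℝ (fun y => G y p q) z)
    (htor : ∀ j k l, torsion (fun j => wirtingerMat G (b j) z) j k l = 0) (u v w : E) :
    wirtinger (fun y => sesq b (G y) v w) u z = wirtinger (fun y => sesq b (G y) u w) v z := by
  have h (u v : E) : wirtinger (fun y => sesq b (G y) v w) u z =
      ∑ i, ∑ j, b.repr u i * b.repr v j * ∑ k, star (b.repr w k) * wirtingerMat G (b i) z j k := by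
    rw [wirtinger_basis b]
    refine Finset.sum_congr rfl fun i _ => ?_
    rw [wirtinger_sesq b hG, sesq_eq_sum, Finset.mul_sum]
    refine Finset.sum_congr rfl fun j _ => ?_
    rw [Finset.mul_sum, Finset.mul_sum]
    exact Finset.sum_congr rfl fun k _ => by ring
  rw [h, h, Finset.sum_comm]
  refine Finset.sum_congr rfl fun j _ => Finset.sum_congr rfl fun i _ => ?_
  have h1 (k : Fin n) : wirtingerMat G (b i) z j k = wirtingerMat G (b j) z i k :=
    sub_eq_zero.mp (htor i j k)
  rw [mul_comm (b.repr u i)]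
  simp only [h1]

/-- In ∂ω the derivative direction and the linear slot of g can be exchanged, so alternation gives
zero. In ∂̄ω, after conjugation, the derivative direction is exchanged with the antilinear slot. -/
theorem extDeriv_eq_zero_of_torsion (b : Module.Basis (Fin n) ℂ E)
    {G : E → Matrix (Fin n) (Fin n) ℂ} {z : E}
    (hG : ∀ p q, DifferentiableAt ℝ (fun y => G y p q) z)
    (hherm : ∀ y p q, star (G y p q) = G y q p) {α : E → E [⋀^Fin 2]→L[ℝ] ℂ}
    (hα : DifferentiableAt ℝ α z)
    (h : ∀ y v, α y v = Complex.I * altSum (fun u => sesq b (G y) (u 0) (u 1)) v)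
    (htor : ∀ j k l, torsion (fun j => wirtingerMat G (b j) z) j k l = 0) :
    extDeriv α z = 0 := by
  have hs (v w : E) := differentiableAt_sesq b hG v w
  ext v
  rw [extDeriv_apply_of_altSum hα (m := fun y u => Complex.I * sesq b (G y) (u 0) (u 1))
    (Filter.Eventually.of_forall fun y v => (h y v).trans (altSum_const_mul _ _ _).symm)
    (fun u => (hs _ _).const_mul _), altSum_add]
  have h1 (u v w : E) : wirtinger (fun y => Complex.I * sesq b (G y) v w) u z =
      Complex.I * wirtinger (fun y => sesq b (G y) v w) u z := wirtinger_const_mul _ _ (hs _ _)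
  have h2 (u v w : E) : wirtingerBar (fun y => Complex.I * sesq b (G y) v w) u z =
      Complex.I * star (wirtinger (fun y => sesq b (G y) w v) u z) := by
    rw [wirtingerBar_const_mul _ _ (hs _ _), ← wirtingerBar_star _ (hs _ _)]
    simp only [star_sesq b (hherm _)]
  simp only [h1, h2]
  rw [altSum_eq_zero_of_swap (i := 0) (j := 1) (by decide), altSum_eq_zero_of_swap (i := 0) (j := 2)
    (by decide), add_zero]
  · rfl
  · intro u
    change Complex.I * star (wirtinger (fun y => sesq b (G y) (u 0) (u 1)) (u 2) z) =
      Complex.I * star (wirtinger (fun y => sesq b (G y) (u 2) (u 1)) (u 0) z)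
    rw [wirtinger_sesq_comm b hG htor]
  · intro u
    change Complex.I * wirtinger (fun y => sesq b (G y) (u 0) (u 2)) (u 1) z =
      Complex.I * wirtinger (fun y => sesq b (G y) (u 1) (u 2)) (u 0) z
    rw [wirtinger_sesq_comm b hG htor]

variable [FiniteDimensional ℂ E]
  {X : Type*} [TopologicalSpace X] [ChartedSpace E X]

theorem HermitianMetric.kahlerForm_isSmooth (g : HermitianMetric E X)
    (b : Module.Basis (Fin n) ℂ E) : g.kahlerForm.IsSmooth := fun x₀ => by
  have : FiniteDimensional ℝ E := FiniteDimensional.complexToReal E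
  refine contDiffOn_form fun v => ?_
  simp only [g.kahlerForm_inChart_apply x₀ b, altSum, sesq_eq_sum]
  exact contDiffOn_const.mul (ContDiffOn.sum fun σ _ => contDiffOn_const.mul
    (ContDiffOn.sum fun j _ => ContDiffOn.sum fun k _ =>
      contDiffOn_const.mul (g.contDiffOn_gram x₀ b j k)))

variable [IsManifold 𝓘(ℂ, E) ω X]

theorem HermitianMetric.torsion_eq_zero_of_normOf {m : ℕ} (g : HermitianMetric E X)
    (Ω : HolomorphicVolumeForm E X (m + 3)) (x₀ : X)
    (hbal : ∀ z ∈ (chartAt E x₀).target, extDeriv ((g.normMulPow Ω).inChart x₀) z = 0)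
    (hast : ∀ z ∈ (chartAt E x₀).target, del (delBar ((g.kahlerPow (m + 1)).inChart x₀)) z = 0)
    {z : E} (hz : z ∈ (chartAt E x₀).target) (b : Module.Basis (Fin (m + 3)) ℂ E)
    (hb : ∀ i j, g.chartInner x₀ z (b i) (b j) = if i = j then 1 else 0)
    (hconst : ∀ᶠ y in nhds z,
      g.normOf Ω ((chartAt E x₀).symm y) = g.normOf Ω ((chartAt E x₀).symm z)) (j k l) :
    torsion (fun j => wirtingerMat (g.gram x₀ b) (b j) z) j k l = 0 := by
  refine (g.laplacian_normOf_nonneg Ω x₀ hbal hast hz b hb).2 ?_ j k l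
  have h (v : E) : wirtingerBar (fun y => (g.normOf Ω ((chartAt E x₀).symm y) : ℂ)) v
      =ᶠ[nhds z] fun _ => 0 := by
    filter_upwards [hconst.eventually_nhds] with y hy
    rw [wirtingerBar_congr (g := fun _ => (g.normOf Ω ((chartAt E x₀).symm z) : ℂ)) v,
      wirtingerBar_const]
    filter_upwards [hy] with w hw using congrArg _ hw
  simp only [fun v => wirtinger_congr v (h v), wirtinger_const, Finset.sum_const_zero,
    Complex.zero_re]

/-- A Hermitian metric for which the norm of a holomorphic volume form is locally constant is
Ricci-flat. -/
theorem HermitianMetric.isRicciFlat_of_normOf (g : HermitianMetric E X)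
    (Ω : HolomorphicVolumeForm E X n)
    (hconst : ∀ x, ∀ᶠ y in nhds x, g.normOf Ω y = g.normOf Ω x) : g.IsRicciFlat n := by
  intro x₀ b z hz k j
  have hU := (chartAt E x₀).open_target
  have hG (p q : Fin n) : ContDiffOn ℝ ∞ (fun y => g.coeff x₀ b y p q) (chartAt E x₀).target :=
    g.contDiffOn_gram x₀ b q p
  have hdet {y : E} (hy : y ∈ (chartAt E x₀).target) : IsUnit (g.coeff x₀ b y).det := by
    rw [g.coeff_eq_gram, Matrix.det_transpose]
    exact g.isUnit_det_gram x₀ b hy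
  have hf := Ω.differentiableOn_chartCoeff x₀ b
  have hterm (p : Fin n) : DifferentiableAt ℝ (fun w => ∑ l, (g.coeff x₀ b w)⁻¹ p l *
      wirtinger (fun u => g.coeff x₀ b u l p) (b j) w) z :=
    differentiableAt_of_contDiffOn hU (ContDiffOn.sum fun l _ =>
      (contDiffOn_matrix_inv hG (fun y hy => hdet hy) p l).mul
        (contDiffOn_wirtinger (b j) hU (hG l p))) hz
  simp only [ricci, chernCurvature]
  rw [Finset.sum_neg_distrib, neg_eq_zero, ← wirtingerBar_sum _ fun p _ => hterm p]
  -- The traced connection form is ∂ⱼ log det G by Jacobi's formula. With ν constant, det G is a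
  -- constant times f f̄, and ∂ⱼ annihilates f̄, leaving ∂ⱼf / f.
  have hev : (fun w => ∑ p, ∑ l, (g.coeff x₀ b w)⁻¹ p l *
      wirtinger (fun u => g.coeff x₀ b u l p) (b j) w) =ᶠ[nhds z]
      fun w => fderiv ℂ (Ω.chartCoeff x₀ b) w (b j) / Ω.chartCoeff x₀ b w := by
    have hc := ((chartAt E x₀).continuousAt_symm hz).eventually
      (hconst ((chartAt E x₀).symm z))
    filter_upwards [hU.eventually_mem hz, hc.eventually_nhds] with w hw hcw
    have h1 : ∑ p, ∑ l, (g.coeff x₀ b w)⁻¹ p l *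
        wirtinger (fun u => g.coeff x₀ b u l p) (b j) w =
        ((g.coeff x₀ b w)⁻¹ * (wirtingerDerivation (b j) w).mat (g.coeff x₀ b)).trace := rfl
    have h2 := (wirtingerDerivation (b j) w).map_det (M := g.coeff x₀ b)
      (fun p q => differentiableAt_of_contDiffOn hU (hG p q) hw) (hdet hw)
    have hfw := (hf.differentiableAt (hU.mem_nhds hw))
    have hfr : DifferentiableAt ℝ (Ω.chartCoeff x₀ b) w := hfw.restrictScalars ℝ
    set c : ℂ := (g.normOf Ω ((chartAt E x₀).symm z) : ℂ) with hcdef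
    have hc0 : c ≠ 0 := Complex.ofReal_ne_zero.mpr (g.normOf_mul_self Ω x₀ b hz).1.ne'
    have h3 {y : E} (hy : y ∈ (chartAt E x₀).target)
        (hyc : g.normOf Ω ((chartAt E x₀).symm y) = g.normOf Ω ((chartAt E x₀).symm z)) :
        (g.coeff x₀ b y).det =
          (c ^ 2)⁻¹ * (Ω.chartCoeff x₀ b y * star (Ω.chartCoeff x₀ b y)) := by
      have := (g.normOf_mul_self Ω x₀ b hy).2
      rw [hyc] at this
      rw [← this, g.coeff_eq_gram, Matrix.det_transpose, ← hcdef,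
        inv_mul_cancel_left₀ (pow_ne_zero _ hc0)]
    have h4 : (wirtingerDerivation (b j) w).toFun (fun y => (g.coeff x₀ b y).det) =
        (c ^ 2)⁻¹ * (fderiv ℂ (Ω.chartCoeff x₀ b) w (b j) * star (Ω.chartCoeff x₀ b w)) := by
      rw [(wirtingerDerivation (b j) w).congr (g := fun y => (c ^ 2)⁻¹ *
        (Ω.chartCoeff x₀ b y * star (Ω.chartCoeff x₀ b y)))]
      · have hstar : DifferentiableAt ℝ (fun y => star (Ω.chartCoeff x₀ b y)) w := hfr.star
        rw [PointDerivation.map_const_mul _ _ (hfr.fun_mul hstar),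
          PointDerivation.map_mul _ hfr hstar]
        change _ * (wirtinger _ _ _ * _ + _ * wirtinger _ _ _) = _
        rw [wirtinger_star _ hfr, wirtingerBar_eq_zero _ hfw, star_zero, mul_zero, add_zero]
        congr 2
        have h5 := fderiv_eq_wirtinger_add (Ω.chartCoeff x₀ b) (b j) w
        rw [wirtingerBar_eq_zero _ hfw, add_zero] at h5
        rw [← h5, hfw.fderiv_restrictScalars ℝ]
        rfl
      · filter_upwards [hU.eventually_mem hw, hcw] with y hy hyc using h3 hy hyc
    rw [h1]
    rw [h4, h3 hw hcw.self_of_nhds] at h2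
    have hf0 := Ω.chartCoeff_ne_zero x₀ b hw
    have hf1 := star_ne_zero.mpr hf0
    rw [eq_div_iff hf0]
    have h6 : ((c ^ 2)⁻¹ * star (Ω.chartCoeff x₀ b w)) ≠ 0 :=
      mul_ne_zero (inv_ne_zero (pow_ne_zero _ hc0)) hf1
    refine mul_left_cancel₀ h6 ?_
    linear_combination -h2
  rw [wirtingerBar_congr _ hev]
  refine wirtingerBar_eq_zero _ ?_
  -- ∂ⱼf is itself holomorphic, hence so is the quotient ∂ⱼf / f.
  have h1 := (differentiableOn_fderiv_apply hU hf (b j)).differentiableAt (hU.mem_nhds hz)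
  simp only [div_eq_mul_inv]
  exact h1.fun_mul ((hf.differentiableAt (hU.mem_nhds hz)).inv (Ω.chartCoeff_ne_zero x₀ b hz))

end Kahler

end AnomalyFlow

end

/-! ### Stationary points are Kähler and Ricci-flat -/

theorem corollary1 {E : Type*} [NormedAddCommGroup E] [NormedSpace ℂ E]
    {n : ℕ} (hE : Module.finrank ℂ E = n) (hn : 3 ≤ n)
    {X : Type*} [TopologicalSpace X] [T2Space X] [CompactSpace X] [ChartedSpace E X]
    [IsManifold 𝓘(ℂ, E) ω X]
    (Ω : AnomalyFlow.HolomorphicVolumeForm E X n)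
    (T : ℝ) (g : ℝ → AnomalyFlow.HermitianMetric E X)
    (hflow : AnomalyFlow.IsAnomalyFlow hn Ω g (Set.Ico 0 T))
    (hinit : (g 0).IsConformallyBalanced Ω)
    (t₀ : ℝ) (ht₀ : t₀ ∈ Set.Ico 0 T)
    (hstat : AnomalyFlow.IsStationaryPoint hn Ω (g t₀)) :
    (g t₀).IsKahler ∧ (g t₀).IsRicciFlat n := by
  -- With n = m + 3 the truncated differences n - 1 and n - 2 in the degrees reduce to m + 2 and m +
  -- 1.
  obtain ⟨m, rfl⟩ : ∃ m, n = m + 3 := ⟨n - 3, by omega⟩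
  have : FiniteDimensional ℂ E := FiniteDimensional.of_finrank_pos (by omega)
  let b₀ : Module.Basis (Fin (m + 3)) ℂ E := (Module.finBasis ℂ E).reindex (finCongr hE)
  have hbal (x₀ : X) : ∀ z ∈ (chartAt E x₀).target,
      extDeriv (((g t₀).normMulPow Ω).inChart x₀) z = 0 :=
    fun z hz => hflow.extDeriv_eq_zero hinit b₀ ht₀ x₀ hz
  have hast (x₀ : X) : ∀ z ∈ (chartAt E x₀).target,
      AnomalyFlow.del (AnomalyFlow.delBar (((g t₀).kahlerPow (m + 1)).inChart x₀)) z = 0 :=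
    fun z hz => hstat.del_delBar_eq_zero x₀ hz
  have hconst := (g t₀).eventually_normOf_eq hE Ω hbal hast
  refine ⟨fun x => ?_, (g t₀).isRicciFlat_of_normOf Ω hconst⟩
  have hx := mem_chart_target E x
  -- The torsion identity assumes that the Gram matrix is the identity at the point, so the basis is
  -- adapted to each x separately.
  obtain ⟨b, hb⟩ := AnomalyFlow.exists_unitary_basis hE ((g t₀).chartInner x (chartAt E x x))
    ((g t₀).chartInner_symm x _) ((g t₀).chartInner_pos x hx)
  have htor := (g t₀).torsion_eq_zero_of_normOf Ω x (hbal x) (hast x) hx b hb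
    (((chartAt E x).continuousAt_symm hx).eventually (hconst _))
  have hd := AnomalyFlow.extDeriv_eq_zero_of_torsion b
    (fun p q => AnomalyFlow.differentiableAt_of_contDiffOn (chartAt E x).open_target
      ((g t₀).contDiffOn_gram x b p q) hx) ((g t₀).star_gram x b)
    (((g t₀).kahlerForm_isSmooth b).differentiableAt hx)
    ((g t₀).kahlerForm_inChart_apply x b) htor
  rw [AnomalyFlow.DForm.d, hd]
  rfl
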